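/- Let $(\mathcal C,\otimes,I,C)$ be a braided tensor category (written as a strict one), and let $H$ be a Hopf algebra in $\mathcal C$ with $C_{H,H}=C_{H,H}^{-1}$ which is finite, i.e. has a left dual $H^*$ with evaluation $d=d_H:H^*\otimes H\to I$ and coevaluation $b=b_H:I\to H\otimes H^*$. Give $H^*$ the multiplication, unit, comultiplication and counit that are the transposes of the comultiplication, counit, multiplication and unit of $H$, where $(H\otimes H)^*=H^*\otimes H^*$ through the evaluation $d(\mathrm{id}\otimes d\otimes \mathrm{id})$ and the coevaluation $(\mathrm{id}\otimes b\otimes\mathrm{id})b$. Let $A=(H^*)^{op}$, i.e. $H^*$ with the multiplication $m_{H^*}C_{H^*,H^*}$ instead of $m_{H^*}$, and let $\tau=d_H C_{H,A}:H\otimes A\to I$. Then: 1. $A$ is a Hopf algebra in $\mathcal C$. 2. $\tau$ is a skew pairing on $H\otimes A$, that is, $\tau(m\otimes \mathrm{id})=\tau(\mathrm{id}\otimes\tau\otimes \mathrm{id})(\mathrm{id}\otimes \mathrm{id}\otimes\Delta)$, $\tau(\mathrm{id}\otimes m)=(\tau\otimes\tau)(\mathrm{id}\otimes C_{H,A}\otimes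 \mathrm{id})(\Delta\otimes \mathrm{id}\otimes \mathrm{id})$, $\tau(\mathrm{id}\otimes\eta)=\epsilon_H$ and $\tau(\eta\otimes \mathrm{id})=\epsilon_A$. It is symmetric with respect to the braiding, that is, $(\mathrm{id}_U\otimes\tau)(C_{H,U}\otimes \mathrm{id}_A)=(\tau\otimes \mathrm{id}_U)(\mathrm{id}_H\otimes C_{U,A})$ for $U=H,A$, and it has a convolution inverse $\bar\tau:H\otimes A\to I$. 3. Put $\Delta_{H\otimes A}=(\mathrm{id}\otimes C_{H,A}\otimes \mathrm{id})(\Delta_H\otimes\Delta_A)$, $$\alpha=(\tau\otimes \mathrm{id}\otimes\bar\tau)(\mathrm{id}\otimes \mathrm{id}\otimes C_{H,A}\otimes \mathrm{id})(\mathrm{id}\otimes C_{H,A}\otimes\Delta)(\Delta\otimes\Delta):H\otimes A\to A,$$ $$\beta=(\tau\otimes \mathrm{id}\otimes\bar\tau)(\mathrm{id}\otimes C_{H,A}\otimes \mathrm{id}\otimes \mathrm{id})(\Delta\otimes C_{H,A}\otimes \mathrm{id})(\Delta\otimes\Delta):H\otimes A\to H.$$ Let the Drinfeld double $D=D(H)=A\bowtie_\tau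 H$ be the object $A\otimes H$ with multiplication $(m_A\otimes m_H)(\mathrm{id}\otimes\alpha\otimes\beta\otimes \mathrm{id})(\mathrm{id}\otimes\Delta_{H\otimes A}\otimes \mathrm{id})$, unit $\eta_A\otimes\eta_H$, comultiplication $(\mathrm{id}\otimes C_{A,H}\otimes \mathrm{id})(\Delta_A\otimes\Delta_H)$ and counit $\epsilon_A\otimes\epsilon_H$. Then $D$ is a Hopf algebra in $\mathcal C$ (in particular it has an antipode). 4. With $R=[b]=\eta_A\otimes b\otimes\eta_H:I\to D\otimes D$, the pair $(D,R)$ is quasi-triangular. That is, $R$ is convolution invertible in $\mathrm{Hom}_{\mathcal C}(I,D\otimes D)$, and, with $\bar\Delta=\Delta^{cop}=C_{D,D}\Delta$, $(D,\bar\Delta,\epsilon)$ is a coalgebra and $$(\bar\Delta\otimes \mathrm{id})R=(\mathrm{id}\otimes \mathrm{id}\otimes m)(\mathrm{id}\otimes R\otimes \mathrm{id})R,$$ $$(\mathrm{id}\otimes\Delta)R=(m\otimes \mathrm{id}\otimes \mathrm{id})(\mathrm{id}\otimes R\otimes \mathrm{id})R,$$ $$(m\otimes m)(\mathrm{id}\otimes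 C_{D,D}\otimes \mathrm{id})(\bar\Delta\otimes R)=(m\otimes m)(\mathrm{id}\otimes C_{D,D}\otimes \mathrm{id})(R\otimes\Delta).$$ -/

import Mathlib

open CategoryTheory MonoidalCategory
open scoped MonObj ComonObj

/-!
Hopf algebras in a braided tensor category `C` are Mathlib's `HopfObj`, and a left dual
`(U, d : U ⊗ V ⟶ 𝟙_ C, b : 𝟙_ C ⟶ V ⊗ U)` of `V` is `ExactPairing V U`.
Associators and unitors are inserted by the monoidal composition `⊗≫`.
-/

universe v u

namespace BraidedDouble

noncomputable section

section Dual

variable {C : Type u} [Category.{v} C] [MonoidalCategory C]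

/-- The transpose `f^* = (d ⊗ id) (id ⊗ f ⊗ id) (id ⊗ b) : V^* ⟶ U^*` of `f : U ⟶ V`, where
`U' = U^*` and `V' = V^*` are left duals. -/
def transpose {U U' V V' : C} [ExactPairing U U'] [ExactPairing V V'] (f : U ⟶ V) : V' ⟶ U' :=
  𝟙 V' ⊗≫ V' ◁ (η_ U U') ⊗≫ V' ◁ f ▷ U' ⊗≫ (ε_ V V') ▷ U' ⊗≫ 𝟙 U'

variable (H K : C) [ExactPairing H K]

/-- The multiplication of the dual `K = H^*`: the transpose of the comultiplication of `H`, where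
`(H ⊗ H)^* = H^* ⊗ H^*` has the (nested) evaluation `d (id ⊗ d ⊗ id)`. -/
def dualMul [ComonObj H] : K ⊗ K ⟶ K := transpose (Δ[H] : H ⟶ H ⊗ H)

/-- The unit of the dual `K = H^*`: the transpose of the counit of `H`. -/
def dualOne [ComonObj H] : 𝟙_ C ⟶ K := transpose (ε[H] : H ⟶ 𝟙_ C)

/-- The comultiplication of the dual `K = H^*`: the transpose of the multiplication of `H`. -/
def dualComul [MonObj H] : K ⟶ K ⊗ K := transpose (μ[H] : H ⊗ H ⟶ H)

/-- The counit of the dual `K = H^*`: the transpose of the unit of `H`. -/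
def dualCounit [MonObj H] : K ⟶ 𝟙_ C := transpose (η[H] : 𝟙_ C ⟶ H)

end Dual

variable {C : Type u} [Category.{v} C] [MonoidalCategory C] [BraidedCategory C]

/-- The opposite multiplication `m^op = m C_{A,A}`. -/
def opMul {A : C} (m : A ⊗ A ⟶ A) : A ⊗ A ⟶ A := (β_ A A).hom ≫ m

/-- The co-opposite comultiplication `Δ^cop = C_{A,A} Δ`. -/
def copComul {A : C} (δ : A ⟶ A ⊗ A) : A ⟶ A ⊗ A := δ ≫ (β_ A A).hom

/-- The Hopf algebra structure of `A = (H^*)^op`: the opposite multiplication of `H^*`, with the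
unit, comultiplication and counit of `H^*`. -/
structure IsDualOp (H A : C) [HopfObj H] [ExactPairing H A] [HopfObj A] : Prop where
  mul_eq : μ[A] = opMul (dualMul H A)
  one_eq : η[A] = dualOne H A
  comul_eq : Δ[A] = dualComul H A
  counit_eq : ε[A] = dualCounit H A

section Pairing

variable {H A : C}

/-- Skew pairings `τ : H ⊗ A ⟶ 𝟙_ C` of bialgebras. -/
structure IsSkewPairing [BimonObj H] [BimonObj A] (τ : H ⊗ A ⟶ 𝟙_ C) : Prop where
  /-- `τ (m ⊗ id) = τ (id ⊗ τ ⊗ id) (id ⊗ id ⊗ Δ)` -/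
  mul_left : μ[H] ▷ A ≫ τ = (H ⊗ H) ◁ Δ[A] ⊗≫ H ◁ τ ▷ A ⊗≫ τ
  /-- `τ (id ⊗ m) = (τ ⊗ τ) (id ⊗ C_{H,A} ⊗ id) (Δ ⊗ id ⊗ id)` -/
  mul_right : H ◁ μ[A] ≫ τ =
    Δ[H] ▷ (A ⊗ A) ⊗≫ H ◁ (β_ H A).hom ▷ A ⊗≫ (τ ⊗ₘ τ) ⊗≫ 𝟙 (𝟙_ C)
  /-- `τ (id ⊗ η) = ε_H` -/
  one_right : (ρ_ H).inv ≫ H ◁ η[A] ≫ τ = ε[H]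
  /-- `τ (η ⊗ id) = ε_A` -/
  one_left : (λ_ A).inv ≫ η[H] ▷ A ≫ τ = ε[A]

/-- `(id_U ⊗ τ) (C_{V,U} ⊗ id_W) = (τ ⊗ id_U) (id_V ⊗ C_{U,W})` for `τ : V ⊗ W ⟶ 𝟙_ C`. -/
def IsSymmetricAt {V W : C} (τ : V ⊗ W ⟶ 𝟙_ C) (U : C) : Prop :=
  (β_ V U).hom ▷ W ⊗≫ U ◁ τ ⊗≫ 𝟙 U = 𝟙 ((V ⊗ U) ⊗ W) ⊗≫ V ◁ (β_ U W).hom ⊗≫ τ ▷ U ⊗≫ 𝟙 U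

/-- `τ : V ⊗ W ⟶ 𝟙_ C` is symmetric with respect to the braiding. -/
def IsSymmetricPairing {V W : C} (τ : V ⊗ W ⟶ 𝟙_ C) : Prop :=
  IsSymmetricAt τ V ∧ IsSymmetricAt τ W

/-- `f` and `g` are inverse to each other in the convolution monoid of morphisms `X ⟶ Y`, from a
coalgebra `X` to an algebra `Y`. -/
def IsConvInverse {X Y : C} [ComonObj X] [MonObj Y] (f g : X ⟶ Y) : Prop :=
  (show Conv X Y from f) * (show Conv X Y from g) = 1 ∧
    (show Conv X Y from g) * (show Conv X Y from f) = 1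

end Pairing

section DoubleCross

variable {A H : C}

/-- `α = (τ ⊗ id ⊗ τ') (id ⊗ id ⊗ C_{H,A} ⊗ id) (id ⊗ C_{H,A} ⊗ Δ) (Δ ⊗ Δ) : H ⊗ A ⟶ A`. -/
def leftAct [ComonObj A] [ComonObj H] (τ τ' : H ⊗ A ⟶ 𝟙_ C) : H ⊗ A ⟶ A :=
  (Δ[H] ⊗ₘ Δ[A]) ⊗≫ H ◁ ((β_ H A).hom ⊗ₘ Δ[A]) ⊗≫ (H ⊗ A) ◁ ((β_ H A).hom ▷ A) ⊗≫
    (τ ⊗ₘ (A ◁ τ')) ⊗≫ 𝟙 A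

/-- `β = (τ ⊗ id ⊗ τ') (id ⊗ C_{H,A} ⊗ id ⊗ id) (Δ ⊗ C_{H,A} ⊗ id) (Δ ⊗ Δ) : H ⊗ A ⟶ H`. -/
def rightAct [ComonObj A] [ComonObj H] (τ τ' : H ⊗ A ⟶ 𝟙_ C) : H ⊗ A ⟶ H :=
  (Δ[H] ⊗ₘ Δ[A]) ⊗≫ (Δ[H] ⊗ₘ ((β_ H A).hom ▷ A)) ⊗≫ H ◁ ((β_ H A).hom ▷ (H ⊗ A)) ⊗≫
    (τ ⊗ₘ (H ◁ τ')) ⊗≫ 𝟙 H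

/-- The multiplication `(m_A ⊗ m_H) (id ⊗ α ⊗ β ⊗ id) (id ⊗ Δ_{H ⊗ A} ⊗ id)` of the double cross
product `A ⋈_τ H`, where `τ'` is the convolution inverse of `τ` and
`Δ_{H ⊗ A} = (id ⊗ C_{H,A} ⊗ id) (Δ_H ⊗ Δ_A)`. -/
def doubleCrossMul [MonObj A] [ComonObj A] [MonObj H] [ComonObj H] (τ τ' : H ⊗ A ⟶ 𝟙_ C) :
    (A ⊗ H) ⊗ (A ⊗ H) ⟶ A ⊗ H :=
  𝟙 ((A ⊗ H) ⊗ (A ⊗ H)) ⊗≫ A ◁ (Δ[H ⊗ A] ▷ H) ⊗≫ A ◁ ((leftAct τ τ' ⊗ₘ rightAct τ τ') ▷ H) ⊗≫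
    (μ[A] ⊗ₘ μ[H])

end DoubleCross

section Quasitriangular

variable (D : C)

attribute [local instance] ComonObj.instTensorUnit in
/-- `(D, R, δ)` is a quasi-triangular bialgebra. -/
structure IsQuasitriangularWith [BimonObj D] (R : 𝟙_ C ⟶ D ⊗ D) (δ : D ⟶ D ⊗ D) : Prop where
  /-- `R` is convolution invertible. -/
  invertible : ∃ R' : 𝟙_ C ⟶ D ⊗ D, IsConvInverse R R'
  /-- `(D, δ, ε)` is a coalgebra. -/
  coassoc : δ ≫ D ◁ δ = δ ≫ δ ▷ D ≫ (α_ D D D).hom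
  counit_left : δ ≫ ε[D] ▷ D = (λ_ D).inv
  counit_right : δ ≫ D ◁ ε[D] = (ρ_ D).inv
  /-- `(δ ⊗ id) R = (id ⊗ id ⊗ m) (id ⊗ R ⊗ id) R` -/
  qt1 : R ≫ δ ▷ D = R ⊗≫ D ◁ R ▷ D ⊗≫ (D ⊗ D) ◁ μ[D]
  /-- `(id ⊗ Δ) R = (m ⊗ id ⊗ id) (id ⊗ R ⊗ id) R` -/
  qt2 : R ≫ D ◁ Δ[D] = R ⊗≫ D ◁ R ▷ D ⊗≫ μ[D] ▷ (D ⊗ D)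
  /-- `(m ⊗ m) (id ⊗ C ⊗ id) (δ ⊗ R) = (m ⊗ m) (id ⊗ C ⊗ id) (R ⊗ Δ)` -/
  qt3 : 𝟙 D ⊗≫ (δ ⊗ₘ R) ⊗≫ D ◁ (β_ D D).hom ▷ D ⊗≫ (μ[D] ⊗ₘ μ[D]) =
    𝟙 D ⊗≫ (R ⊗ₘ Δ[D]) ⊗≫ D ◁ (β_ D D).hom ▷ D ⊗≫ (μ[D] ⊗ₘ μ[D])

/-- `(D, R)` is quasi-triangular if `(D, R, Δ^cop)` is. -/
def IsQuasitriangular [BimonObj D] (R : 𝟙_ C ⟶ D ⊗ D) : Prop :=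
  IsQuasitriangularWith D R (copComul Δ[D])

variable {D}

/-- The object `D` with multiplication `m`, unit `e`, comultiplication `δ` and counit `c` is a Hopf
algebra (there is an antipode, and it is unique), quasi-triangular with R-matrix `R`. -/
def IsQuasitriangularHopf (m : D ⊗ D ⟶ D) (e : 𝟙_ C ⟶ D) (δ : D ⟶ D ⊗ D) (c : D ⟶ 𝟙_ C)
    (R : 𝟙_ C ⟶ D ⊗ D) : Prop :=
  ∃ _ : HopfObj D, μ[D] = m ∧ η[D] = e ∧ Δ[D] = δ ∧ ε[D] = c ∧ IsQuasitriangular D R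

end Quasitriangular

section Drinfeld

variable (H A : C) [ExactPairing H A]

/-- `τ = d_H C_{H,A} : H ⊗ A ⟶ 𝟙_ C`. -/
def evalPairing : H ⊗ A ⟶ 𝟙_ C := (β_ H A).hom ≫ (ε_ H A)

/-- `[b] = η_A ⊗ b ⊗ η_H : 𝟙_ C ⟶ (A ⊗ H) ⊗ (A ⊗ H)`. -/
def coevalMatrix [MonObj H] [MonObj A] : 𝟙_ C ⟶ (A ⊗ H) ⊗ (A ⊗ H) :=
  𝟙 (𝟙_ C) ⊗≫ (η[A] ⊗ₘ ((η_ H A) ⊗ₘ η[H])) ⊗≫ 𝟙 ((A ⊗ H) ⊗ (A ⊗ H))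

end Drinfeld

end

end BraidedDouble

/-!
Objects with trivial double braiding are stable under tensor products and duals, so the hypothesis
on `H` makes the full monoidal subcategory generated by `H` and its dual `A` symmetric, and the
whole construction takes place there.

In a symmetric category the antipode of a finite Hopf monoid is invertible: `A` is a Hopf module
over `H`, and the projection onto coinvariants splits the antipode. Hence `H` with the opposite
comultiplication is a Hopf monoid, and `A` is its dual. Conjugation by the pairing `τ` in the
convolution monoid on `H ⊗ A`, followed by the braiding, is a distributive law `H ⊗ A ⟶ A ⊗ H`;
the monoid it defines on `A ⊗ H` is the double. The identity of the double is the convolution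
product of its projections to `A` and `H`, each of which is convolution invertible, and this gives
the antipode. The identities for `R` are checked after adjoining one tensor factor over the
pairing, where they become the defining properties of `τ` and of the distributive law.
-/

namespace BraidedDouble

open scoped HopfObj

/-! ### Morphisms of comonoids -/

section ComonHom

variable {C : Type u} [Category.{v} C] [MonoidalCategory C] [BraidedCategory C]

instance isComonHom_tensorHom {X X' Y Y' : C} [ComonObj X] [ComonObj X'] [ComonObj Y]
    [ComonObj Y'] (f : X ⟶ X') (g : Y ⟶ Y') [IsComonHom f] [IsComonHom g] :
    IsComonHom (f ⊗ₘ g) where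
  hom_counit := by
    simp only [Comon.tensorObj_counit, tensorHom_comp_tensorHom_assoc, IsComonHom.hom_counit]
  hom_comul := by
    simp only [Comon.tensorObj_comul, tensorHom_comp_tensorHom_assoc, IsComonHom.hom_comul,
      Category.assoc, ← tensorμ_natural]

instance isComonHom_whiskerRight {X X' : C} (Y : C) [ComonObj X] [ComonObj X'] [ComonObj Y]
    (f : X ⟶ X') [IsComonHom f] : IsComonHom (f ▷ Y) := by
  rw [← tensorHom_id]; infer_instance

instance isComonHom_whiskerLeft (X : C) {Y Y' : C} [ComonObj X] [ComonObj Y] [ComonObj Y']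
    (f : Y ⟶ Y') [IsComonHom f] : IsComonHom (X ◁ f) := by
  rw [← id_tensorHom]; infer_instance

instance isComonHom_associator (X Y Z : C) [ComonObj X] [ComonObj Y] [ComonObj Z] :
    IsComonHom (α_ X Y Z).hom := by
  have h : IsComonHom (𝟙 (X ⊗ Y) ▷ Z ≫ (α_ X Y Z).hom ≫ X ◁ 𝟙 (Y ⊗ Z)) :=
    (α_ (Comon.mk X) (Comon.mk Y) (Comon.mk Z)).hom.isComonHom_hom
  simpa using h

attribute [local instance] ComonObj.instTensorUnit

instance isComonHom_leftUnitor (X : C) [ComonObj X] : IsComonHom (λ_ X).hom where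
  hom_counit := by simp
  hom_comul := by
    simp only [Comon.tensorObj_comul, ComonObj.instTensorUnit_comul, tensorμ,
      braiding_tensorUnit_left, MonoidalCategory.tensorHom_def']
    monoidal

instance isComonHom_rightUnitor (X : C) [ComonObj X] : IsComonHom (ρ_ X).hom where
  hom_counit := by simp [unitors_equal]
  hom_comul := by
    simp only [Comon.tensorObj_comul, ComonObj.instTensorUnit_comul, tensorμ,
      braiding_tensorUnit_right, MonoidalCategory.tensorHom_def]
    monoidal

instance isComonHom_symm_hom {X Y : C} [ComonObj X] [ComonObj Y] (f : X ≅ Y) [IsComonHom f.hom] :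
    IsComonHom f.symm.hom :=
  inferInstanceAs (IsComonHom f.inv)

instance isComonHom_counit (X : C) [ComonObj X] : IsComonHom ε[X] where
  hom_counit := Category.comp_id _
  hom_comul := by
    rw [MonoidalCategory.tensorHom_def, ComonObj.counit_comul_assoc, ComonObj.instTensorUnit_comul,
      leftUnitor_inv_naturality]

instance isComonHom_mul (X : C) [BimonObj X] : IsComonHom μ[X] where

instance isComonHom_one (X : C) [BimonObj X] : IsComonHom η[X] where
  hom_counit := by simp
  hom_comul := by simp [MonObj.tensorObj.one_def, ComonObj.instTensorUnit_comul]

end ComonHom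

section CounitProjections

variable {C : Type u} [Category.{v} C] [MonoidalCategory C] [BraidedCategory C] (X Y : C)
  [ComonObj X] [ComonObj Y]

attribute [local instance] ComonObj.instTensorUnit

/-- The projection `x ⊗ y ↦ x ε(y)`. -/
def counitFst : X ⊗ Y ⟶ X := X ◁ ε[Y] ≫ (ρ_ X).hom

/-- The projection `x ⊗ y ↦ ε(x) y`. -/
def counitSnd : X ⊗ Y ⟶ Y := ε[X] ▷ Y ≫ (λ_ Y).hom

instance isComonHom_counitFst : IsComonHom (counitFst X Y) := by
  unfold counitFst; infer_instance

instance isComonHom_counitSnd : IsComonHom (counitSnd X Y) := by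
  unfold counitSnd; infer_instance

lemma comul_counitFst_counitSnd :
    Δ[X ⊗ Y] ≫ (counitFst X Y ⊗ₘ counitSnd X Y) = 𝟙 (X ⊗ Y) := by
  have h : counitFst X Y ⊗ₘ counitSnd X Y =
      ((𝟙 X ⊗ₘ ε[Y]) ⊗ₘ (ε[X] ⊗ₘ 𝟙 Y)) ≫ ((ρ_ X).hom ⊗ₘ (λ_ Y).hom) := by
    simp [counitFst, counitSnd]
  rw [h, Comon.tensorObj_comul, Category.assoc, ← tensorμ_natural_assoc]
  simp only [tensorHom_comp_tensorHom_assoc, id_tensorHom, tensorHom_id,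
    ComonObj.comul_counit, ComonObj.counit_comul, tensorμ, braiding_tensorUnit_left]
  monoidal

lemma comul_counitSnd_counitFst :
    Δ[X ⊗ Y] ≫ (counitSnd X Y ⊗ₘ counitFst X Y) = (β_ X Y).hom := by
  have h : counitSnd X Y ⊗ₘ counitFst X Y =
      ((ε[X] ⊗ₘ 𝟙 Y) ⊗ₘ (𝟙 X ⊗ₘ ε[Y])) ≫ ((λ_ Y).hom ⊗ₘ (ρ_ X).hom) := by
    simp [counitFst, counitSnd]
  rw [h, Comon.tensorObj_comul, Category.assoc, ← tensorμ_natural_assoc]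
  simp only [tensorHom_comp_tensorHom_assoc, id_tensorHom, tensorHom_id,
    ComonObj.comul_counit, ComonObj.counit_comul, tensorμ]
  monoidal

end CounitProjections

section SymmetricComonoids

variable {C : Type u} [Category.{v} C] [MonoidalCategory C] [SymmetricCategory C]

lemma counit_braiding (X Y : C) [ComonObj X] [ComonObj Y] :
    (β_ X Y).hom ≫ ε[Y ⊗ X] = ε[X ⊗ Y] := by
  rw [Comon.tensorObj_counit, Comon.tensorObj_counit, ← BraidedCategory.braiding_naturality_assoc,
    braiding_leftUnitor, unitors_equal]

lemma tensorμ_comp_braiding_tensor_braiding (X Y : C) :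
    tensorμ X X Y Y ≫ ((β_ X Y).hom ⊗ₘ (β_ X Y).hom) =
      (β_ (X ⊗ X) (Y ⊗ Y)).hom ≫ tensorμ Y Y X X := by
  have h : Y ◁ (β_ X Y).hom ▷ X ≫ Y ◁ (β_ Y X).hom ▷ X = 𝟙 _ := by
    simp only [← whiskerLeft_comp, ← comp_whiskerRight, SymmetricCategory.symmetry,
      id_whiskerRight, whiskerLeft_id]
  calc
    _ = 𝟙 _ ⊗≫ X ◁ (β_ X Y).hom ▷ Y ⊗≫ (β_ X Y).hom ▷ (X ⊗ Y) ⊗≫ Y ◁ X ◁ (β_ X Y).hom ⊗≫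
        𝟙 _ := by
      simp only [tensorμ, MonoidalCategory.tensorHom_def]; monoidal
    _ = 𝟙 _ ⊗≫ X ◁ (β_ X Y).hom ▷ Y ⊗≫ (β_ X Y).hom ▷ (X ⊗ Y) ⊗≫ Y ◁ X ◁ (β_ X Y).hom ⊗≫
        (Y ◁ (β_ X Y).hom ▷ X ≫ Y ◁ (β_ Y X).hom ▷ X) ⊗≫ 𝟙 _ := by
      rw [h]; monoidal
    _ = _ := by
      simp only [tensorμ, BraidedCategory.braiding_tensor_right_hom,
        BraidedCategory.braiding_tensor_left_hom]
      monoidal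

instance isComonHom_braiding (X Y : C) [ComonObj X] [ComonObj Y] :
    IsComonHom (β_ X Y).hom where
  hom_counit := counit_braiding X Y
  hom_comul := by
    rw [Comon.tensorObj_comul, Comon.tensorObj_comul, Category.assoc,
      tensorμ_comp_braiding_tensor_braiding, BraidedCategory.braiding_naturality_assoc]

end SymmetricComonoids

/-! ### Convolution units and conjugation -/

section ConvFunctoriality

variable {C : Type u} [Category.{v} C] [MonoidalCategory C]

/-- The morphism underlying an element of a convolution monoid. -/
def convHom {X N : C} (u : Conv X N) : X ⟶ N := u

lemma convHom_mul {X N : C} [ComonObj X] [MonObj N] (u v : Conv X N) :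
    convHom (u * v) = Δ[X] ≫ convHom u ▷ X ≫ N ◁ convHom v ≫ μ[N] := rfl

lemma convHom_one {X N : C} [ComonObj X] [MonObj N] :
    convHom (1 : Conv X N) = ε[X] ≫ η[N] := rfl

/-- Precomposition with a morphism of comonoids is a homomorphism of convolution monoids. -/
def convComap {X Y : C} [ComonObj X] [ComonObj Y] (N : C) [MonObj N] (f : X ⟶ Y) [IsComonHom f] :
    Conv Y N →* Conv X N where
  toFun u := f ≫ convHom u
  map_one' := by
    change f ≫ ε[Y] ≫ η[N] = ε[X] ≫ η[N]
    simp
  map_mul' u v := by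
    change f ≫ Δ[Y] ≫ convHom u ▷ Y ≫ N ◁ convHom v ≫ μ[N] =
      Δ[X] ≫ (f ≫ convHom u) ▷ X ≫ N ◁ (f ≫ convHom v) ≫ μ[N]
    rw [IsComonHom.hom_comul_assoc, MonoidalCategory.tensorHom_def']
    simp only [comp_whiskerRight, whiskerLeft_comp, Category.assoc]
    rw [whisker_exchange_assoc, whisker_exchange_assoc]

lemma convHom_convComap {X Y : C} [ComonObj X] [ComonObj Y] {N : C} [MonObj N] (f : X ⟶ Y)
    [IsComonHom f] (u : Conv Y N) : convHom (convComap N f u) = f ≫ convHom u := rfl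

/-- Postcomposition with a morphism of monoids is a homomorphism of convolution monoids. -/
def convMap (X : C) [ComonObj X] {N N' : C} [MonObj N] [MonObj N'] (f : N ⟶ N') [IsMonHom f] :
    Conv X N →* Conv X N' where
  toFun u := convHom u ≫ f
  map_one' := by
    change (ε[X] ≫ η[N]) ≫ f = ε[X] ≫ η[N']
    simp
  map_mul' u v := by
    change (Δ[X] ≫ convHom u ▷ X ≫ N ◁ convHom v ≫ μ[N]) ≫ f =
      Δ[X] ≫ (convHom u ≫ f) ▷ X ≫ N' ◁ (convHom v ≫ f) ≫ μ[N']
    simp only [comp_whiskerRight, whiskerLeft_comp, Category.assoc, IsMonHom.mul_hom,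
      MonoidalCategory.tensorHom_def]
    rw [whisker_exchange_assoc]

end ConvFunctoriality

section Actions

variable {C : Type u} [Category.{v} C] [MonoidalCategory C] {X Y : C} [ComonObj X] [ComonObj Y]

/-- The left action `x ↦ u(x₁) x₂`. -/
def lact (u : Conv X (𝟙_ C)) : X ⟶ X := Δ[X] ≫ convHom u ▷ X ≫ (λ_ X).hom

/-- The right action `x ↦ x₁ u(x₂)`. -/
def ract (u : Conv X (𝟙_ C)) : X ⟶ X := Δ[X] ≫ X ◁ convHom u ≫ (ρ_ X).hom

lemma lact_comul (u : Conv X (𝟙_ C)) : lact u ≫ Δ[X] = Δ[X] ≫ lact u ▷ X := by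
  simp only [lact]
  generalize convHom u = f
  calc
    _ = Δ[X] ≫ (f ▷ X ≫ 𝟙_ C ◁ Δ[X]) ⊗≫ 𝟙 _ := by monoidal
    _ = (Δ[X] ≫ X ◁ Δ[X]) ⊗≫ f ▷ X ▷ X ⊗≫ 𝟙 _ := by rw [← whisker_exchange]; monoidal
    _ = _ := by rw [ComonObj.comul_assoc]; monoidal

lemma ract_comul (u : Conv X (𝟙_ C)) : ract u ≫ Δ[X] = Δ[X] ≫ X ◁ ract u := by
  simp only [ract]
  generalize convHom u = f
  calc
    _ = Δ[X] ≫ (X ◁ f ≫ Δ[X] ▷ 𝟙_ C) ⊗≫ 𝟙 _ := by monoidal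
    _ = (Δ[X] ≫ Δ[X] ▷ X ≫ (α_ X X X).hom) ⊗≫ X ◁ X ◁ f ⊗≫ 𝟙 _ := by
      rw [whisker_exchange]; monoidal
    _ = _ := by rw [← ComonObj.comul_assoc]; monoidal

lemma comul_ract_whiskerRight (u : Conv X (𝟙_ C)) :
    Δ[X] ≫ ract u ▷ X = Δ[X] ≫ X ◁ lact u := by
  simp only [lact, ract]
  generalize convHom u = f
  calc
    _ = (Δ[X] ≫ Δ[X] ▷ X ≫ (α_ X X X).hom) ⊗≫ X ◁ f ▷ X ⊗≫ 𝟙 _ := by monoidal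
    _ = _ := by rw [← ComonObj.comul_assoc]; monoidal

lemma lact_mul (u v : Conv X (𝟙_ C)) : lact (u * v) = lact u ≫ lact v := by
  have h : lact u ≫ lact v = (lact u ≫ Δ[X]) ≫ convHom v ▷ X ≫ (λ_ X).hom := by
    simp [lact]
  rw [h, lact_comul]
  simp only [lact, convHom_mul]
  generalize convHom u = f
  generalize convHom v = g
  change Δ[X] ≫ (Δ[X] ≫ f ▷ X ≫ (𝟙_ C) ◁ g ≫ (λ_ _).hom) ▷ X ≫ (λ_ X).hom = _
  monoidal

lemma ract_mul (u v : Conv X (𝟙_ C)) : ract (u * v) = ract v ≫ ract u := by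
  have h : ract v ≫ ract u = (ract v ≫ Δ[X]) ≫ X ◁ convHom u ≫ (ρ_ X).hom := by
    simp [ract]
  rw [h, ract_comul]
  simp only [ract, convHom_mul]
  generalize convHom u = f
  generalize convHom v = g
  change Δ[X] ≫ X ◁ (Δ[X] ≫ f ▷ X ≫ (𝟙_ C) ◁ g ≫ (λ_ _).hom) ≫ (ρ_ X).hom = _
  rw [← whisker_exchange_assoc]
  monoidal

lemma lact_one : lact (1 : Conv X (𝟙_ C)) = 𝟙 X := by
  simp [lact, convHom_one]

lemma ract_one : ract (1 : Conv X (𝟙_ C)) = 𝟙 X := by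
  simp [ract, convHom_one]

lemma lact_ract_comm (u v : Conv X (𝟙_ C)) : lact u ≫ ract v = ract v ≫ lact u := by
  have h : lact u ≫ ract v = (lact u ≫ Δ[X]) ≫ X ◁ convHom v ≫ (ρ_ X).hom := by
    simp [ract]
  rw [h, lact_comul, Category.assoc, ← whisker_exchange_assoc]
  simp [ract]

lemma comp_lact (f : X ⟶ Y) [IsComonHom f] (u : Conv Y (𝟙_ C)) :
    f ≫ lact u = lact (convComap _ f u) ≫ f := by
  simp only [lact, convHom_convComap, IsComonHom.hom_comul_assoc, Category.assoc,
    comp_whiskerRight, MonoidalCategory.tensorHom_def']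
  rw [← leftUnitor_naturality, whisker_exchange_assoc, whisker_exchange_assoc]

lemma comp_ract (f : X ⟶ Y) [IsComonHom f] (u : Conv Y (𝟙_ C)) :
    f ≫ ract u = ract (convComap _ f u) ≫ f := by
  simp only [ract, convHom_convComap, IsComonHom.hom_comul_assoc, Category.assoc,
    whiskerLeft_comp, MonoidalCategory.tensorHom_def]
  rw [← rightUnitor_naturality, ← whisker_exchange_assoc, ← whisker_exchange_assoc]

lemma ract_counit (u : Conv X (𝟙_ C)) : ract u ≫ ε[X] = convHom u := by
  rw [ract, Category.assoc, Category.assoc, ← rightUnitor_naturality, whisker_exchange_assoc,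
    ComonObj.counit_comul_assoc]
  simp [← unitors_equal]

lemma lact_convHom (u v : Conv X (𝟙_ C)) : lact u ≫ convHom v = convHom (u * v) := by
  simp [lact, convHom_mul]

/-- The conjugation `x ↦ u(x₁) x₂ u⁻¹(x₃)`. -/
def conj (u : (Conv X (𝟙_ C))ˣ) : X ⟶ X := lact u.1 ≫ ract (u⁻¹).1

lemma conj_mul (u v : (Conv X (𝟙_ C))ˣ) : conj (u * v) = conj u ≫ conj v := by
  simp only [conj, Units.val_mul, mul_inv_rev, lact_mul, ract_mul, Category.assoc]
  rw [← Category.assoc (lact v.1), lact_ract_comm]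
  simp only [Category.assoc]

lemma conj_one : conj (1 : (Conv X (𝟙_ C))ˣ) = 𝟙 X := by
  simp [conj, lact_one, ract_one]

lemma comp_conj (f : X ⟶ Y) [IsComonHom f] (u : (Conv Y (𝟙_ C))ˣ) :
    f ≫ conj u = conj (Units.map (convComap _ f) u) ≫ f := by
  rw [conj, ← Category.assoc, comp_lact, Category.assoc, comp_ract, conj, Category.assoc]
  rfl

lemma ract_conj (u : (Conv X (𝟙_ C))ˣ) : ract u.1 ≫ conj u = lact u.1 := by
  rw [conj, lact_ract_comm, ← Category.assoc, ← ract_mul, Units.inv_mul, ract_one, Category.id_comp]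

instance isComonHom_conj (u : (Conv X (𝟙_ C))ˣ) : IsComonHom (conj u) where
  hom_counit := by
    rw [conj, Category.assoc, ract_counit, lact_convHom, Units.mul_inv, convHom_one]
    simp
  hom_comul := by
    have h : X ◁ lact (u⁻¹).1 ≫ X ◁ lact u.1 = 𝟙 _ := by
      rw [← whiskerLeft_comp, ← lact_mul, Units.inv_mul, lact_one, whiskerLeft_id]
    calc
      _ = Δ[X] ≫ X ◁ ract (u⁻¹).1 ≫ lact u.1 ▷ X := by
        rw [conj, Category.assoc, ract_comul, ← Category.assoc, lact_comul, Category.assoc,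
          whisker_exchange]
      _ = Δ[X] ≫ X ◁ lact (u⁻¹).1 ≫ X ◁ lact u.1 ≫ X ◁ ract (u⁻¹).1 ≫ lact u.1 ▷ X := by
        rw [reassoc_of% h]
      _ = Δ[X] ≫ ract (u⁻¹).1 ▷ X ≫ X ◁ lact u.1 ≫ X ◁ ract (u⁻¹).1 ≫ lact u.1 ▷ X := by
        rw [← Category.assoc (Δ[X]), ← comul_ract_whiskerRight, Category.assoc]
      _ = _ := by
        have h' : conj u ⊗ₘ conj u =
            (ract (u⁻¹).1 ▷ X ≫ lact u.1 ▷ X) ≫ X ◁ lact u.1 ≫ X ◁ ract (u⁻¹).1 := by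
          rw [MonoidalCategory.tensorHom_def, ← comp_whiskerRight, ← whiskerLeft_comp,
            ← lact_ract_comm]
          rfl
        simp only [h', Category.assoc, whisker_exchange, whisker_exchange_assoc]

end Actions

section TensorActions

variable {C : Type u} [Category.{v} C] [MonoidalCategory C] [BraidedCategory C] (X Y : C)
    [ComonObj X] [ComonObj Y]

attribute [local instance] ComonObj.instTensorUnit

lemma whiskerLeft_lact (u : Conv Y (𝟙_ C)) :
    X ◁ lact u = lact (convComap _ (counitSnd X Y) u) := by
  simp only [lact, convHom_convComap, Comon.tensorObj_comul]
  generalize convHom u = f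
  have h : ((counitSnd X Y) ≫ f) ▷ (X ⊗ Y) =
      ((ε[X] ⊗ₘ f) ⊗ₘ (𝟙 X ⊗ₘ 𝟙 Y)) ≫ (λ_ (𝟙_ C)).hom ▷ (X ⊗ Y) := by
    simp [counitSnd, MonoidalCategory.tensorHom_def]
  rw [h, Category.assoc, Category.assoc, ← tensorμ_natural_assoc, ← leftUnitor_monoidal]
  simp only [tensorHom_comp_tensorHom, tensorHom_id,
    ComonObj.counit_comul_assoc, Iso.inv_hom_id]
  simp

lemma whiskerLeft_ract (u : Conv Y (𝟙_ C)) :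
    X ◁ ract u = ract (convComap _ (counitSnd X Y) u) := by
  simp only [ract, convHom_convComap, Comon.tensorObj_comul]
  generalize convHom u = f
  have h : (X ⊗ Y) ◁ ((counitSnd X Y) ≫ f) =
      ((𝟙 X ⊗ₘ 𝟙 Y) ⊗ₘ (ε[X] ⊗ₘ f)) ≫ (X ⊗ Y) ◁ (λ_ (𝟙_ C)).hom := by
    simp [counitSnd, MonoidalCategory.tensorHom_def]
  rw [h, Category.assoc, Category.assoc, ← tensorμ_natural_assoc, ← rightUnitor_monoidal]
  simp only [tensorHom_comp_tensorHom, id_tensorHom,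
    ComonObj.comul_counit_assoc, Iso.inv_hom_id]

lemma lact_whiskerRight (u : Conv X (𝟙_ C)) :
    lact u ▷ Y = lact (convComap _ (counitFst X Y) u) := by
  simp only [lact, convHom_convComap, Comon.tensorObj_comul]
  generalize convHom u = f
  have h : ((counitFst X Y) ≫ f) ▷ (X ⊗ Y) =
      ((f ⊗ₘ ε[Y]) ⊗ₘ (𝟙 X ⊗ₘ 𝟙 Y)) ≫ (λ_ (𝟙_ C)).hom ▷ (X ⊗ Y) := by
    simp [counitFst, MonoidalCategory.tensorHom_def', unitors_equal]
  rw [h, Category.assoc, Category.assoc, ← tensorμ_natural_assoc, ← leftUnitor_monoidal]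
  simp only [tensorHom_comp_tensorHom, tensorHom_id,
    ComonObj.counit_comul_assoc, Iso.inv_hom_id]

lemma ract_whiskerRight (u : Conv X (𝟙_ C)) :
    ract u ▷ Y = ract (convComap _ (counitFst X Y) u) := by
  simp only [ract, convHom_convComap, Comon.tensorObj_comul]
  generalize convHom u = f
  have h : (X ⊗ Y) ◁ ((counitFst X Y) ≫ f) =
      ((𝟙 X ⊗ₘ 𝟙 Y) ⊗ₘ (f ⊗ₘ ε[Y])) ≫ (X ⊗ Y) ◁ (λ_ (𝟙_ C)).hom := by
    simp [counitFst, MonoidalCategory.tensorHom_def', unitors_equal]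
  rw [h, Category.assoc, Category.assoc, ← tensorμ_natural_assoc, ← rightUnitor_monoidal]
  simp only [tensorHom_comp_tensorHom, id_tensorHom,
    ComonObj.comul_counit_assoc, Iso.inv_hom_id]
  simp

lemma whiskerLeft_conj (u : (Conv Y (𝟙_ C))ˣ) :
    X ◁ conj u = conj (Units.map (convComap _ (counitSnd X Y)) u) := by
  rw [conj, whiskerLeft_comp, whiskerLeft_lact, whiskerLeft_ract]
  rfl

lemma conj_whiskerRight (u : (Conv X (𝟙_ C))ˣ) :
    conj u ▷ Y = conj (Units.map (convComap _ (counitFst X Y)) u) := by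
  rw [conj, comp_whiskerRight, lact_whiskerRight, ract_whiskerRight]
  rfl

end TensorActions

section HopfUnits

variable {C : Type u} [Category.{v} C] [MonoidalCategory C] [BraidedCategory C]

/-- The identity of a Hopf monoid as a convolution unit, with the antipode as its inverse. -/
def idUnit (H : C) [HopfObj H] : (Conv H H)ˣ where
  val := 𝟙 H
  inv := 𝒮[H]
  val_inv := by
    change Δ[H] ≫ 𝟙 H ▷ H ≫ H ◁ 𝒮[H] ≫ μ[H] = ε[H] ≫ η[H]
    rw [id_whiskerRight, Category.id_comp, HopfObj.antipode_right]
  inv_val := by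
    change Δ[H] ≫ 𝒮[H] ▷ H ≫ H ◁ 𝟙 H ≫ μ[H] = ε[H] ≫ η[H]
    rw [whiskerLeft_id, Category.id_comp, HopfObj.antipode_left]

/-- The Hopf monoid given by a convolution inverse of the identity of a bimonoid. -/
abbrev hopfObjOfUnit {D : C} [BimonObj D] (u : (Conv D D)ˣ) (hu : convHom u.1 = 𝟙 D) :
    HopfObj D where
  antipode := convHom (u⁻¹).1
  antipode_left := by
    have h : convHom ((u⁻¹).1 * u.1) = ε[D] ≫ η[D] := congrArg convHom u.inv_mul
    rwa [convHom_mul, hu, whiskerLeft_id, Category.id_comp] at h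
  antipode_right := by
    have h : convHom (u.1 * (u⁻¹).1) = ε[D] ≫ η[D] := congrArg convHom u.mul_inv
    rwa [convHom_mul, hu, id_whiskerRight, Category.id_comp] at h

/-- The convolution unit `x ⊗ y ↦ u(x) v(y)`, with inverse `x ⊗ y ↦ v⁻¹(y) u⁻¹(x)`. -/
def mulUnit {X Y D : C} [ComonObj X] [ComonObj Y] [MonObj D] (u : (Conv X D)ˣ)
    (v : (Conv Y D)ˣ) : (Conv (X ⊗ Y) D)ˣ :=
  Units.map (convComap D (counitFst X Y)) u * Units.map (convComap D (counitSnd X Y)) v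

lemma convHom_mulUnit {X Y D : C} [ComonObj X] [ComonObj Y] [MonObj D] (u : (Conv X D)ˣ)
    (v : (Conv Y D)ˣ) :
    convHom (mulUnit u v).1 = (convHom u.1 ⊗ₘ convHom v.1) ≫ μ[D] := by
  have h : Δ[X ⊗ Y] ≫ ((counitFst X Y ≫ convHom u.1) ⊗ₘ (counitSnd X Y ≫ convHom v.1)) =
      convHom u.1 ⊗ₘ convHom v.1 := by
    rw [← tensorHom_comp_tensorHom, ← Category.assoc, comul_counitFst_counitSnd, Category.id_comp]
  rw [← h, Category.assoc, MonoidalCategory.tensorHom_def, Category.assoc]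
  rfl

end HopfUnits

/-! ### Distributive laws and cross products -/

section DistributiveLaws

variable {C : Type u} [Category.{v} C] [MonoidalCategory C] {A H : C} [MonObj A] [MonObj H]

/-- A distributive law `H ⊗ A ⟶ A ⊗ H` between monoids. -/
structure IsDistributiveLaw (ψ : H ⊗ A ⟶ A ⊗ H) : Prop where
  mul_left : μ[H] ▷ A ≫ ψ =
    (α_ H H A).hom ≫ H ◁ ψ ≫ (α_ H A H).inv ≫ ψ ▷ H ≫ (α_ A H H).hom ≫ A ◁ μ[H]
  mul_right : H ◁ μ[A] ≫ ψ =
    (α_ H A A).inv ≫ ψ ▷ A ≫ (α_ A H A).hom ≫ A ◁ ψ ≫ (α_ A A H).inv ≫ μ[A] ▷ H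
  one_left : η[H] ▷ A ≫ ψ = (λ_ A).hom ≫ (ρ_ A).inv ≫ A ◁ η[H]
  one_right : H ◁ η[A] ≫ ψ = (ρ_ H).hom ≫ (λ_ H).inv ≫ η[A] ▷ H

/-- The multiplication on `A ⊗ H` defined by `ψ : H ⊗ A ⟶ A ⊗ H`. -/
def crossMul (ψ : H ⊗ A ⟶ A ⊗ H) : (A ⊗ H) ⊗ (A ⊗ H) ⟶ A ⊗ H :=
  𝟙 _ ⊗≫ A ◁ ψ ▷ H ⊗≫ (μ[A] ⊗ₘ μ[H])

variable {ψ : H ⊗ A ⟶ A ⊗ H}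

lemma IsDistributiveLaw.one_crossMul (h : IsDistributiveLaw ψ) :
    ((λ_ (𝟙_ C)).inv ≫ (η[A] ⊗ₘ η[H])) ▷ (A ⊗ H) ≫ crossMul ψ = (λ_ (A ⊗ H)).hom := by
  calc
    _ = 𝟙 _ ⊗≫ η[A] ▷ (A ⊗ H) ⊗≫ A ◁ (η[H] ▷ A ≫ ψ) ▷ H ⊗≫ (μ[A] ⊗ₘ μ[H]) := by
      simp only [MonoidalCategory.tensorHom_def, crossMul]; monoidal
    _ = 𝟙 _ ⊗≫ η[A] ▷ (A ⊗ H) ⊗≫ ((A ⊗ A) ◁ η[H] ▷ H ≫ (μ[A] ▷ _)) ⊗≫ A ◁ μ[H] := by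
      rw [h.one_left, MonoidalCategory.tensorHom_def]; monoidal
    _ = 𝟙 _ ⊗≫ (η[A] ▷ A ≫ μ[A]) ▷ H ⊗≫ A ◁ (η[H] ▷ H ≫ μ[H]) := by
      rw [whisker_exchange]; monoidal
    _ = _ := by rw [MonObj.one_mul, MonObj.one_mul]; monoidal

lemma IsDistributiveLaw.crossMul_one (h : IsDistributiveLaw ψ) :
    (A ⊗ H) ◁ ((λ_ (𝟙_ C)).inv ≫ (η[A] ⊗ₘ η[H])) ≫ crossMul ψ = (ρ_ (A ⊗ H)).hom := by
  calc
    _ = 𝟙 _ ⊗≫ (A ⊗ H) ◁ η[H] ⊗≫ A ◁ (H ◁ η[A] ≫ ψ) ▷ H ⊗≫ (μ[A] ⊗ₘ μ[H]) := by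
      simp only [MonoidalCategory.tensorHom_def', crossMul]; monoidal
    _ = 𝟙 _ ⊗≫ (A ⊗ H) ◁ η[H] ⊗≫ ((A ◁ η[A]) ▷ (H ⊗ H) ≫ (A ⊗ A) ◁ μ[H]) ⊗≫ μ[A] ▷ H := by
      rw [h.one_right, MonoidalCategory.tensorHom_def']; monoidal
    _ = 𝟙 _ ⊗≫ A ◁ (H ◁ η[H] ≫ μ[H]) ⊗≫ (A ◁ η[A] ≫ μ[A]) ▷ H := by
      rw [← whisker_exchange]; monoidal
    _ = _ := by rw [MonObj.mul_one, MonObj.mul_one]; monoidal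

lemma IsDistributiveLaw.crossMul_whiskerRight_crossMul (h : IsDistributiveLaw ψ) :
    crossMul ψ ▷ (A ⊗ H) ≫ crossMul ψ =
      𝟙 _ ⊗≫ A ◁ ψ ▷ (H ⊗ A ⊗ H) ⊗≫ (A ⊗ A) ◁ H ◁ ψ ▷ H ⊗≫ (A ⊗ A) ◁ ψ ▷ (H ⊗ H) ⊗≫
        (μ[A] ▷ A ≫ μ[A]) ▷ (H ⊗ H ⊗ H) ⊗≫ A ◁ (μ[H] ▷ H ≫ μ[H]) := by
  calc
    _ = 𝟙 _ ⊗≫ A ◁ ψ ▷ (H ⊗ A ⊗ H) ⊗≫ μ[A] ▷ (H ⊗ H ⊗ A ⊗ H) ⊗≫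
        A ◁ (μ[H] ▷ A ≫ ψ) ▷ H ⊗≫ (μ[A] ⊗ₘ μ[H]) := by
      simp only [MonoidalCategory.tensorHom_def, crossMul]; monoidal
    _ = 𝟙 _ ⊗≫ A ◁ ψ ▷ (H ⊗ A ⊗ H) ⊗≫ (μ[A] ▷ _ ≫ _ ◁ (H ◁ ψ ▷ H)) ⊗≫
        A ◁ ψ ▷ (H ⊗ H) ⊗≫ A ◁ A ◁ μ[H] ▷ H ⊗≫ (μ[A] ⊗ₘ μ[H]) := by
      rw [h.mul_left]; monoidal
    _ = 𝟙 _ ⊗≫ A ◁ ψ ▷ (H ⊗ A ⊗ H) ⊗≫ (A ⊗ A) ◁ H ◁ ψ ▷ H ⊗≫ (μ[A] ▷ _ ≫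
        _ ◁ (ψ ▷ (H ⊗ H))) ⊗≫ A ◁ A ◁ μ[H] ▷ H ⊗≫ (μ[A] ⊗ₘ μ[H]) := by
      rw [← whisker_exchange]; monoidal
    _ = 𝟙 _ ⊗≫ A ◁ ψ ▷ (H ⊗ A ⊗ H) ⊗≫ (A ⊗ A) ◁ H ◁ ψ ▷ H ⊗≫ (A ⊗ A) ◁ ψ ▷ (H ⊗ H) ⊗≫
        (μ[A] ▷ A ≫ μ[A]) ▷ (H ⊗ H ⊗ H) ⊗≫ A ◁ (μ[H] ▷ H ≫ μ[H]) := by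
      have e : (A ⊗ A) ◁ (μ[H] ▷ H ≫ μ[H]) ≫ μ[A] ▷ H = μ[A] ▷ _ ≫ _ := whisker_exchange _ _
      rw [← whisker_exchange, MonoidalCategory.tensorHom_def']
      calc
        _ = 𝟙 _ ⊗≫ A ◁ ψ ▷ (H ⊗ A ⊗ H) ⊗≫ (A ⊗ A) ◁ H ◁ ψ ▷ H ⊗≫ (A ⊗ A) ◁ (ψ ▷ (H ⊗ H)) ⊗≫
            μ[A] ▷ (A ⊗ H ⊗ H ⊗ H) ⊗≫ ((A ⊗ A) ◁ (μ[H] ▷ H ≫ μ[H]) ≫ μ[A] ▷ H) := by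
          monoidal
        _ = _ := by
          rw [e]; monoidal

lemma IsDistributiveLaw.whiskerLeft_crossMul_crossMul (h : IsDistributiveLaw ψ) :
    (α_ (A ⊗ H) (A ⊗ H) (A ⊗ H)).hom ≫ (A ⊗ H) ◁ crossMul ψ ≫ crossMul ψ =
      𝟙 _ ⊗≫ A ◁ ψ ▷ (H ⊗ A ⊗ H) ⊗≫ (A ⊗ A) ◁ H ◁ ψ ▷ H ⊗≫ (A ⊗ A) ◁ ψ ▷ (H ⊗ H) ⊗≫
        (A ◁ μ[A] ≫ μ[A]) ▷ (H ⊗ H ⊗ H) ⊗≫ A ◁ (H ◁ μ[H] ≫ μ[H]) := by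
  symm
  calc
    _ = 𝟙 _ ⊗≫ A ◁ (ψ ▷ (H ⊗ A) ≫ (A ⊗ H) ◁ ψ) ▷ H ⊗≫ (A ⊗ A) ◁ ψ ▷ (H ⊗ H) ⊗≫
        (A ◁ μ[A] ≫ μ[A]) ▷ (H ⊗ H ⊗ H) ⊗≫ A ◁ (H ◁ μ[H] ≫ μ[H]) := by
      monoidal
    _ = 𝟙 _ ⊗≫ (A ⊗ H ⊗ A) ◁ ψ ▷ H ⊗≫ A ◁ ψ ▷ (A ⊗ H ⊗ H) ⊗≫ (A ⊗ A) ◁ ψ ▷ (H ⊗ H) ⊗≫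
        (A ◁ μ[A] ≫ μ[A]) ▷ (H ⊗ H ⊗ H) ⊗≫ A ◁ (H ◁ μ[H] ≫ μ[H]) := by
      rw [← whisker_exchange]; monoidal
    _ = 𝟙 _ ⊗≫ (A ⊗ H ⊗ A) ◁ ψ ▷ H ⊗≫ A ◁ ψ ▷ (A ⊗ H ⊗ H) ⊗≫
        A ◁ (A ◁ ψ ⊗≫ μ[A] ▷ H) ▷ (H ⊗ H) ⊗≫ (μ[A] ▷ _ ≫ A ◁ (H ◁ μ[H] ≫ μ[H])) := by
      monoidal
    _ = 𝟙 _ ⊗≫ (A ⊗ H ⊗ A) ◁ ψ ▷ H ⊗≫ A ◁ ((H ◁ μ[A] ≫ ψ) ▷ (H ⊗ H) ≫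
        (A ⊗ H) ◁ μ[H]) ⊗≫ (μ[A] ⊗ₘ μ[H]) := by
      rw [← whisker_exchange, MonoidalCategory.tensorHom_def', h.mul_right]; monoidal
    _ = 𝟙 _ ⊗≫ (A ⊗ H ⊗ A) ◁ ψ ▷ H ⊗≫ (A ⊗ H) ◁ (A ⊗ A) ◁ μ[H] ⊗≫
        (A ⊗ H) ◁ μ[A] ▷ H ⊗≫ A ◁ ψ ▷ H ⊗≫ (μ[A] ⊗ₘ μ[H]) := by
      rw [← whisker_exchange]; monoidal
    _ = _ := by
      simp only [MonoidalCategory.tensorHom_def', crossMul]; monoidal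

lemma IsDistributiveLaw.crossMul_assoc (h : IsDistributiveLaw ψ) :
    crossMul ψ ▷ (A ⊗ H) ≫ crossMul ψ =
      (α_ (A ⊗ H) (A ⊗ H) (A ⊗ H)).hom ≫ (A ⊗ H) ◁ crossMul ψ ≫ crossMul ψ := by
  rw [h.crossMul_whiskerRight_crossMul, h.whiskerLeft_crossMul_crossMul, MonObj.mul_assoc,
    MonObj.mul_assoc]
  monoidal

variable (A H) in
/-- The inclusion `a ↦ a ⊗ 1`. -/
def unitInl : A ⟶ A ⊗ H := (ρ_ A).inv ≫ A ◁ η[H]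

variable (A H) in
/-- The inclusion `h ↦ 1 ⊗ h`. -/
def unitInr : H ⟶ A ⊗ H := (λ_ H).inv ≫ η[A] ▷ H

lemma IsDistributiveLaw.unitInl_tensorHom_unitInl_crossMul (h : IsDistributiveLaw ψ) :
    (unitInl A H ⊗ₘ unitInl A H) ≫ crossMul ψ =
      μ[A] ≫ unitInl A H := by
  calc
    _ = 𝟙 _ ⊗≫ (A ⊗ A) ◁ η[H] ⊗≫ A ◁ (η[H] ▷ A ≫ ψ) ▷ H ⊗≫ (μ[A] ⊗ₘ μ[H]) := by
      simp only [unitInl, MonoidalCategory.tensorHom_def', crossMul]; monoidal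
    _ = 𝟙 _ ⊗≫ (A ⊗ A) ◁ η[H] ⊗≫ (A ⊗ A) ◁ (η[H] ▷ H ≫ μ[H]) ⊗≫ μ[A] ▷ H := by
      rw [h.one_left, MonoidalCategory.tensorHom_def']; monoidal
    _ = 𝟙 _ ⊗≫ ((A ⊗ A) ◁ η[H] ≫ μ[A] ▷ H) := by
      rw [MonObj.one_mul]; monoidal
    _ = _ := by rw [unitInl, whisker_exchange]; monoidal

lemma IsDistributiveLaw.unitInr_tensorHom_unitInr_crossMul (h : IsDistributiveLaw ψ) :
    (unitInr A H ⊗ₘ unitInr A H) ≫ crossMul ψ =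
      μ[H] ≫ unitInr A H := by
  calc
    _ = 𝟙 _ ⊗≫ η[A] ▷ (H ⊗ H) ⊗≫ A ◁ (H ◁ η[A] ≫ ψ) ▷ H ⊗≫ (μ[A] ⊗ₘ μ[H]) := by
      simp only [unitInr, MonoidalCategory.tensorHom_def, crossMul]; monoidal
    _ = 𝟙 _ ⊗≫ η[A] ▷ (H ⊗ H) ⊗≫ (A ◁ η[A] ≫ μ[A]) ▷ (H ⊗ H) ⊗≫ A ◁ μ[H] := by
      rw [h.one_right, MonoidalCategory.tensorHom_def]; monoidal
    _ = 𝟙 _ ⊗≫ (η[A] ▷ (H ⊗ H) ≫ A ◁ μ[H]) := by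
      rw [MonObj.mul_one]; monoidal
    _ = _ := by rw [unitInr, ← whisker_exchange]; monoidal

lemma IsDistributiveLaw.unitInl_tensorHom_unitInr_crossMul (h : IsDistributiveLaw ψ) :
    (unitInl A H ⊗ₘ unitInr A H) ≫ crossMul ψ = 𝟙 (A ⊗ H) := by
  calc
    _ = 𝟙 _ ⊗≫ A ◁ (η[H] ▷ (𝟙_ C) ≫ H ◁ η[A]) ▷ H ⊗≫ A ◁ ψ ▷ H ⊗≫
        (μ[A] ⊗ₘ μ[H]) := by
      simp only [unitInl, unitInr, MonoidalCategory.tensorHom_def, crossMul]; monoidal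
    _ = 𝟙 _ ⊗≫ A ◁ η[A] ▷ H ⊗≫ A ◁ (η[H] ▷ A ≫ ψ) ▷ H ⊗≫ (μ[A] ⊗ₘ μ[H]) := by
      rw [← whisker_exchange]; monoidal
    _ = 𝟙 _ ⊗≫ (A ◁ η[A]) ▷ H ⊗≫ ((A ⊗ A) ◁ (η[H] ▷ H) ≫ μ[A] ▷ _) ⊗≫ A ◁ μ[H] := by
      rw [h.one_left, MonoidalCategory.tensorHom_def]; monoidal
    _ = 𝟙 _ ⊗≫ (A ◁ η[A] ≫ μ[A]) ▷ H ⊗≫ A ◁ (η[H] ▷ H ≫ μ[H]) := by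
      rw [whisker_exchange]; monoidal
    _ = _ := by rw [MonObj.mul_one, MonObj.one_mul]; monoidal

lemma unitInr_tensorHom_unitInl_crossMul (ψ : H ⊗ A ⟶ A ⊗ H) :
    (unitInr A H ⊗ₘ unitInl A H) ≫ crossMul ψ = ψ := by
  calc
    _ = 𝟙 _ ⊗≫ η[A] ▷ (H ⊗ A) ⊗≫ (A ⊗ H ⊗ A) ◁ η[H] ⊗≫ A ◁ ψ ▷ H ⊗≫ (μ[A] ⊗ₘ μ[H]) := by
      simp only [unitInl, unitInr, MonoidalCategory.tensorHom_def, crossMul]; monoidal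
    _ = 𝟙 _ ⊗≫ η[A] ▷ (H ⊗ A) ⊗≫ A ◁ ((H ⊗ A) ◁ η[H] ≫ ψ ▷ H) ⊗≫ (μ[A] ⊗ₘ μ[H]) := by
      monoidal
    _ = 𝟙 _ ⊗≫ (η[A] ▷ (H ⊗ A) ≫ A ◁ ψ) ⊗≫ (A ⊗ A ⊗ H) ◁ η[H] ⊗≫ (μ[A] ⊗ₘ μ[H]) := by
      rw [whisker_exchange]; monoidal
    _ = ψ ⊗≫ η[A] ▷ (A ⊗ H) ⊗≫ (A ⊗ A) ◁ (H ◁ η[H] ≫ μ[H]) ⊗≫ μ[A] ▷ H := by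
      rw [← whisker_exchange, MonoidalCategory.tensorHom_def']; monoidal
    _ = ψ ⊗≫ (η[A] ▷ A ≫ μ[A]) ▷ H ⊗≫ 𝟙 _ := by
      rw [MonObj.mul_one]; monoidal
    _ = _ := by rw [MonObj.one_mul]; monoidal

end DistributiveLaws

section CrossProduct

variable {C : Type u} [Category.{v} C] [MonoidalCategory C] {A H : C}

/-- The object `A ⊗ H` with the monoid structure `crossMul ψ` of a distributive law `ψ`, instead of
the tensor product of monoids. -/
def CrossProduct [MonObj A] [MonObj H] {ψ : H ⊗ A ⟶ A ⊗ H} (_h : IsDistributiveLaw ψ) : C := A ⊗ H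

namespace CrossProduct

instance [MonObj A] [MonObj H] {ψ : H ⊗ A ⟶ A ⊗ H} (h : IsDistributiveLaw ψ) :
    MonObj (CrossProduct h) where
  one := (λ_ (𝟙_ C)).inv ≫ (η[A] ⊗ₘ η[H])
  mul := crossMul ψ
  one_mul := h.one_crossMul
  mul_one := h.crossMul_one
  mul_assoc := h.crossMul_assoc

/-- The inclusion of the left factor. -/
def inl [MonObj A] [MonObj H] {ψ : H ⊗ A ⟶ A ⊗ H} (h : IsDistributiveLaw ψ) :
    A ⟶ CrossProduct h := unitInl A H

/-- The inclusion of the right factor. -/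
def inr [MonObj A] [MonObj H] {ψ : H ⊗ A ⟶ A ⊗ H} (h : IsDistributiveLaw ψ) :
    H ⟶ CrossProduct h := unitInr A H

instance isMonHom_inl [MonObj A] [MonObj H] {ψ : H ⊗ A ⟶ A ⊗ H} (h : IsDistributiveLaw ψ) :
    IsMonHom (inl h) where
  mul_hom := h.unitInl_tensorHom_unitInl_crossMul.symm
  one_hom := by
    change η[A] ≫ (ρ_ A).inv ≫ A ◁ η[H] = (λ_ (𝟙_ C)).inv ≫ (η[A] ⊗ₘ η[H])
    rw [MonoidalCategory.tensorHom_def, unitors_inv_equal]; simp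

instance isMonHom_inr [MonObj A] [MonObj H] {ψ : H ⊗ A ⟶ A ⊗ H} (h : IsDistributiveLaw ψ) :
    IsMonHom (inr h) where
  mul_hom := h.unitInr_tensorHom_unitInr_crossMul.symm
  one_hom := by
    change η[H] ≫ (λ_ H).inv ≫ η[A] ▷ H = (λ_ (𝟙_ C)).inv ≫ (η[A] ⊗ₘ η[H])
    rw [MonoidalCategory.tensorHom_def']; simp

lemma inl_tensorHom_inr_mul [MonObj A] [MonObj H] {ψ : H ⊗ A ⟶ A ⊗ H} (h : IsDistributiveLaw ψ) :
    (inl h ⊗ₘ inr h) ≫ μ[CrossProduct h] = 𝟙 (A ⊗ H) :=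
  h.unitInl_tensorHom_unitInr_crossMul

lemma inr_tensorHom_inl_mul [MonObj A] [MonObj H] {ψ : H ⊗ A ⟶ A ⊗ H} (h : IsDistributiveLaw ψ) :
    (inr h ⊗ₘ inl h) ≫ μ[CrossProduct h] = ψ :=
  unitInr_tensorHom_unitInl_crossMul ψ

end CrossProduct

end CrossProduct

section CrossBimonoid

variable {C : Type u} [Category.{v} C] [MonoidalCategory C] [BraidedCategory C] {A H : C}

attribute [local instance] ComonObj.instTensorUnit

instance isComonHom_unitInl [ComonObj A] [BimonObj H] : IsComonHom (unitInl A H) := by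
  have : IsComonHom (ρ_ A).inv := isComonHom_symm_hom (ρ_ A)
  unfold unitInl; infer_instance

instance isComonHom_unitInr [BimonObj A] [ComonObj H] : IsComonHom (unitInr A H) := by
  have : IsComonHom (λ_ H).inv := isComonHom_symm_hom (λ_ H)
  unfold unitInr; infer_instance

instance isComonHom_crossMul [BimonObj A] [BimonObj H] (ψ : H ⊗ A ⟶ A ⊗ H) [IsComonHom ψ] :
    IsComonHom (crossMul ψ) := by
  have h : crossMul ψ = (α_ A H (A ⊗ H)).hom ≫
      A ◁ ((α_ H A H).inv ≫ ψ ▷ H ≫ (α_ A H H).hom) ≫ (α_ A A (H ⊗ H)).inv ≫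
        (μ[A] ⊗ₘ μ[H]) := by
    rw [crossMul]; monoidal
  rw [h]; infer_instance

namespace CrossProduct

instance [BimonObj A] [BimonObj H] {ψ : H ⊗ A ⟶ A ⊗ H} [IsComonHom ψ] (h : IsDistributiveLaw ψ) :
    BimonObj (CrossProduct h) where
  counit := ε[A ⊗ H]
  comul := Δ[A ⊗ H]
  counit_comul := ComonObj.counit_comul (A ⊗ H)
  comul_counit := ComonObj.comul_counit (A ⊗ H)
  comul_assoc := ComonObj.comul_assoc (A ⊗ H)
  mul_comul := by
    have e := IsComonHom.hom_comul (crossMul ψ)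
    rwa [Comon.tensorObj_comul (A ⊗ H) (A ⊗ H), Category.assoc] at e
  one_comul := IsComonHom.hom_comul ((λ_ (𝟙_ C)).inv ≫ (η[A] ⊗ₘ η[H]))
  mul_counit := IsComonHom.hom_counit (crossMul ψ)
  one_counit := IsComonHom.hom_counit ((λ_ (𝟙_ C)).inv ≫ (η[A] ⊗ₘ η[H]))

instance isComonHom_inl [BimonObj A] [BimonObj H] {ψ : H ⊗ A ⟶ A ⊗ H} [IsComonHom ψ]
    (h : IsDistributiveLaw ψ) : IsComonHom (inl h) where
  hom_counit := IsComonHom.hom_counit (unitInl A H)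
  hom_comul := IsComonHom.hom_comul (unitInl A H)

instance isComonHom_inr [BimonObj A] [BimonObj H] {ψ : H ⊗ A ⟶ A ⊗ H} [IsComonHom ψ]
    (h : IsDistributiveLaw ψ) : IsComonHom (inr h) where
  hom_counit := IsComonHom.hom_counit (unitInr A H)
  hom_comul := IsComonHom.hom_comul (unitInr A H)

/-- As `a ⊗ h` is the product of `a` and `h`, the antipode is `S(h) S(a)`. -/
instance [HopfObj A] [HopfObj H] {ψ : H ⊗ A ⟶ A ⊗ H} [IsComonHom ψ] (h : IsDistributiveLaw ψ) :
    HopfObj (CrossProduct h) :=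
  let u := Units.map (convMap A (inl h)) (idUnit A)
  let v := Units.map (convMap H (inr h)) (idUnit H)
  have huv : (convHom u.1 ⊗ₘ convHom v.1) ≫ μ = 𝟙 (A ⊗ H) := by
    change ((𝟙 A ≫ inl h) ⊗ₘ (𝟙 H ≫ inr h)) ≫ μ = _
    rw [Category.id_comp, Category.id_comp, inl_tensorHom_inr_mul]
  hopfObjOfUnit (D := CrossProduct h) (mulUnit u v) ((convHom_mulUnit u v).trans huv)

end CrossProduct

end CrossBimonoid

/-! ### The distributive law of a skew pairing -/

section Projections

variable {C : Type u} [Category.{v} C] [MonoidalCategory C] [SymmetricCategory C] {H A : C}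
  [ComonObj H] [ComonObj A]

lemma lact_counitFst (u : Conv (H ⊗ A) (𝟙_ C)) :
    lact u ≫ counitFst H A =
      Δ[H] ▷ A ⊗≫ H ◁ (β_ H A).hom ⊗≫ convHom u ▷ H ⊗≫ 𝟙 H := by
  simp only [lact, counitFst, Comon.tensorObj_comul]
  generalize convHom u = f
  calc
    _ = 𝟙 _ ⊗≫ (Δ[H] ⊗ₘ Δ[A]) ⊗≫ H ◁ (β_ H A).hom ▷ A ⊗≫ (f ▷ (H ⊗ A) ≫ _ ◁ (H ◁ ε[A])) ⊗≫
        𝟙 _ := by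
      simp only [tensorμ]; monoidal
    _ = 𝟙 _ ⊗≫ (Δ[H] ⊗ₘ Δ[A]) ⊗≫ H ◁ ((β_ H A).hom ▷ A ≫ _ ◁ ε[A]) ⊗≫ f ▷ H ⊗≫ 𝟙 _ := by
      rw [← whisker_exchange]; monoidal
    _ = 𝟙 _ ⊗≫ Δ[H] ▷ A ⊗≫ (H ⊗ H) ◁ (Δ[A] ≫ A ◁ ε[A]) ⊗≫ H ◁ (β_ H A).hom ⊗≫ f ▷ H ⊗≫ 𝟙 _ := by
      rw [← whisker_exchange, MonoidalCategory.tensorHom_def]; monoidal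
    _ = _ := by rw [ComonObj.comul_counit]; monoidal

lemma lact_counitSnd (u : Conv (H ⊗ A) (𝟙_ C)) :
    lact u ≫ counitSnd H A = H ◁ Δ[A] ⊗≫ convHom u ▷ A ⊗≫ 𝟙 A := by
  simp only [lact, counitSnd, Comon.tensorObj_comul]
  generalize convHom u = f
  calc
    _ = 𝟙 _ ⊗≫ (Δ[H] ⊗ₘ Δ[A]) ⊗≫ H ◁ (β_ H A).hom ▷ A ⊗≫ (f ▷ (H ⊗ A) ≫ _ ◁ (ε[H] ▷ A)) ⊗≫
        𝟙 _ := by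
      simp only [tensorμ]; monoidal
    _ = 𝟙 _ ⊗≫ (Δ[H] ⊗ₘ Δ[A]) ⊗≫ H ◁ ((β_ H A).hom ≫ A ◁ ε[H]) ▷ A ⊗≫ f ▷ A ⊗≫ 𝟙 _ := by
      rw [← whisker_exchange]; monoidal
    _ = 𝟙 _ ⊗≫ (Δ[H] ▷ A ≫ _ ◁ Δ[A]) ⊗≫ H ◁ ε[H] ▷ (A ⊗ A) ⊗≫ f ▷ A ⊗≫ 𝟙 _ := by
      rw [← BraidedCategory.braiding_naturality_left, braiding_tensorUnit_left,
        MonoidalCategory.tensorHom_def]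
      monoidal
    _ = 𝟙 _ ⊗≫ H ◁ Δ[A] ⊗≫ (Δ[H] ≫ H ◁ ε[H]) ▷ (A ⊗ A) ⊗≫ f ▷ A ⊗≫ 𝟙 _ := by
      rw [← whisker_exchange]; monoidal
    _ = _ := by rw [ComonObj.comul_counit]; monoidal

lemma ract_counitFst (u : Conv (H ⊗ A) (𝟙_ C)) :
    ract u ≫ counitFst H A = Δ[H] ▷ A ⊗≫ H ◁ convHom u ⊗≫ 𝟙 H := by
  simp only [ract, counitFst, Comon.tensorObj_comul]
  generalize convHom u = f
  calc
    _ = 𝟙 _ ⊗≫ (Δ[H] ⊗ₘ Δ[A]) ⊗≫ H ◁ (β_ H A).hom ▷ A ⊗≫ H ◁ (A ◁ f ≫ ε[A] ▷ _) ⊗≫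
        𝟙 _ := by
      simp only [tensorμ]; monoidal
    _ = 𝟙 _ ⊗≫ (Δ[H] ⊗ₘ Δ[A]) ⊗≫ H ◁ ((β_ H A).hom ≫ ε[A] ▷ H) ▷ A ⊗≫ H ◁ f ⊗≫ 𝟙 _ := by
      rw [whisker_exchange]; monoidal
    _ = 𝟙 _ ⊗≫ Δ[H] ▷ A ⊗≫ (H ⊗ H) ◁ (Δ[A] ≫ ε[A] ▷ A) ⊗≫ H ◁ f ⊗≫ 𝟙 _ := by
      rw [← BraidedCategory.braiding_naturality_right, braiding_tensorUnit_right,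
        MonoidalCategory.tensorHom_def]
      monoidal
    _ = _ := by rw [ComonObj.counit_comul]; monoidal

lemma ract_counitSnd (u : Conv (H ⊗ A) (𝟙_ C)) :
    ract u ≫ counitSnd H A =
      H ◁ Δ[A] ⊗≫ (β_ H A).hom ▷ A ⊗≫ A ◁ convHom u ⊗≫ 𝟙 A := by
  simp only [ract, counitSnd, Comon.tensorObj_comul]
  generalize convHom u = f
  calc
    _ = 𝟙 _ ⊗≫ (Δ[H] ⊗ₘ Δ[A]) ⊗≫ H ◁ (β_ H A).hom ▷ A ⊗≫ ((H ⊗ A) ◁ f ≫ (ε[H] ▷ A) ▷ _) ⊗≫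
        𝟙 _ := by
      simp only [tensorμ]; monoidal
    _ = 𝟙 _ ⊗≫ (Δ[H] ⊗ₘ Δ[A]) ⊗≫ (H ◁ (β_ H A).hom ≫ ε[H] ▷ _) ▷ A ⊗≫ A ◁ f ⊗≫ 𝟙 _ := by
      rw [whisker_exchange]; monoidal
    _ = 𝟙 _ ⊗≫ (H ◁ Δ[A] ≫ (Δ[H] ≫ ε[H] ▷ H) ▷ (A ⊗ A)) ⊗≫ (β_ H A).hom ▷ A ⊗≫ A ◁ f ⊗≫
        𝟙 _ := by
      rw [whisker_exchange, MonoidalCategory.tensorHom_def']; monoidal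
    _ = 𝟙 _ ⊗≫ (Δ[H] ≫ ε[H] ▷ H) ▷ A ⊗≫ H ◁ Δ[A] ⊗≫ (β_ H A).hom ▷ A ⊗≫ A ◁ f ⊗≫ 𝟙 _ := by
      rw [whisker_exchange]; monoidal
    _ = _ := by rw [ComonObj.counit_comul]; monoidal

end Projections

section Transfer

variable {C : Type u} [Category.{v} C] [MonoidalCategory C]

lemma conj_unitsMap_iso {X Y : C} [ComonObj X] [ComonObj Y] (f : X ≅ Y) [IsComonHom f.hom]
    (u : (Conv Y (𝟙_ C))ˣ) :
    conj (Units.map (convComap _ f.hom) u) = f.hom ≫ conj u ≫ f.inv := by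
  rw [← Category.assoc, comp_conj, Category.assoc, Iso.hom_inv_id, Category.comp_id]

lemma lact_convComap_iso {X Y : C} [ComonObj X] [ComonObj Y] (f : X ≅ Y) [IsComonHom f.hom]
    (u : Conv Y (𝟙_ C)) :
    lact (convComap _ f.hom u) = f.hom ≫ lact u ≫ f.inv := by
  rw [← Category.assoc, comp_lact, Category.assoc, Iso.hom_inv_id, Category.comp_id]

end Transfer

section Exchange

variable {C : Type u} [Category.{v} C] [MonoidalCategory C] [SymmetricCategory C] {H A : C}

attribute [local instance] ComonObj.instTensorUnit

/-- The map `h ⊗ a ↦ τ(h₁, a₁) a₂ ⊗ h₂ τ⁻¹(h₃, a₃)`. -/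
def exchange [ComonObj H] [ComonObj A] (t : (Conv (H ⊗ A) (𝟙_ C))ˣ) : H ⊗ A ⟶ A ⊗ H :=
  conj t ≫ (β_ H A).hom

instance isComonHom_exchange [ComonObj H] [ComonObj A] (t : (Conv (H ⊗ A) (𝟙_ C))ˣ) :
    IsComonHom (exchange t) := by
  unfold exchange; infer_instance

variable [BimonObj H] [BimonObj A] (t : (Conv (H ⊗ A) (𝟙_ C))ˣ)

/-- The isomorphism exchanging the last two factors. -/
def swapRight (X Y Z : C) : (X ⊗ Y) ⊗ Z ≅ (X ⊗ Z) ⊗ Y :=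
  α_ X Y Z ≪≫ whiskerLeftIso X (β_ Y Z) ≪≫ (α_ X Z Y).symm

/-- The isomorphism exchanging the first two factors. -/
def swapLeft (X Y Z : C) : X ⊗ (Y ⊗ Z) ≅ Y ⊗ (X ⊗ Z) :=
  (α_ X Y Z).symm ≪≫ whiskerRightIso (β_ X Y) Z ≪≫ α_ Y X Z

instance (X Y Z : C) [ComonObj X] [ComonObj Y] [ComonObj Z] :
    IsComonHom (swapRight X Y Z).hom := by
  simp only [swapRight, Iso.trans_hom, Iso.symm_hom, whiskerLeftIso_hom]; infer_instance

instance (X Y Z : C) [ComonObj X] [ComonObj Y] [ComonObj Z] :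
    IsComonHom (swapLeft X Y Z).hom := by
  simp only [swapLeft, Iso.trans_hom, Iso.symm_hom, whiskerRightIso_hom]; infer_instance

lemma IsSkewPairing.convComap_mul_left (h : IsSkewPairing (convHom t.1)) :
    Units.map (convComap _ (μ[H] ▷ A)) t =
      Units.map (convComap _ (α_ H H A).hom)
          (Units.map (convComap _ (counitSnd H (H ⊗ A))) t) *
        Units.map (convComap _ (swapRight H H A).hom)
          (Units.map (convComap _ (counitFst (H ⊗ A) H)) t) := by
  apply Units.ext
  change convHom _ = convHom _
  rw [Units.val_mul, ← lact_convHom]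
  simp only [Units.coe_map, lact_convComap_iso, ← whiskerLeft_lact,
    convHom_convComap, h.mul_left]
  have e := lact_counitSnd (H := H) (A := A) t.1
  generalize convHom t.1 = f at *
  generalize lact t.1 = g at *
  have e' : (β_ H A).hom ≫ A ◁ ε[H] = ε[H] ▷ A ≫ (λ_ A).hom ≫ (ρ_ A).inv := by
    rw [← BraidedCategory.braiding_naturality_left, braiding_tensorUnit_left]
  calc
    _ = 𝟙 _ ⊗≫ H ◁ (H ◁ Δ[A] ⊗≫ f ▷ A ⊗≫ 𝟙 A) ⊗≫ f := by monoidal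
    _ = 𝟙 _ ⊗≫ H ◁ g ⊗≫ H ◁ ((β_ H A).hom ≫ A ◁ ε[H]) ⊗≫ f := by
      rw [← e, e', counitSnd]; monoidal
    _ = _ := by
      simp only [counitFst, swapRight, Iso.trans_hom, Iso.symm_hom, whiskerLeftIso_hom]
      monoidal

lemma IsSkewPairing.convComap_mul_right (h : IsSkewPairing (convHom t.1)) :
    Units.map (convComap _ (H ◁ μ[A])) t =
      Units.map (convComap _ (α_ H A A).symm.hom)
          (Units.map (convComap _ (counitFst (H ⊗ A) A)) t) *
        Units.map (convComap _ (swapLeft H A A).hom)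
          (Units.map (convComap _ (counitSnd A (H ⊗ A))) t) := by
  apply Units.ext
  change convHom _ = convHom _
  rw [Units.val_mul, ← lact_convHom]
  simp only [Units.coe_map, lact_convComap_iso, ← lact_whiskerRight,
    convHom_convComap, h.mul_right]
  have e := lact_counitFst (H := H) (A := A) t.1
  generalize convHom t.1 = f at *
  generalize lact t.1 = g at *
  have e' : (β_ H A).hom ≫ ε[A] ▷ H = H ◁ ε[A] ≫ (ρ_ H).hom ≫ (λ_ H).inv := by
    rw [← BraidedCategory.braiding_naturality_right, braiding_tensorUnit_right]
  calc
    _ = 𝟙 _ ⊗≫ (Δ[H] ▷ A ⊗≫ H ◁ (β_ H A).hom ⊗≫ f ▷ H ⊗≫ 𝟙 H) ▷ A ⊗≫ f := by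
      rw [MonoidalCategory.tensorHom_def]; monoidal
    _ = 𝟙 _ ⊗≫ g ▷ A ⊗≫ ((β_ H A).hom ≫ ε[A] ▷ H) ▷ A ⊗≫ f := by
      rw [← e, e', counitFst]; monoidal
    _ = _ := by
      simp only [counitSnd, swapLeft, Iso.trans_hom, Iso.symm_hom, Iso.symm_inv,
        whiskerRightIso_hom]
      monoidal

lemma IsSkewPairing.convComap_one_left (h : IsSkewPairing (convHom t.1)) :
    Units.map (convComap _ (η[H] ▷ A)) t = 1 := by
  apply Units.ext
  change η[H] ▷ A ≫ convHom t.1 = ε[𝟙_ C ⊗ A] ≫ 𝟙 _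
  rw [← cancel_epi (λ_ A).inv, h.one_left, Category.comp_id, IsComonHom.hom_counit]

lemma IsSkewPairing.convComap_one_right (h : IsSkewPairing (convHom t.1)) :
    Units.map (convComap _ (H ◁ η[A])) t = 1 := by
  apply Units.ext
  change H ◁ η[A] ≫ convHom t.1 = ε[H ⊗ 𝟙_ C] ≫ 𝟙 _
  rw [← cancel_epi (ρ_ H).inv, h.one_right, Category.comp_id, IsComonHom.hom_counit]

lemma IsSkewPairing.mul_whiskerRight_conj (h : IsSkewPairing (convHom t.1)) :
    μ[H] ▷ A ≫ conj t = (α_ H H A).hom ≫ H ◁ conj t ≫ (α_ H H A).inv ≫ (swapRight H H A).hom ≫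
      conj t ▷ H ≫ (swapRight H H A).inv ≫ μ[H] ▷ A := by
  rw [comp_conj, h.convComap_mul_left, conj_mul, conj_unitsMap_iso, conj_unitsMap_iso,
    ← whiskerLeft_conj, ← conj_whiskerRight]
  simp only [Category.assoc]

lemma IsSkewPairing.whiskerLeft_mul_conj (h : IsSkewPairing (convHom t.1)) :
    H ◁ μ[A] ≫ conj t = (α_ H A A).inv ≫ conj t ▷ A ≫ (α_ H A A).hom ≫ (swapLeft H A A).hom ≫
      A ◁ conj t ≫ (swapLeft H A A).inv ≫ H ◁ μ[A] := by
  rw [comp_conj, h.convComap_mul_right, conj_mul, conj_unitsMap_iso, conj_unitsMap_iso,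
    ← whiskerLeft_conj, ← conj_whiskerRight]
  simp only [Category.assoc]
  rfl

lemma IsSkewPairing.isDistributiveLaw (h : IsSkewPairing (convHom t.1)) :
    IsDistributiveLaw (exchange t) where
  mul_left := by
    have e : (swapRight H H A).inv ≫ μ[H] ▷ A ≫ (β_ H A).hom =
        (β_ H A).hom ▷ H ≫ (α_ A H H).hom ≫ A ◁ μ[H] := by
      rw [Iso.inv_comp_eq, BraidedCategory.braiding_naturality_left,
        BraidedCategory.braiding_tensor_left_hom]
      simp [swapRight]
    rw [exchange, ← Category.assoc, h.mul_whiskerRight_conj]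
    simp only [Category.assoc, e, whiskerLeft_comp, comp_whiskerRight]
    simp [swapRight]
  mul_right := by
    have e : (swapLeft H A A).inv ≫ H ◁ μ[A] ≫ (β_ H A).hom =
        A ◁ (β_ H A).hom ≫ (α_ A A H).inv ≫ μ[A] ▷ H := by
      rw [Iso.inv_comp_eq, BraidedCategory.braiding_naturality_right,
        BraidedCategory.braiding_tensor_right_hom]
      simp [swapLeft]
    rw [exchange, ← Category.assoc, h.whiskerLeft_mul_conj]
    simp only [Category.assoc, e, whiskerLeft_comp, comp_whiskerRight]
    simp [swapLeft]
  one_left := by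
    rw [exchange, ← Category.assoc, comp_conj, h.convComap_one_left, conj_one, Category.id_comp,
      BraidedCategory.braiding_naturality_left, braiding_tensorUnit_left]
    simp only [Category.assoc]
  one_right := by
    rw [exchange, ← Category.assoc, comp_conj, h.convComap_one_right, conj_one, Category.id_comp,
      BraidedCategory.braiding_naturality_right, braiding_tensorUnit_right]
    simp only [Category.assoc]

end Exchange

section DoubleCrossMul

variable {C : Type u} [Category.{v} C] [MonoidalCategory C] [SymmetricCategory C] {H A : C}

lemma leftAct_eq [ComonObj H] [ComonObj A] (t : (Conv (H ⊗ A) (𝟙_ C))ˣ) :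
    leftAct (convHom t.1) (convHom (t⁻¹).1) = conj t ≫ counitSnd H A := by
  rw [conj, Category.assoc, ract_counitSnd, leftAct]
  simp only [lact, Comon.tensorObj_comul, tensorμ]
  generalize convHom t.1 = f
  generalize convHom (t⁻¹).1 = g
  calc
    _ = (Δ[H] ⊗ₘ Δ[A]) ⊗≫ H ◁ (β_ H A).hom ▷ A ⊗≫
        ((H ⊗ A) ◁ (H ◁ Δ[A] ⊗≫ (β_ H A).hom ▷ A ⊗≫ A ◁ g ⊗≫ 𝟙 A) ≫ f ▷ _) ⊗≫ 𝟙 A := by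
      rw [MonoidalCategory.tensorHom_def (β_ H A).hom, MonoidalCategory.tensorHom_def' f]
      monoidal
    _ = _ := by
      rw [whisker_exchange]; monoidal

lemma rightAct_eq_braiding_tensor [ComonObj H] [ComonObj A] (f g : H ⊗ A ⟶ 𝟙_ C) :
    rightAct f g = 𝟙 _ ⊗≫ (Δ[H] ⊗ₘ Δ[A]) ⊗≫ Δ[H] ▷ (H ⊗ A ⊗ A) ⊗≫
      H ◁ (β_ (H ⊗ H) A).hom ▷ A ⊗≫ f ▷ (H ⊗ H ⊗ A) ⊗≫ H ◁ g ⊗≫ 𝟙 H := by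
  have e : Δ[H] ⊗ₘ (β_ H A).hom ▷ A = Δ[H] ▷ ((H ⊗ A) ⊗ A) ≫ (H ⊗ H) ◁ (β_ H A).hom ▷ A :=
    MonoidalCategory.tensorHom_def _ _
  rw [rightAct, e]
  calc
    _ = 𝟙 _ ⊗≫ (Δ[H] ⊗ₘ Δ[A]) ⊗≫ Δ[H] ▷ (H ⊗ A ⊗ A) ⊗≫ H ◁ (H ◁ (β_ H A).hom ⊗≫
        (β_ H A).hom ▷ H) ▷ A ⊗≫ ((H ⊗ A) ◁ H ◁ g ≫ f ▷ (H ⊗ 𝟙_ C)) ⊗≫ 𝟙 H := by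
      rw [MonoidalCategory.tensorHom_def' f]; monoidal
    _ = _ := by
      rw [BraidedCategory.braiding_tensor_left_hom, whisker_exchange]; monoidal

lemma rightAct_eq [ComonObj H] [ComonObj A] (t : (Conv (H ⊗ A) (𝟙_ C))ˣ) :
    rightAct (convHom t.1) (convHom (t⁻¹).1) = conj t ≫ counitFst H A := by
  rw [conj, Category.assoc, ract_counitFst, rightAct_eq_braiding_tensor]
  simp only [lact, Comon.tensorObj_comul, tensorμ]
  generalize convHom t.1 = f
  generalize convHom (t⁻¹).1 = g
  calc
    _ = 𝟙 _ ⊗≫ (H ◁ Δ[A] ≫ (Δ[H] ≫ Δ[H] ▷ H ≫ (α_ H H H).hom) ▷ (A ⊗ A)) ⊗≫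
        H ◁ (β_ (H ⊗ H) A).hom ▷ A ⊗≫ f ▷ (H ⊗ H ⊗ A) ⊗≫ H ◁ g ⊗≫ 𝟙 H := by
      rw [MonoidalCategory.tensorHom_def']
      monoidal
    _ = 𝟙 _ ⊗≫ (Δ[H] ⊗ₘ Δ[A]) ⊗≫ H ◁ (Δ[H] ▷ A ≫ (β_ (H ⊗ H) A).hom) ▷ A ⊗≫
        f ▷ (H ⊗ H ⊗ A) ⊗≫ H ◁ g ⊗≫ 𝟙 H := by
      rw [← ComonObj.comul_assoc, MonoidalCategory.tensorHom_def']
      monoidal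
    _ = 𝟙 _ ⊗≫ (Δ[H] ⊗ₘ Δ[A]) ⊗≫ H ◁ (β_ H A).hom ▷ A ⊗≫ ((H ⊗ A) ◁ (Δ[H] ▷ A) ≫ f ▷ _) ⊗≫
        H ◁ g ⊗≫ 𝟙 H := by
      rw [BraidedCategory.braiding_naturality_left]; monoidal
    _ = _ := by
      rw [whisker_exchange]; monoidal

lemma doubleCrossMul_eq [BimonObj H] [BimonObj A] (t : (Conv (H ⊗ A) (𝟙_ C))ˣ) :
    doubleCrossMul (convHom t.1) (convHom (t⁻¹).1) = crossMul (exchange t) := by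
  have h : Δ[H ⊗ A] ≫ (leftAct (convHom t.1) (convHom (t⁻¹).1) ⊗ₘ
      rightAct (convHom t.1) (convHom (t⁻¹).1)) = exchange t := by
    rw [leftAct_eq, rightAct_eq, ← tensorHom_comp_tensorHom, ← IsComonHom.hom_comul_assoc,
      comul_counitSnd_counitFst, exchange]
  rw [crossMul, ← h, doubleCrossMul]
  monoidal

end DoubleCrossMul

/-! ### Transposes -/

section Adjuncts

variable {C : Type u} [Category.{v} C] [MonoidalCategory C] {H A : C} [ExactPairing H A]

/-- The morphism `A ⊗ X ⟶ Z` adjunct to `f : X ⟶ H ⊗ Z`, where `A` is a left dual of `H`. -/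
def adjunctLeft {X Z : C} (f : X ⟶ H ⊗ Z) : A ⊗ X ⟶ Z :=
  A ◁ f ⊗≫ ε_ H A ▷ Z ⊗≫ 𝟙 Z

/-- The morphism `X ⊗ H ⟶ Z` adjunct to `f : X ⟶ Z ⊗ A`, where `A` is a left dual of `H`. -/
def adjunctRight {X Z : C} (f : X ⟶ Z ⊗ A) : X ⊗ H ⟶ Z :=
  f ▷ H ⊗≫ Z ◁ ε_ H A ⊗≫ 𝟙 Z

lemma adjunctLeft_injective {X Z : C} :
    Function.Injective (adjunctLeft : (X ⟶ H ⊗ Z) → (A ⊗ X ⟶ Z)) := fun f g h ↦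
  (tensorLeftHomEquiv X H A Z).symm.injective
    (by simpa [tensorLeftHomEquiv, adjunctLeft, monoidalComp] using h)

lemma adjunctRight_injective {X Z : C} :
    Function.Injective (adjunctRight : (X ⟶ Z ⊗ A) → (X ⊗ H ⟶ Z)) := fun f g h ↦
  (tensorRightHomEquiv X H A Z).symm.injective
    (by simpa [tensorRightHomEquiv, adjunctRight, monoidalComp] using h)

lemma adjunctLeft_comp_whiskerLeft {X Z W : C} (f : X ⟶ H ⊗ Z) (g : Z ⟶ W) :
    adjunctLeft (A := A) (f ≫ H ◁ g) = adjunctLeft f ≫ g := by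
  unfold adjunctLeft
  calc
    _ = A ◁ f ⊗≫ ((A ⊗ H) ◁ g ≫ ε_ H A ▷ W) ⊗≫ 𝟙 W := by monoidal
    _ = _ := by rw [whisker_exchange]; monoidal

lemma adjunctRight_comp_whiskerRight {X Z W : C} (f : X ⟶ Z ⊗ A) (g : Z ⟶ W) :
    adjunctRight (H := H) (f ≫ g ▷ A) = adjunctRight f ≫ g := by
  unfold adjunctRight
  calc
    _ = f ▷ H ⊗≫ (g ▷ (A ⊗ H) ≫ W ◁ ε_ H A) ⊗≫ 𝟙 W := by monoidal
    _ = _ := by rw [← whisker_exchange]; monoidal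

lemma hom_ext_evaluation_left {Z : C} {f g : Z ⟶ A} (h : f ▷ H ≫ ε_ H A = g ▷ H ≫ ε_ H A) :
    f = g := by
  have key (k : Z ⟶ A) : adjunctRight (k ≫ (λ_ A).inv) = k ▷ H ≫ ε_ H A := by
    unfold adjunctRight; monoidal
  rw [← cancel_mono (λ_ A).inv]
  exact adjunctRight_injective (by rw [key, key, h])

lemma hom_ext_evaluation_right {X : C} {f g : X ⟶ H} (h : A ◁ f ≫ ε_ H A = A ◁ g ≫ ε_ H A) :
    f = g := by
  have key (k : X ⟶ H) : adjunctLeft (k ≫ (ρ_ H).inv) = A ◁ k ≫ ε_ H A := by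
    unfold adjunctLeft; monoidal
  rw [← cancel_mono (ρ_ H).inv]
  exact adjunctLeft_injective (by rw [key, key, h])

end Adjuncts

section Mates

variable {C : Type u} [Category.{v} C] [MonoidalCategory C]

/-- `f' : V^* ⟶ U^*` is the transpose of `f : U ⟶ V`, expressed through the evaluations. -/
def IsMate {U U' V V' : C} [ExactPairing U U'] [ExactPairing V V'] (f : U ⟶ V) (f' : V' ⟶ U') :
    Prop :=
  f' ▷ U ≫ ε_ U U' = V' ◁ f ≫ ε_ V V'

variable {U U' V V' W W' X X' : C} [ExactPairing U U'] [ExactPairing V V'] [ExactPairing W W']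
  [ExactPairing X X']

lemma isMate_transpose (f : U ⟶ V) : IsMate f (transpose f : V' ⟶ U') := by
  unfold IsMate transpose
  calc
    _ = 𝟙 _ ⊗≫ V' ◁ η_ U U' ▷ U ⊗≫ V' ◁ f ▷ (U' ⊗ U) ⊗≫ (ε_ V V' ▷ (U' ⊗ U) ≫ _ ◁ ε_ U U') ⊗≫
        𝟙 _ := by monoidal
    _ = 𝟙 _ ⊗≫ V' ◁ η_ U U' ▷ U ⊗≫ V' ◁ (f ▷ (U' ⊗ U) ≫ V ◁ ε_ U U') ⊗≫ ε_ V V' := by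
      rw [← whisker_exchange]; monoidal
    _ = 𝟙 _ ⊗≫ V' ◁ (η_ U U' ▷ U ⊗≫ U ◁ ε_ U U') ⊗≫ V' ◁ f ⊗≫ ε_ V V' := by
      rw [← whisker_exchange]; monoidal
    _ = _ := by rw [ExactPairing.evaluation_coevaluation'']; monoidal

lemma IsMate.unique {f : U ⟶ V} {f₁ f₂ : V' ⟶ U'} (h₁ : IsMate f f₁) (h₂ : IsMate f f₂) :
    f₁ = f₂ :=
  hom_ext_evaluation_left (h₁.trans h₂.symm)

lemma IsMate.eq_transpose {f : U ⟶ V} {f' : V' ⟶ U'} (h : IsMate f f') : f' = transpose f :=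
  h.unique (isMate_transpose f)

lemma isMate_id : IsMate (𝟙 U) (𝟙 U') := by simp [IsMate]

lemma IsMate.comp {f : U ⟶ V} {f' : V' ⟶ U'} {g : V ⟶ W} {g' : W' ⟶ V'} (hf : IsMate f f')
    (hg : IsMate g g') : IsMate (f ≫ g) (g' ≫ f') := by
  unfold IsMate at *
  rw [comp_whiskerRight, Category.assoc, hf, ← whisker_exchange_assoc, hg]
  simp

lemma IsMate.tensor {f : U ⟶ V} {f' : V' ⟶ U'} {g : W ⟶ X} {g' : X' ⟶ W'} (hf : IsMate f f')
    (hg : IsMate g g') : IsMate (f ⊗ₘ g) (g' ⊗ₘ f') := by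
  unfold IsMate at *
  simp only [ExactPairing.tensor_evaluation]
  calc
    _ = 𝟙 _ ⊗≫ g' ▷ (V' ⊗ U ⊗ W) ⊗≫ W' ◁ (f' ▷ U ≫ ε_ U U') ▷ W ⊗≫ ε_ W W' := by
      rw [MonoidalCategory.tensorHom_def]; monoidal
    _ = 𝟙 _ ⊗≫ X' ◁ V' ◁ f ▷ W ⊗≫ (g' ▷ _ ≫ W' ◁ (ε_ V V')) ▷ W ⊗≫ ε_ W W' := by
      rw [hf]
      calc
        _ = 𝟙 _ ⊗≫ (g' ▷ (V' ⊗ U) ≫ W' ◁ (V' ◁ f)) ▷ W ⊗≫ W' ◁ ε_ V V' ▷ W ⊗≫ ε_ W W' := by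
          monoidal
        _ = _ := by rw [← whisker_exchange]; monoidal
    _ = 𝟙 _ ⊗≫ X' ◁ V' ◁ f ▷ W ⊗≫ X' ◁ ε_ V V' ▷ W ⊗≫ (g' ▷ W ≫ ε_ W W') := by
      rw [← whisker_exchange]; monoidal
    _ = 𝟙 _ ⊗≫ X' ◁ V' ◁ f ▷ W ⊗≫ X' ◁ (ε_ V V' ▷ W ≫ _ ◁ g) ⊗≫ ε_ X X' := by
      rw [hg]; monoidal
    _ = _ := by
      rw [← whisker_exchange, MonoidalCategory.tensorHom_def]; monoidal

lemma IsMate.whiskerRight {f : U ⟶ V} {f' : V' ⟶ U'} (hf : IsMate f f') :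
    IsMate (f ▷ W) (W' ◁ f') := by
  simpa using hf.tensor (isMate_id (U := W) (U' := W'))

lemma IsMate.whiskerLeft {f : U ⟶ V} {f' : V' ⟶ U'} (hf : IsMate f f') :
    IsMate (W ◁ f) (f' ▷ W') := by
  simpa using (isMate_id (U := W) (U' := W')).tensor hf

lemma isMate_associator : IsMate (α_ U V W).hom (α_ W' V' U').hom := by
  simp only [IsMate, ExactPairing.tensor_evaluation]; monoidal

lemma isMate_associator_inv : IsMate (α_ U V W).inv (α_ W' V' U').inv := by
  simp only [IsMate, ExactPairing.tensor_evaluation]; monoidal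

lemma evaluation_tensorUnit : ε_ (𝟙_ C) (𝟙_ C) = (ρ_ (𝟙_ C)).hom := rfl

lemma isMate_leftUnitor : IsMate (λ_ U).hom (ρ_ U').inv := by
  simp only [IsMate, ExactPairing.tensor_evaluation, evaluation_tensorUnit]; monoidal

lemma isMate_leftUnitor_inv : IsMate (λ_ U).inv (ρ_ U').hom := by
  simp only [IsMate, ExactPairing.tensor_evaluation, evaluation_tensorUnit]; monoidal

lemma isMate_rightUnitor : IsMate (ρ_ U).hom (λ_ U').inv := by
  simp only [IsMate, ExactPairing.tensor_evaluation, evaluation_tensorUnit]; monoidal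

lemma isMate_rightUnitor_inv : IsMate (ρ_ U).inv (λ_ U').hom := by
  simp only [IsMate, ExactPairing.tensor_evaluation, evaluation_tensorUnit]; monoidal

lemma exists_isMate (f' : V' ⟶ U') : ∃ f : U ⟶ V, IsMate f f' := by
  refine ⟨𝟙 U ⊗≫ η_ V V' ▷ U ⊗≫ V ◁ (f' ▷ U ≫ ε_ U U') ⊗≫ 𝟙 V, ?_⟩
  unfold IsMate
  symm
  calc
    _ = 𝟙 _ ⊗≫ V' ◁ η_ V V' ▷ U ⊗≫ (_ ◁ (f' ▷ U ≫ ε_ U U') ≫ ε_ V V' ▷ (𝟙_ C)) ⊗≫ 𝟙 _ := by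
      monoidal
    _ = 𝟙 _ ⊗≫ (V' ◁ η_ V V' ⊗≫ ε_ V V' ▷ V') ▷ U ⊗≫ (f' ▷ U ≫ ε_ U U') := by
      rw [whisker_exchange]; monoidal
    _ = _ := by
      rw [ExactPairing.coevaluation_evaluation'']; monoidal

lemma IsMate.unique_left {f g : U ⟶ V} {f' : V' ⟶ U'} (hf : IsMate f f') (hg : IsMate g f') :
    f = g :=
  hom_ext_evaluation_right (hf.symm.trans hg)

lemma IsMate.coevaluation {f : U ⟶ V} {f' : V' ⟶ U'} (h : IsMate f f') :
    η_ U U' ≫ f ▷ U' = η_ V V' ≫ V ◁ f' := by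
  symm
  rw [h.eq_transpose, transpose]
  calc
    _ = 𝟙 _ ⊗≫ (η_ V V' ▷ (𝟙_ C) ≫ _ ◁ η_ U U') ⊗≫ V ◁ V' ◁ f ▷ U' ⊗≫ V ◁ ε_ V V' ▷ U' ⊗≫
        𝟙 _ := by monoidal
    _ = η_ U U' ⊗≫ (η_ V V' ▷ U ≫ _ ◁ f) ▷ U' ⊗≫ V ◁ ε_ V V' ▷ U' ⊗≫ 𝟙 _ := by
      rw [← whisker_exchange]; monoidal
    _ = η_ U U' ⊗≫ f ▷ U' ⊗≫ (η_ V V' ▷ V ⊗≫ V ◁ ε_ V V') ▷ U' ⊗≫ 𝟙 _ := by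
      rw [← whisker_exchange]; monoidal
    _ = _ := by
      rw [ExactPairing.evaluation_coevaluation'']; monoidal

end Mates

section BraidedMates

variable {C : Type u} [Category.{v} C] [MonoidalCategory C] [SymmetricCategory C]

lemma isSymmetricAt_of_symmetric {V W : C} (p : V ⊗ W ⟶ 𝟙_ C) (X : C) : IsSymmetricAt p X := by
  have h : V ◁ (β_ X W).hom ≫ V ◁ (β_ W X).hom = 𝟙 _ := by
    rw [← whiskerLeft_comp, SymmetricCategory.symmetry, whiskerLeft_id]
  unfold IsSymmetricAt
  calc
    _ = 𝟙 _ ⊗≫ (V ◁ (β_ X W).hom ≫ V ◁ (β_ W X).hom) ⊗≫ (β_ V X).hom ▷ W ⊗≫ X ◁ p ⊗≫ 𝟙 X := by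
      rw [h]; monoidal
    _ = 𝟙 _ ⊗≫ V ◁ (β_ X W).hom ⊗≫ ((β_ (V ⊗ W) X).hom ≫ X ◁ p) ⊗≫ 𝟙 X := by
      rw [BraidedCategory.braiding_tensor_left_hom]; monoidal
    _ = _ := by
      rw [← BraidedCategory.braiding_naturality_left, braiding_tensorUnit_left]; monoidal

variable {U U' V V' : C} [ExactPairing U U'] [ExactPairing V V']

lemma isMate_braiding : IsMate (β_ U V).hom (β_ U' V').hom := by
  simp only [IsMate, ExactPairing.tensor_evaluation]
  have h₁ := isSymmetricAt_of_symmetric (ε_ U U') V'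
  have h₂ := isSymmetricAt_of_symmetric (ε_ V V') U
  unfold IsSymmetricAt at h₁ h₂
  calc
    _ = 𝟙 _ ⊗≫ ((β_ U' V').hom ▷ U ⊗≫ V' ◁ ε_ U U' ⊗≫ 𝟙 V') ▷ V ⊗≫ ε_ V V' := by monoidal
    _ = 𝟙 _ ⊗≫ U' ◁ (β_ V' U).hom ▷ V ⊗≫ (ε_ U U' ▷ (V' ⊗ V) ≫ _ ◁ ε_ V V') ⊗≫ 𝟙 _ := by
      rw [h₁]; monoidal
    _ = 𝟙 _ ⊗≫ U' ◁ ((β_ V' U).hom ▷ V ⊗≫ U ◁ ε_ V V' ⊗≫ 𝟙 U) ⊗≫ ε_ U U' := by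
      rw [← whisker_exchange]; monoidal
    _ = _ := by
      rw [h₂]; monoidal

end BraidedMates

/-! ### The evaluation pairing -/

section Pairing

variable {C : Type u} [Category.{v} C] [MonoidalCategory C]

/-- `A` is the dual of the co-opposite of `H`. -/
structure IsDualCop [BraidedCategory C] (H A : C) [MonObj H] [ComonObj H] [MonObj A]
    [ComonObj A] [ExactPairing H A] : Prop where
  mul : IsMate (copComul Δ[H]) μ[A]
  one : IsMate ε[H] η[A]
  comul : IsMate μ[H] Δ[A]
  counit : IsMate η[H] ε[A]

variable [SymmetricCategory C] {H A : C} [ExactPairing H A]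

lemma IsDualCop.isDualOp [HopfObj H] [HopfObj A] (h : IsDualCop H A) : IsDualOp H A where
  mul_eq := by
    rw [h.mul.eq_transpose, opMul, dualMul]
    exact ((isMate_transpose _).comp isMate_braiding).eq_transpose.symm
  one_eq := h.one.eq_transpose
  comul_eq := h.comul.eq_transpose
  counit_eq := h.counit.eq_transpose

lemma isSymmetricPairing_evalPairing : IsSymmetricPairing (evalPairing H A) :=
  ⟨isSymmetricAt_of_symmetric _ _, isSymmetricAt_of_symmetric _ _⟩

variable (H A) in
lemma braiding_nested_evaluation :
    (β_ (H ⊗ H) (A ⊗ A)).hom ≫ ε_ (H ⊗ H) (A ⊗ A) =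
      𝟙 _ ⊗≫ H ◁ evalPairing H A ▷ A ⊗≫ evalPairing H A := by
  have h₁ := isSymmetricAt_of_symmetric (evalPairing H A) A
  have h₂ := isSymmetricAt_of_symmetric (ε_ H A) A
  unfold IsSymmetricAt at h₁ h₂
  have e : H ◁ A ◁ (β_ H A).hom ≫ H ◁ A ◁ (β_ A H).hom = 𝟙 _ := by
    simp only [← whiskerLeft_comp, SymmetricCategory.symmetry, whiskerLeft_id]
  simp only [ExactPairing.tensor_evaluation]
  calc
    _ = 𝟙 _ ⊗≫ H ◁ (β_ H A).hom ▷ A ⊗≫ ((β_ H A).hom ▷ (H ⊗ A) ≫ _ ◁ (β_ H A).hom) ⊗≫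
        A ◁ evalPairing H A ▷ H ⊗≫ ε_ H A := by
      simp only [BraidedCategory.braiding_tensor_right_hom,
        BraidedCategory.braiding_tensor_left_hom, evalPairing]
      monoidal
    _ = 𝟙 _ ⊗≫ H ◁ (β_ H A).hom ▷ A ⊗≫ H ◁ A ◁ (β_ H A).hom ⊗≫
        ((β_ H A).hom ▷ A ⊗≫ A ◁ evalPairing H A ⊗≫ 𝟙 A) ▷ H ⊗≫ ε_ H A := by
      rw [← whisker_exchange]; monoidal
    _ = 𝟙 _ ⊗≫ H ◁ (β_ H A).hom ▷ A ⊗≫ H ◁ A ◁ (β_ H A).hom ⊗≫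
        H ◁ (β_ A A).hom ▷ H ⊗≫ (evalPairing H A ▷ (A ⊗ H) ≫ _ ◁ ε_ H A) ⊗≫ 𝟙 _ := by
      rw [h₁]; monoidal
    _ = 𝟙 _ ⊗≫ H ◁ (β_ H A).hom ▷ A ⊗≫ H ◁ A ◁ (β_ H A).hom ⊗≫
        H ◁ ((β_ A A).hom ▷ H ⊗≫ A ◁ ε_ H A ⊗≫ 𝟙 A) ⊗≫ evalPairing H A := by
      rw [← whisker_exchange]; monoidal
    _ = 𝟙 _ ⊗≫ H ◁ (β_ H A).hom ▷ A ⊗≫ (H ◁ A ◁ (β_ H A).hom ≫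
        H ◁ A ◁ (β_ A H).hom) ⊗≫ H ◁ ε_ H A ▷ A ⊗≫ evalPairing H A := by
      rw [h₂]; monoidal
    _ = _ := by
      rw [e]; simp only [evalPairing]; monoidal

lemma IsDualCop.whiskerLeft_mul_evalPairing [ComonObj H] [MonObj H] [MonObj A] [ComonObj A]
    (h : IsDualCop H A) :
    H ◁ μ[A] ≫ evalPairing H A = Δ[H] ▷ (A ⊗ A) ⊗≫ H ◁ (β_ H A).hom ▷ A ⊗≫
      (evalPairing H A ⊗ₘ evalPairing H A) ⊗≫ 𝟙 (𝟙_ C) := by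
  have e : μ[A] ▷ H ≫ ε_ H A = _ ◁ copComul Δ[H] ≫ _ := h.mul
  have hs := isSymmetricAt_of_symmetric (evalPairing H A) H
  unfold IsSymmetricAt at hs
  calc
    _ = Δ[H] ▷ (A ⊗ A) ≫ (β_ H H).hom ▷ (A ⊗ A) ≫ (β_ (H ⊗ H) (A ⊗ A)).hom ≫
        ε_ (H ⊗ H) (A ⊗ A) := by
      rw [evalPairing, BraidedCategory.braiding_naturality_right_assoc, e,
        ← BraidedCategory.braiding_naturality_left_assoc, copComul, comp_whiskerRight,
        Category.assoc]
    _ = Δ[H] ▷ (A ⊗ A) ⊗≫ ((β_ H H).hom ▷ A ⊗≫ H ◁ evalPairing H A ⊗≫ 𝟙 H) ▷ A ⊗≫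
        evalPairing H A := by
      rw [braiding_nested_evaluation]; monoidal
    _ = _ := by
      rw [hs, MonoidalCategory.tensorHom_def]; monoidal

lemma IsDualCop.isSkewPairing [BimonObj H] [BimonObj A] (h : IsDualCop H A) :
    IsSkewPairing (evalPairing H A) where
  mul_left := by
    have e : A ◁ μ[H] ≫ ε_ H A = Δ[A] ▷ _ ≫ _ := h.comul.symm
    rw [evalPairing, BraidedCategory.braiding_naturality_left_assoc, e,
      ← BraidedCategory.braiding_naturality_right_assoc, braiding_nested_evaluation, evalPairing]
    monoidal
  mul_right := h.whiskerLeft_mul_evalPairing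
  one_right := by
    have e : η[A] ▷ H ≫ ε_ H A = _ ◁ ε[H] ≫ _ := h.one
    rw [evalPairing, BraidedCategory.braiding_naturality_right_assoc, e,
      braiding_tensorUnit_right, evaluation_tensorUnit]
    simp [← unitors_equal]
  one_left := by
    have e : A ◁ η[H] ≫ ε_ H A = _ ▷ _ ≫ _ := h.counit.symm
    rw [evalPairing, BraidedCategory.braiding_naturality_left_assoc, e,
      braiding_tensorUnit_left, evaluation_tensorUnit]
    simp

end Pairing

/-! ### Commuting the coevaluation past a comultiplication -/

section Exchange

variable {C : Type u} [Category.{v} C] [MonoidalCategory C] [SymmetricCategory C] {H A : C}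
  [ExactPairing H A] [BimonObj H] [BimonObj A]

variable (H A) in
/-- The evaluation `A ⊗ H ⟶ 𝟙_ C` as an element of a convolution monoid. -/
def evalConv : Conv (A ⊗ H) (𝟙_ C) := ε_ H A

lemma lact_evalConv : lact (evalConv H A) =
    (Δ[A] ⊗ₘ Δ[H]) ⊗≫ A ◁ (β_ A H).hom ▷ H ⊗≫ ε_ H A ▷ (A ⊗ H) ⊗≫ 𝟙 _ := by
  change Δ[A ⊗ H] ≫ ε_ H A ▷ (A ⊗ H) ≫ _ = _
  rw [Comon.tensorObj_comul, tensorμ]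
  monoidal

lemma lact_evalConv_copComul : lact (evalConv H A) =
    (copComul Δ[A] ⊗ₘ copComul Δ[H]) ⊗≫ A ◁ (β_ A H).hom ▷ H ⊗≫ (A ⊗ H) ◁ ε_ H A ⊗≫ 𝟙 _ := by
  change Δ[A ⊗ H] ≫ ε_ H A ▷ (A ⊗ H) ≫ _ = _
  rw [Comon.tensorObj_comul, copComul, copComul, ← tensorHom_comp_tensorHom]
  have e : ((β_ A A).hom ⊗ₘ (β_ H H).hom) ⊗≫ A ◁ (β_ A H).hom ▷ H ⊗≫ (A ⊗ H) ◁ ε_ H A ⊗≫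
      𝟙 _ = tensorμ A A H H ≫ ε_ H A ▷ (A ⊗ H) ≫ (λ_ _).hom := by
    calc
      _ = (((β_ A A).hom ⊗ₘ (β_ H H).hom) ≫ tensorμ A A H H) ≫ (A ⊗ H) ◁ ε_ H A ≫
          (ρ_ _).hom := by
        rw [tensorμ]; monoidal
      _ = _ := by
        rw [← SymmetricCategory.tensorμ_braid_swap, Category.assoc,
          ← BraidedCategory.braiding_naturality_left_assoc, braiding_tensorUnit_left]
        simp
  rw [Category.assoc, ← e]
  monoidal

lemma ract_evalConv : ract (evalConv H A) =
    (Δ[A] ⊗ₘ copComul Δ[H]) ⊗≫ A ◁ ε_ H A ▷ H ⊗≫ 𝟙 _ := by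
  change Δ[A ⊗ H] ≫ (A ⊗ H) ◁ ε_ H A ≫ _ = _
  have h := isSymmetricAt_of_symmetric (ε_ H A) H
  unfold IsSymmetricAt at h
  rw [Comon.tensorObj_comul, tensorμ]
  calc
    _ = (Δ[A] ⊗ₘ Δ[H]) ⊗≫ A ◁ ((β_ A H).hom ▷ H ⊗≫ H ◁ ε_ H A ⊗≫ 𝟙 H) := by monoidal
    _ = (Δ[A] ▷ H ≫ (A ⊗ A) ◁ Δ[H] ≫ (A ⊗ A) ◁ (β_ H H).hom) ⊗≫ A ◁ ε_ H A ▷ H ⊗≫ 𝟙 _ := by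
      rw [h, MonoidalCategory.tensorHom_def]; monoidal
    _ = _ := by
      rw [copComul, MonoidalCategory.tensorHom_def]; monoidal

lemma IsDualCop.adjunctLeft_coevaluation_comul (h : IsDualCop H A) :
    adjunctLeft ((λ_ H).inv ≫ (η_ H A ⊗ₘ Δ[H]) ≫ tensorμ H A H H ≫ μ[H] ▷ (A ⊗ H)) =
      lact (evalConv H A) := by
  have e : A ◁ μ[H] ≫ ε_ H A = Δ[A] ▷ _ ≫ _ := h.comul.symm
  rw [ExactPairing.tensor_evaluation] at e
  rw [lact_evalConv, tensorμ, adjunctLeft]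
  calc
    _ = 𝟙 _ ⊗≫ A ◁ (η_ H A ⊗ₘ Δ[H]) ⊗≫ A ◁ H ◁ (β_ A H).hom ▷ H ⊗≫
        (A ◁ μ[H] ≫ ε_ H A) ▷ (A ⊗ H) ⊗≫ 𝟙 (A ⊗ H) := by monoidal
    _ = 𝟙 _ ⊗≫ A ◁ (η_ H A ⊗ₘ Δ[H]) ⊗≫ (A ◁ (H ◁ (β_ A H).hom ▷ H) ≫ Δ[A] ▷ _) ⊗≫
        A ◁ ε_ H A ▷ (H ⊗ A ⊗ H) ⊗≫ ε_ H A ▷ (A ⊗ H) ⊗≫ 𝟙 (A ⊗ H) := by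
      rw [e]; monoidal
    _ = 𝟙 _ ⊗≫ A ◁ (𝟙_ C ◁ Δ[H] ≫ η_ H A ▷ (H ⊗ H)) ⊗≫ Δ[A] ▷ (H ⊗ A ⊗ H ⊗ H) ⊗≫
        A ◁ ((A ⊗ H) ◁ (β_ A H).hom ≫ ε_ H A ▷ _) ▷ H ⊗≫ ε_ H A ▷ (A ⊗ H) ⊗≫ 𝟙 (A ⊗ H) := by
      rw [whisker_exchange, MonoidalCategory.tensorHom_def']; monoidal
    _ = 𝟙 _ ⊗≫ A ◁ Δ[H] ⊗≫ (A ◁ (η_ H A ▷ (H ⊗ H)) ≫ Δ[A] ▷ _) ⊗≫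
        A ◁ ε_ H A ▷ (A ⊗ H ⊗ H) ⊗≫ A ◁ (β_ A H).hom ▷ H ⊗≫ ε_ H A ▷ (A ⊗ H) ⊗≫ 𝟙 (A ⊗ H) := by
      rw [whisker_exchange (ε_ H A)]; monoidal
    _ = 𝟙 _ ⊗≫ A ◁ Δ[H] ⊗≫ Δ[A] ▷ (H ⊗ H) ⊗≫ A ◁ (A ◁ η_ H A ⊗≫ ε_ H A ▷ A) ▷ (H ⊗ H) ⊗≫
        A ◁ (β_ A H).hom ▷ H ⊗≫ ε_ H A ▷ (A ⊗ H) ⊗≫ 𝟙 (A ⊗ H) := by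
      rw [whisker_exchange]; monoidal
    _ = _ := by
      rw [ExactPairing.coevaluation_evaluation'', MonoidalCategory.tensorHom_def']; monoidal

lemma IsDualCop.adjunctLeft_comul_coevaluation (h : IsDualCop H A) :
    adjunctLeft ((ρ_ H).inv ≫ (copComul Δ[H] ⊗ₘ η_ H A) ≫ tensorμ H H H A ≫ μ[H] ▷ (H ⊗ A)) =
      ract (evalConv H A) ≫ (β_ A H).hom := by
  have e : A ◁ μ[H] ≫ ε_ H A = Δ[A] ▷ _ ≫ _ := h.comul.symm
  rw [ExactPairing.tensor_evaluation] at e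
  have hs := isSymmetricAt_of_symmetric (ε_ H A) H
  unfold IsSymmetricAt at hs
  rw [ract_evalConv, tensorμ, adjunctLeft]
  set k : A ⊗ H ⟶ H ⊗ A :=
    (Δ[A] ⊗ₘ copComul Δ[H]) ⊗≫ A ◁ ε_ H A ▷ H ⊗≫ (β_ A H).hom with hk
  calc
    _ = 𝟙 _ ⊗≫ A ◁ (copComul Δ[H] ⊗ₘ η_ H A) ⊗≫ A ◁ H ◁ (β_ H H).hom ▷ A ⊗≫
        (A ◁ μ[H] ≫ ε_ H A) ▷ (H ⊗ A) ⊗≫ 𝟙 (H ⊗ A) := by monoidal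
    _ = 𝟙 _ ⊗≫ A ◁ (copComul Δ[H] ⊗ₘ η_ H A) ⊗≫ (A ◁ (H ◁ (β_ H H).hom ▷ A) ≫ Δ[A] ▷ _) ⊗≫
        A ◁ ε_ H A ▷ (H ⊗ H ⊗ A) ⊗≫ ε_ H A ▷ (H ⊗ A) ⊗≫ 𝟙 (H ⊗ A) := by
      rw [e]; monoidal
    _ = 𝟙 _ ⊗≫ A ◁ (copComul Δ[H] ⊗ₘ η_ H A) ⊗≫ Δ[A] ▷ (H ⊗ H ⊗ H ⊗ A) ⊗≫
        A ◁ ((A ⊗ H) ◁ (β_ H H).hom ≫ ε_ H A ▷ _) ▷ A ⊗≫ ε_ H A ▷ (H ⊗ A) ⊗≫ 𝟙 (H ⊗ A) := by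
      rw [whisker_exchange]; monoidal
    _ = 𝟙 _ ⊗≫ A ◁ (copComul Δ[H] ⊗ₘ η_ H A) ⊗≫ Δ[A] ▷ (H ⊗ H ⊗ H ⊗ A) ⊗≫
        A ◁ ε_ H A ▷ (H ⊗ H ⊗ A) ⊗≫
        (𝟙 ((A ⊗ H) ⊗ H) ⊗≫ A ◁ (β_ H H).hom ⊗≫ ε_ H A ▷ H ⊗≫ 𝟙 H) ▷ A ⊗≫ 𝟙 (H ⊗ A) := by
      rw [whisker_exchange]; monoidal
    _ = 𝟙 _ ⊗≫ ((A ⊗ H) ◁ η_ H A ≫ k ▷ (H ⊗ A)) ⊗≫ H ◁ ε_ H A ▷ A ⊗≫ 𝟙 (H ⊗ A) := by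
      rw [← hs, hk, MonoidalCategory.tensorHom_def', MonoidalCategory.tensorHom_def']; monoidal
    _ = k ⊗≫ H ◁ (A ◁ η_ H A ⊗≫ ε_ H A ▷ A) ⊗≫ 𝟙 (H ⊗ A) := by
      rw [whisker_exchange]; monoidal
    _ = _ := by
      rw [ExactPairing.coevaluation_evaluation'', hk]; monoidal

lemma IsDualCop.adjunctRight_coevaluation_comul (h : IsDualCop H A) :
    adjunctRight ((λ_ A).inv ≫ (η_ H A ⊗ₘ Δ[A]) ≫ tensorμ H A A A ≫ (H ⊗ A) ◁ μ[A]) =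
      ract (evalConv H A) ≫ (β_ A H).hom := by
  have e : μ[A] ▷ H ≫ ε_ H A = _ ◁ copComul Δ[H] ≫ _ := h.mul
  rw [ExactPairing.tensor_evaluation] at e
  have hs := isSymmetricAt_of_symmetric (ε_ H A) A
  unfold IsSymmetricAt at hs
  rw [ract_evalConv, tensorμ, adjunctRight]
  set k : A ⊗ H ⟶ H ⊗ A :=
    (Δ[A] ⊗ₘ copComul Δ[H]) ⊗≫ A ◁ ε_ H A ▷ H ⊗≫ (β_ A H).hom with hk
  calc
    _ = 𝟙 _ ⊗≫ (η_ H A ⊗ₘ Δ[A]) ▷ H ⊗≫ (H ◁ (β_ A A).hom ▷ A) ▷ H ⊗≫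
        (H ⊗ A) ◁ (μ[A] ▷ H ≫ ε_ H A) ⊗≫ 𝟙 (H ⊗ A) := by monoidal
    _ = 𝟙 _ ⊗≫ (η_ H A ⊗ₘ Δ[A]) ▷ H ⊗≫ ((H ◁ (β_ A A).hom ▷ A) ▷ H ≫
        _ ◁ copComul Δ[H]) ⊗≫ (H ⊗ A) ◁ A ◁ ε_ H A ▷ H ⊗≫ (H ⊗ A) ◁ ε_ H A ⊗≫ 𝟙 (H ⊗ A) := by
      rw [e]; monoidal
    _ = 𝟙 _ ⊗≫ (η_ H A ⊗ₘ Δ[A]) ▷ H ⊗≫ (H ⊗ A ⊗ A ⊗ A) ◁ copComul Δ[H] ⊗≫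
        H ◁ ((β_ A A).hom ▷ (A ⊗ H) ≫ (A ⊗ A) ◁ ε_ H A) ▷ H ⊗≫ (H ⊗ A) ◁ ε_ H A ⊗≫
        𝟙 (H ⊗ A) := by
      rw [← whisker_exchange]; monoidal
    _ = 𝟙 _ ⊗≫ (η_ H A ⊗ₘ Δ[A]) ▷ H ⊗≫ (H ⊗ A ⊗ A ⊗ A) ◁ copComul Δ[H] ⊗≫
        H ◁ (A ⊗ A) ◁ ε_ H A ▷ H ⊗≫ H ◁ ((β_ A A).hom ▷ H ⊗≫ A ◁ ε_ H A ⊗≫ 𝟙 A) ⊗≫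
        𝟙 (H ⊗ A) := by
      rw [← whisker_exchange]; monoidal
    _ = 𝟙 _ ⊗≫ (η_ H A ▷ (A ⊗ H) ≫ (H ⊗ A) ◁ k) ⊗≫ H ◁ ε_ H A ▷ A ⊗≫ 𝟙 (H ⊗ A) := by
      rw [hs, hk, MonoidalCategory.tensorHom_def, MonoidalCategory.tensorHom_def]; monoidal
    _ = k ⊗≫ (η_ H A ▷ H ⊗≫ H ◁ ε_ H A) ▷ A ⊗≫ 𝟙 (H ⊗ A) := by
      rw [← whisker_exchange]; monoidal
    _ = _ := by
      rw [ExactPairing.evaluation_coevaluation'', hk]; monoidal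

lemma IsDualCop.adjunctRight_comul_coevaluation (h : IsDualCop H A) :
    adjunctRight ((ρ_ A).inv ≫ (copComul Δ[A] ⊗ₘ η_ H A) ≫ tensorμ A A H A ≫ (A ⊗ H) ◁ μ[A]) =
      lact (evalConv H A) := by
  have e : μ[A] ▷ H ≫ ε_ H A = _ ◁ copComul Δ[H] ≫ _ := h.mul
  rw [ExactPairing.tensor_evaluation] at e
  rw [lact_evalConv_copComul, tensorμ, adjunctRight]
  calc
    _ = 𝟙 _ ⊗≫ (copComul Δ[A] ⊗ₘ η_ H A) ▷ H ⊗≫ (A ◁ (β_ A H).hom ▷ A) ▷ H ⊗≫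
        (A ⊗ H) ◁ (μ[A] ▷ H ≫ ε_ H A) ⊗≫ 𝟙 (A ⊗ H) := by monoidal
    _ = 𝟙 _ ⊗≫ (copComul Δ[A] ⊗ₘ η_ H A) ▷ H ⊗≫ ((A ◁ (β_ A H).hom ▷ A) ▷ H ≫
        _ ◁ copComul Δ[H]) ⊗≫ (A ⊗ H) ◁ A ◁ ε_ H A ▷ H ⊗≫ (A ⊗ H) ◁ ε_ H A ⊗≫ 𝟙 (A ⊗ H) := by
      rw [e]; monoidal
    _ = 𝟙 _ ⊗≫ copComul Δ[A] ▷ H ⊗≫ (A ⊗ A) ◁ (η_ H A ▷ H ≫ (H ⊗ A) ◁ copComul Δ[H]) ⊗≫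
        A ◁ ((β_ A H).hom ▷ (A ⊗ H) ≫ (H ⊗ A) ◁ ε_ H A) ▷ H ⊗≫ (A ⊗ H) ◁ ε_ H A ⊗≫
        𝟙 (A ⊗ H) := by
      rw [← whisker_exchange, MonoidalCategory.tensorHom_def]; monoidal
    _ = 𝟙 _ ⊗≫ copComul Δ[A] ▷ H ⊗≫ (A ⊗ A) ◁ copComul Δ[H] ⊗≫
        (A ⊗ A) ◁ (η_ H A ▷ H ⊗≫ H ◁ ε_ H A) ▷ H ⊗≫ A ◁ (β_ A H).hom ▷ H ⊗≫
        (A ⊗ H) ◁ ε_ H A ⊗≫ 𝟙 (A ⊗ H) := by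
      rw [← whisker_exchange, ← whisker_exchange]; monoidal
    _ = _ := by
      rw [ExactPairing.evaluation_coevaluation'', MonoidalCategory.tensorHom_def]; monoidal

lemma ract_evalConv_exchange (t : (Conv (H ⊗ A) (𝟙_ C))ˣ) (ht : convHom t.1 = evalPairing H A) :
    ract (evalConv H A) ≫ (β_ A H).hom ≫ exchange t = lact (evalConv H A) := by
  have e : convComap (𝟙_ C) (β_ A H).hom t.1 = evalConv H A := by
    change (β_ A H).hom ≫ convHom t.1 = ε_ H A
    rw [ht, evalPairing, SymmetricCategory.symmetry_assoc]
  rw [exchange, ← e, ← Category.assoc, ← comp_ract, Category.assoc, ← Category.assoc (ract t.1),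
    ract_conj, ← Category.assoc, comp_lact, Category.assoc, SymmetricCategory.symmetry,
    Category.comp_id]

lemma IsDualCop.coevaluation_exchange (h : IsDualCop H A) (t : (Conv (H ⊗ A) (𝟙_ C))ˣ)
    (ht : convHom t.1 = evalPairing H A) :
    (ρ_ H).inv ≫ (copComul Δ[H] ⊗ₘ η_ H A) ≫ tensorμ H H H A ≫ (μ[H] ⊗ₘ exchange t) =
      (λ_ H).inv ≫ (η_ H A ⊗ₘ Δ[H]) ≫ tensorμ H A H H ≫ μ[H] ▷ (A ⊗ H) := by
  apply adjunctLeft_injective (A := A)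
  calc
    _ = adjunctLeft (((ρ_ H).inv ≫ (copComul Δ[H] ⊗ₘ η_ H A) ≫ tensorμ H H H A ≫
        μ[H] ▷ (H ⊗ A)) ≫ H ◁ exchange t) := by
      simp only [MonoidalCategory.tensorHom_def μ[H], Category.assoc]
    _ = lact (evalConv H A) := by
      rw [adjunctLeft_comp_whiskerLeft, h.adjunctLeft_comul_coevaluation, Category.assoc,
        ract_evalConv_exchange t ht]
    _ = _ := h.adjunctLeft_coevaluation_comul.symm

lemma IsDualCop.exchange_coevaluation (h : IsDualCop H A) (t : (Conv (H ⊗ A) (𝟙_ C))ˣ)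
    (ht : convHom t.1 = evalPairing H A) :
    (ρ_ A).inv ≫ (copComul Δ[A] ⊗ₘ η_ H A) ≫ tensorμ A A H A ≫ (A ⊗ H) ◁ μ[A] =
      (λ_ A).inv ≫ (η_ H A ⊗ₘ Δ[A]) ≫ tensorμ H A A A ≫ (exchange t ⊗ₘ μ[A]) := by
  apply adjunctRight_injective (H := H)
  symm
  calc
    _ = adjunctRight (((λ_ A).inv ≫ (η_ H A ⊗ₘ Δ[A]) ≫ tensorμ H A A A ≫
        (H ⊗ A) ◁ μ[A]) ≫ exchange t ▷ A) := by
      simp only [MonoidalCategory.tensorHom_def' (exchange t), Category.assoc]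
    _ = lact (evalConv H A) := by
      rw [adjunctRight_comp_whiskerRight, h.adjunctRight_coevaluation_comul, Category.assoc,
        ract_evalConv_exchange t ht]
    _ = _ := h.adjunctRight_comul_coevaluation.symm

end Exchange

/-! ### The `R`-matrix -/

section Intertwining

variable {C : Type u} [Category.{v} C] [MonoidalCategory C] {M : C} [MonObj M]

/-- `p r = r q` for `r : 𝟙_ C ⟶ M`. -/
def Intertwines (r : 𝟙_ C ⟶ M) {X : C} (p q : X ⟶ M) : Prop :=
  (ρ_ X).inv ≫ (p ⊗ₘ r) ≫ μ[M] = (λ_ X).inv ≫ (r ⊗ₘ q) ≫ μ[M]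

lemma Intertwines.mul {r : 𝟙_ C ⟶ M} {X Y : C} {p q : X ⟶ M} {p' q' : Y ⟶ M}
    (h : Intertwines r p q) (h' : Intertwines r p' q') :
    Intertwines r ((p ⊗ₘ p') ≫ μ[M]) ((q ⊗ₘ q') ≫ μ[M]) := by
  unfold Intertwines at *
  calc
    _ = 𝟙 _ ⊗≫ p ▷ Y ⊗≫ M ◁ p' ⊗≫ ((M ⊗ M) ◁ r ≫ μ[M] ▷ M) ≫ μ[M] := by
      simp only [MonoidalCategory.tensorHom_def]
      rw [whisker_exchange]; monoidal
    _ = 𝟙 _ ⊗≫ p ▷ Y ⊗≫ M ◁ p' ⊗≫ M ◁ M ◁ r ⊗≫ (μ[M] ▷ M ≫ μ[M]) := by monoidal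
    _ = 𝟙 _ ⊗≫ p ▷ Y ⊗≫ M ◁ ((ρ_ Y).inv ≫ (p' ⊗ₘ r) ≫ μ[M]) ≫ μ[M] := by
      rw [MonObj.mul_assoc, MonoidalCategory.tensorHom_def]; monoidal
    _ = 𝟙 _ ⊗≫ p ▷ Y ⊗≫ M ◁ r ▷ Y ⊗≫ (M ◁ M ◁ q' ≫ M ◁ μ[M]) ≫ μ[M] := by
      rw [h', MonoidalCategory.tensorHom_def]; monoidal
    _ = 𝟙 _ ⊗≫ p ▷ Y ⊗≫ M ◁ r ▷ Y ⊗≫ (M ⊗ M) ◁ q' ⊗≫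
        ((α_ M M M).hom ≫ M ◁ μ[M] ≫ μ[M]) := by monoidal
    _ = 𝟙 _ ⊗≫ p ▷ Y ⊗≫ M ◁ r ▷ Y ⊗≫ ((M ⊗ M) ◁ q' ≫ μ[M] ▷ M) ≫ μ[M] := by
      rw [← MonObj.mul_assoc]; monoidal
    _ = ((ρ_ X).inv ≫ (p ⊗ₘ r) ≫ μ[M]) ▷ Y ⊗≫ M ◁ q' ≫ μ[M] := by
      rw [whisker_exchange, MonoidalCategory.tensorHom_def]; monoidal
    _ = 𝟙 _ ⊗≫ r ▷ (X ⊗ Y) ⊗≫ M ◁ q ▷ Y ⊗≫ (μ[M] ▷ Y ≫ M ◁ q') ≫ μ[M] := by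
      rw [h, MonoidalCategory.tensorHom_def]; monoidal
    _ = 𝟙 _ ⊗≫ r ▷ (X ⊗ Y) ⊗≫ M ◁ q ▷ Y ⊗≫ M ◁ M ◁ q' ⊗≫ (μ[M] ▷ M ≫ μ[M]) := by
      rw [← whisker_exchange]; monoidal
    _ = _ := by
      rw [MonObj.mul_assoc]
      simp only [MonoidalCategory.tensorHom_def]
      monoidal

lemma Intertwines.of_epi {r : 𝟙_ C ⟶ M} {X Y : C} {p q : X ⟶ M} (e : Y ⟶ X) [Epi e]
    (h : Intertwines r (e ≫ p) (e ≫ q)) : Intertwines r p q := by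
  unfold Intertwines at *
  rw [← cancel_epi e]
  have h₁ : e ≫ (ρ_ X).inv ≫ (p ⊗ₘ r) ≫ μ[M] = (ρ_ Y).inv ≫ ((e ≫ p) ⊗ₘ r) ≫ μ[M] := by
    simp [MonoidalCategory.tensorHom_def]
  have h₂ : e ≫ (λ_ X).inv ≫ (r ⊗ₘ q) ≫ μ[M] = (λ_ Y).inv ≫ (r ⊗ₘ (e ≫ q)) ≫ μ[M] := by
    simp [MonoidalCategory.tensorHom_def']
  rw [h₁, h₂, h]

end Intertwining

section CopComul

variable {C : Type u} [Category.{v} C] [MonoidalCategory C] [SymmetricCategory C]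

attribute [local instance] ComonObj.instTensorUnit

instance isMonHom_comul {C : Type u} [Category.{v} C] [MonoidalCategory C] [BraidedCategory C]
    (D : C) [BimonObj D] : IsMonHom Δ[D] where
  one_hom := BimonObj.one_comul D
  mul_hom := by rw [BimonObj.mul_comul, MonObj.tensorObj.mul_def]

instance isMonHom_copComul (D : C) [BimonObj D] : IsMonHom (copComul Δ[D]) := by
  unfold copComul; infer_instance

lemma comp_copComul {C : Type u} [Category.{v} C] [MonoidalCategory C] [BraidedCategory C]
    {X Y : C} [ComonObj X] [ComonObj Y] (f : X ⟶ Y) [IsComonHom f] :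
    f ≫ copComul Δ[Y] = copComul Δ[X] ≫ (f ⊗ₘ f) := by
  simp only [copComul, Category.assoc, IsComonHom.hom_comul_assoc,
    BraidedCategory.braiding_naturality]

variable (D : C) [ComonObj D]

lemma copComul_counit_left : copComul Δ[D] ≫ ε[D] ▷ D = (λ_ D).inv := by
  rw [copComul, Category.assoc, ← BraidedCategory.braiding_naturality_right,
    braiding_tensorUnit_right, ComonObj.comul_counit_assoc]
  simp

lemma copComul_counit_right : copComul Δ[D] ≫ D ◁ ε[D] = (ρ_ D).inv := by
  rw [copComul, Category.assoc, ← BraidedCategory.braiding_naturality_left,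
    braiding_tensorUnit_left, ComonObj.counit_comul_assoc]
  simp

lemma copComul_coassoc : copComul Δ[D] ≫ D ◁ copComul Δ[D] =
    copComul Δ[D] ≫ copComul Δ[D] ▷ D ≫ (α_ D D D).hom := by
  simp only [copComul, whiskerLeft_comp, comp_whiskerRight, Category.assoc]
  rw [← BraidedCategory.braiding_naturality_left_assoc,
    ← BraidedCategory.braiding_naturality_right_assoc, ComonObj.comul_assoc_assoc]
  have e : (α_ D D D).hom ≫ (β_ D (D ⊗ D)).hom ≫ (β_ D D).hom ▷ D ≫ (α_ D D D).hom =
      (β_ (D ⊗ D) D).hom ≫ D ◁ (β_ D D).hom := by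
    rw [← BraidedCategory.braiding_naturality_right_assoc]
    simp only [BraidedCategory.braiding_tensor_right_hom, BraidedCategory.braiding_tensor_left_hom]
    simp
  rw [← e]

end CopComul

section Coevaluation

variable {C : Type u} [Category.{v} C] [MonoidalCategory C]

lemma nested_coevaluation_tensorHom {H A K B M M' N N' : C} [ExactPairing H A] [ExactPairing K B]
    (f : H ⟶ M) (f' : A ⟶ M') (g : K ⟶ N) (g' : B ⟶ N') :
    η_ (H ⊗ K) (B ⊗ A) ≫ ((f ⊗ₘ g) ⊗ₘ (g' ⊗ₘ f')) =
      (η_ H A ≫ (f ⊗ₘ f')) ⊗≫ M ◁ (η_ K B ≫ (g ⊗ₘ g')) ▷ M' ⊗≫ 𝟙 ((M ⊗ N) ⊗ (N' ⊗ M')) := by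
  calc
    _ = η_ H A ⊗≫ (H ◁ η_ K B ≫ f ▷ (K ⊗ B)) ▷ A ⊗≫ M ◁ (g ▷ B ≫ N ◁ g') ▷ A ⊗≫
        M ◁ (N ⊗ N') ◁ f' ⊗≫ 𝟙 _ := by
      rw [ExactPairing.tensor_coevaluation]; simp only [MonoidalCategory.tensorHom_def]; monoidal
    _ = η_ H A ⊗≫ f ▷ A ⊗≫ M ◁ ((η_ K B ≫ (g ⊗ₘ g')) ▷ A ≫ (N ⊗ N') ◁ f') ⊗≫ 𝟙 _ := by
      rw [whisker_exchange, MonoidalCategory.tensorHom_def g]; monoidal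
    _ = _ := by
      rw [← whisker_exchange, MonoidalCategory.tensorHom_def f]; monoidal

variable [SymmetricCategory C] {H A : C} [ExactPairing H A]

lemma nested_coevaluation_braiding :
    η_ (H ⊗ H) (A ⊗ A) ≫ (β_ H H).hom ▷ (A ⊗ A) =
      (ρ_ (𝟙_ C)).inv ≫ (η_ H A ⊗ₘ η_ H A) ≫ tensorμ H A H A := by
  rw [ExactPairing.tensor_coevaluation, tensorμ]
  have h : (ρ_ H).inv ≫ H ◁ η_ H A ≫ (β_ H (H ⊗ A)).hom = (λ_ H).inv ≫ η_ H A ▷ H := by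
    rw [BraidedCategory.braiding_naturality_right, braiding_tensorUnit_right]
    simp
  have h' : 𝟙 H ⊗≫ H ◁ η_ H A ⊗≫ (β_ H H).hom ▷ A ⊗≫ 𝟙 ((H ⊗ H) ⊗ A) =
      𝟙 H ⊗≫ η_ H A ▷ H ⊗≫ H ◁ (β_ A H).hom ⊗≫ 𝟙 ((H ⊗ H) ⊗ A) := by
    have e : H ◁ (β_ H A).hom ≫ H ◁ (β_ A H).hom = 𝟙 _ := by
      rw [← whiskerLeft_comp, SymmetricCategory.symmetry, whiskerLeft_id]
    calc
      _ = 𝟙 H ⊗≫ H ◁ η_ H A ⊗≫ (β_ H H).hom ▷ A ⊗≫ (H ◁ (β_ H A).hom ≫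
          H ◁ (β_ A H).hom) ⊗≫ 𝟙 ((H ⊗ H) ⊗ A) := by rw [e]; monoidal
      _ = ((ρ_ H).inv ≫ H ◁ η_ H A ≫ (β_ H (H ⊗ A)).hom) ⊗≫
          H ◁ (β_ A H).hom ⊗≫ 𝟙 ((H ⊗ H) ⊗ A) := by
        rw [BraidedCategory.braiding_tensor_right_hom]; monoidal
      _ = _ := by rw [h]; monoidal
  calc
    _ = η_ H A ⊗≫ (𝟙 H ⊗≫ H ◁ η_ H A ⊗≫ (β_ H H).hom ▷ A ⊗≫ 𝟙 ((H ⊗ H) ⊗ A)) ▷ A ⊗≫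
        𝟙 _ := by monoidal
    _ = 𝟙 _ ⊗≫ ((𝟙_ C) ◁ η_ H A ≫ η_ H A ▷ (H ⊗ A)) ⊗≫ H ◁ (β_ A H).hom ▷ A ⊗≫
        𝟙 _ := by
      rw [h']; monoidal
    _ = _ := by
      rw [MonoidalCategory.tensorHom_def']; monoidal

variable [MonObj H] [ComonObj H] [MonObj A] [ComonObj A]

lemma IsDualCop.coevaluation_comul (h : IsDualCop H A) :
    η_ H A ≫ Δ[H] ▷ A =
      (ρ_ (𝟙_ C)).inv ≫ (η_ H A ⊗ₘ η_ H A) ≫ tensorμ H A H A ≫ (H ⊗ H) ◁ μ[A] := by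
  have e := h.mul.coevaluation
  have e' : (β_ H H).hom ▷ A ≫ (β_ H H).hom ▷ A = 𝟙 _ := by
    rw [← comp_whiskerRight, SymmetricCategory.symmetry, id_whiskerRight]
  calc
    _ = (η_ H A ≫ copComul Δ[H] ▷ A) ≫ (β_ H H).hom ▷ A := by
      rw [copComul, comp_whiskerRight, Category.assoc, Category.assoc, e', Category.comp_id]
    _ = (η_ (H ⊗ H) (A ⊗ A) ≫ (β_ H H).hom ▷ (A ⊗ A)) ≫ (H ⊗ H) ◁ μ[A] := by
      rw [e, Category.assoc, whisker_exchange, Category.assoc]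
    _ = _ := by rw [nested_coevaluation_braiding]; simp only [Category.assoc]

lemma IsDualCop.coevaluation_convHom_mul (h : IsDualCop H A) {N : C} [MonObj N] (f g : Conv H N) :
    η_ H A ≫ convHom (f * g) ▷ A =
      (λ_ (𝟙_ C)).inv ≫ ((η_ H A ≫ convHom f ▷ A) ⊗ₘ (η_ H A ≫ convHom g ▷ A)) ≫
        tensorμ N A N A ≫ (μ[N] ⊗ₘ μ[A]) := by
  calc
    _ = (η_ H A ≫ Δ[H] ▷ A) ≫ ((convHom f ⊗ₘ convHom g) ≫ μ[N]) ▷ A := by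
      rw [convHom_mul, MonoidalCategory.tensorHom_def]
      simp only [comp_whiskerRight, Category.assoc]
    _ = (λ_ (𝟙_ C)).inv ≫ (η_ H A ⊗ₘ η_ H A) ≫ tensorμ H A H A ≫
        ((convHom f ⊗ₘ convHom g) ⊗ₘ 𝟙 (A ⊗ A)) ≫ (μ[N] ⊗ₘ μ[A]) := by
      rw [h.coevaluation_comul, ← unitors_inv_equal, tensorHom_comp_tensorHom, Category.id_comp,
        MonoidalCategory.tensorHom_def' _ μ[A]]
      simp only [Category.assoc]
    _ = _ := by
      rw [← id_tensorHom_id, ← tensorμ_natural_assoc, tensorHom_comp_tensorHom_assoc, tensorHom_id,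
        tensorHom_id]

attribute [local instance] ComonObj.instTensorUnit

/-- Transposition `f ↦ (f ⊗ id) b` as a homomorphism of convolution monoids. -/
def IsDualCop.coevaluationConv (h : IsDualCop H A) (N : C) [MonObj N] :
    Conv H N →* Conv (𝟙_ C) (N ⊗ A) where
  toFun f := η_ H A ≫ convHom f ▷ A
  map_one' := by
    have e : η_ H A ≫ ε[H] ▷ A = _ ≫ _ ◁ η[A] := h.one.coevaluation
    change η_ H A ≫ (ε[H] ≫ η[N]) ▷ A = 𝟙 (𝟙_ C) ≫ (λ_ (𝟙_ C)).inv ≫ (η[N] ⊗ₘ η[A])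
    have e' : η_ (𝟙_ C) (𝟙_ C) = (λ_ (𝟙_ C)).inv := unitors_inv_equal.symm
    rw [comp_whiskerRight, reassoc_of% e, MonoidalCategory.tensorHom_def', Category.id_comp, e']
  map_mul' f g := by
    rw [h.coevaluation_convHom_mul, MonoidalCategory.tensorHom_def, Category.assoc]
    rfl

end Coevaluation

section RMatrix

variable {C : Type u} [Category.{v} C] [MonoidalCategory C] [SymmetricCategory C]
  {H A D : C} [ExactPairing H A] [BimonObj A] [BimonObj D] (iH : H ⟶ D) (iA : A ⟶ D)

section Bimonoid

variable [BimonObj H]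

lemma IsDualCop.copComul_whiskerRight_coevaluation (h : IsDualCop H A) [IsComonHom iH]
    [IsMonHom iA] :
    (η_ H A ≫ (iH ⊗ₘ iA)) ≫ copComul Δ[D] ▷ D =
      (η_ H A ≫ (iH ⊗ₘ iA)) ⊗≫ D ◁ (η_ H A ≫ (iH ⊗ₘ iA)) ▷ D ⊗≫ (D ⊗ D) ◁ μ[D] := by
  calc
    _ = (η_ H A ≫ copComul Δ[H] ▷ A) ≫ ((iH ⊗ₘ iH) ⊗ₘ iA) := by
      simp only [Category.assoc, ← tensorHom_id, tensorHom_comp_tensorHom, comp_copComul,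
        Category.id_comp, Category.comp_id]
    _ = (η_ (H ⊗ H) (A ⊗ A) ≫ ((iH ⊗ₘ iH) ⊗ₘ (iA ⊗ₘ iA))) ≫ (D ⊗ D) ◁ μ[D] := by
      rw [h.mul.coevaluation]
      simp only [Category.assoc, ← id_tensorHom, tensorHom_comp_tensorHom, IsMonHom.mul_hom,
        Category.id_comp, Category.comp_id]
    _ = _ := by
      rw [nested_coevaluation_tensorHom]
      generalize η_ H A ≫ (iH ⊗ₘ iA) = r
      monoidal

lemma IsDualCop.whiskerLeft_comul_coevaluation (h : IsDualCop H A) [IsMonHom iH] [IsComonHom iA] :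
    (η_ H A ≫ (iH ⊗ₘ iA)) ≫ D ◁ Δ[D] =
      (η_ H A ≫ (iH ⊗ₘ iA)) ⊗≫ D ◁ (η_ H A ≫ (iH ⊗ₘ iA)) ▷ D ⊗≫ μ[D] ▷ (D ⊗ D) := by
  calc
    _ = (η_ H A ≫ H ◁ Δ[A]) ≫ (iH ⊗ₘ (iA ⊗ₘ iA)) := by
      simp only [Category.assoc, ← id_tensorHom, tensorHom_comp_tensorHom, IsComonHom.hom_comul,
        Category.id_comp, Category.comp_id]
    _ = (η_ (H ⊗ H) (A ⊗ A) ≫ ((iH ⊗ₘ iH) ⊗ₘ (iA ⊗ₘ iA))) ≫ μ[D] ▷ (D ⊗ D) := by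
      rw [← h.comul.coevaluation]
      simp only [Category.assoc, ← tensorHom_id, tensorHom_comp_tensorHom, IsMonHom.mul_hom,
        Category.id_comp, Category.comp_id]
    _ = _ := by
      rw [nested_coevaluation_tensorHom]
      generalize η_ H A ≫ (iH ⊗ₘ iA) = r
      monoidal

variable (t : (Conv (H ⊗ A) (𝟙_ C))ˣ)

lemma IsDualCop.intertwines_left [IsMonHom iH] [IsComonHom iH] (h : IsDualCop H A)
    (ht : convHom t.1 = evalPairing H A)
    (hx : (iH ⊗ₘ iA) ≫ μ[D] = exchange t ≫ (iA ⊗ₘ iH) ≫ μ[D]) :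
    Intertwines (η_ H A ≫ (iH ⊗ₘ iA)) (iH ≫ copComul Δ[D]) (iH ≫ Δ[D]) := by
  unfold Intertwines
  rw [comp_copComul, IsComonHom.hom_comul]
  simp only [← tensorHom_comp_tensorHom, MonObj.tensorObj.mul_def, Category.assoc,
    tensorμ_natural_assoc]
  rw [tensorHom_comp_tensorHom, tensorHom_comp_tensorHom, ← IsMonHom.mul_hom, hx,
    ← tensorHom_comp_tensorHom, reassoc_of% h.coevaluation_exchange t ht, ← tensorHom_id,
    tensorHom_comp_tensorHom, Category.id_comp]

lemma IsDualCop.intertwines_right [IsMonHom iA] [IsComonHom iA] (h : IsDualCop H A)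
    (ht : convHom t.1 = evalPairing H A)
    (hx : (iH ⊗ₘ iA) ≫ μ[D] = exchange t ≫ (iA ⊗ₘ iH) ≫ μ[D]) :
    Intertwines (η_ H A ≫ (iH ⊗ₘ iA)) (iA ≫ copComul Δ[D]) (iA ≫ Δ[D]) := by
  unfold Intertwines
  rw [comp_copComul, IsComonHom.hom_comul]
  simp only [← tensorHom_comp_tensorHom, MonObj.tensorObj.mul_def, Category.assoc,
    tensorμ_natural_assoc]
  rw [tensorHom_comp_tensorHom, tensorHom_comp_tensorHom, ← IsMonHom.mul_hom, hx,
    ← tensorHom_comp_tensorHom (exchange t), ← reassoc_of% h.exchange_coevaluation t ht,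
    ← id_tensorHom, tensorHom_comp_tensorHom, Category.id_comp]

lemma IsDualCop.intertwines [IsMonHom iH] [IsComonHom iH] [IsMonHom iA] [IsComonHom iA]
    (h : IsDualCop H A)
    (ht : convHom t.1 = evalPairing H A)
    (hx : (iH ⊗ₘ iA) ≫ μ[D] = exchange t ≫ (iA ⊗ₘ iH) ≫ μ[D]) [Epi ((iA ⊗ₘ iH) ≫ μ[D])] :
    Intertwines (η_ H A ≫ (iH ⊗ₘ iA)) (copComul Δ[D]) Δ[D] := by
  have e := (h.intertwines_right iH iA t ht hx).mul (h.intertwines_left iH iA t ht hx)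
  apply Intertwines.of_epi ((iA ⊗ₘ iH) ≫ μ[D])
  rw [Category.assoc, Category.assoc, IsMonHom.mul_hom, IsMonHom.mul_hom,
    tensorHom_comp_tensorHom_assoc, tensorHom_comp_tensorHom_assoc]
  exact e

end Bimonoid

variable [HopfObj H] [IsMonHom iH] [IsMonHom iA]

attribute [local instance] ComonObj.instTensorUnit

lemma IsDualCop.exists_isConvInverse (h : IsDualCop H A) :
    ∃ R', IsConvInverse (η_ H A ≫ (iH ⊗ₘ iA)) R' := by
  let u := Units.map ((convMap (𝟙_ C) (iH ⊗ₘ iA)).comp (h.coevaluationConv H)) (idUnit H)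
  have hu : convHom u.1 = η_ H A ≫ (iH ⊗ₘ iA) := by
    change (η_ H A ≫ 𝟙 H ▷ A) ≫ (iH ⊗ₘ iA) = _
    simp
  rw [← hu]
  exact ⟨convHom (u⁻¹).1, u.mul_inv, u.inv_mul⟩

theorem IsDualCop.isQuasitriangular [IsComonHom iH] [IsComonHom iA] (h : IsDualCop H A)
    (t : (Conv (H ⊗ A) (𝟙_ C))ˣ) (ht : convHom t.1 = evalPairing H A)
    (hx : (iH ⊗ₘ iA) ≫ μ[D] = exchange t ≫ (iA ⊗ₘ iH) ≫ μ[D]) [Epi ((iA ⊗ₘ iH) ≫ μ[D])] :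
    IsQuasitriangular D (η_ H A ≫ (iH ⊗ₘ iA)) where
  invertible := h.exists_isConvInverse iH iA
  coassoc := copComul_coassoc D
  counit_left := copComul_counit_left D
  counit_right := copComul_counit_right D
  qt1 := h.copComul_whiskerRight_coevaluation iH iA
  qt2 := h.whiskerLeft_comul_coevaluation iH iA
  qt3 := by
    have e := h.intertwines iH iA t ht hx
    unfold Intertwines at e
    simp only [MonObj.tensorObj.mul_def, tensorμ] at e
    generalize η_ H A ≫ (iH ⊗ₘ iA) = R at *
    calc
      _ = (ρ_ D).inv ≫ (copComul Δ[D] ⊗ₘ R) ≫ _ := by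
        generalize copComul Δ[D] ⊗ₘ R = k
        monoidal
      _ = _ := e
      _ = _ := by
        generalize R ⊗ₘ Δ[D] = k
        monoidal

end RMatrix

/-! ### The Drinfeld double in a symmetric category -/

section PairingInverse

variable {C : Type u} [Category.{v} C] [MonoidalCategory C] [BraidedCategory C] {H A : C}
  [BimonObj H] [BimonObj A] {p : H ⊗ A ⟶ 𝟙_ C}

lemma IsSkewPairing.whiskerLeft_convHom_mul (h : IsSkewPairing p) (f g : Conv A A) :
    H ◁ convHom (f * g) ≫ p =
      Δ[H ⊗ A] ≫ ((H ◁ convHom f ≫ p) ⊗ₘ (H ◁ convHom g ≫ p)) ≫ (λ_ (𝟙_ C)).hom := by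
  have e : H ◁ μ[A] ≫ p = Δ[H] ▷ (A ⊗ A) ≫ tensorμ H H A A ≫ (p ⊗ₘ p) ≫ (λ_ (𝟙_ C)).hom := by
    rw [h.mul_right, tensorμ]; monoidal
  calc
    _ = H ◁ Δ[A] ≫ H ◁ (convHom f ⊗ₘ convHom g) ≫ H ◁ μ[A] ≫ p := by
      rw [convHom_mul, MonoidalCategory.tensorHom_def]
      simp only [whiskerLeft_comp, Category.assoc]
    _ = (Δ[H] ⊗ₘ Δ[A]) ≫ ((𝟙 H ⊗ₘ 𝟙 H) ⊗ₘ (convHom f ⊗ₘ convHom g)) ≫ tensorμ H H A A ≫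
        (p ⊗ₘ p) ≫ (λ_ (𝟙_ C)).hom := by
      rw [e, whisker_exchange_assoc, whisker_exchange_assoc, id_tensorHom_id, id_tensorHom,
        MonoidalCategory.tensorHom_def Δ[H], Category.assoc]
    _ = _ := by
      rw [tensorμ_natural_assoc, tensorHom_comp_tensorHom_assoc, Comon.tensorObj_comul,
        Category.assoc, id_tensorHom, id_tensorHom]

/-- Pairing the second factor, `f ↦ p (id ⊗ f)`, as a homomorphism of convolution monoids. -/
def IsSkewPairing.whiskerLeftConv (h : IsSkewPairing p) : Conv A A →* Conv (H ⊗ A) (𝟙_ C) where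
  toFun f := H ◁ convHom f ≫ p
  map_one' := by
    change H ◁ (ε[A] ≫ η[A]) ≫ p = ε[H ⊗ A] ≫ 𝟙 _
    have e : H ◁ η[A] ≫ p = (ρ_ H).hom ≫ ε[H] := by rw [← h.one_right, Iso.hom_inv_id_assoc]
    have e' : ε[H ⊗ A] = (ε[H] ⊗ₘ ε[A]) ≫ (λ_ (𝟙_ C)).hom := rfl
    rw [whiskerLeft_comp, Category.assoc, e, e', Category.comp_id, MonoidalCategory.tensorHom_def']
    simp [unitors_equal]
  map_mul' f g := by
    rw [h.whiskerLeft_convHom_mul, MonoidalCategory.tensorHom_def, Category.assoc]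
    rfl

end PairingInverse

lemma coevalMatrix_eq {C : Type u} [Category.{v} C] [MonoidalCategory C] {H A : C}
    [ExactPairing H A] [MonObj H] [MonObj A] :
    coevalMatrix H A = η_ H A ≫ (unitInr A H ⊗ₘ unitInl A H) := by
  calc
    _ = 𝟙 _ ⊗≫ (η[A] ▷ 𝟙_ C ≫ A ◁ η_ H A) ⊗≫ (A ⊗ H ⊗ A) ◁ η[H] ⊗≫ 𝟙 _ := by
      rw [coevalMatrix, MonoidalCategory.tensorHom_def, MonoidalCategory.tensorHom_def]
      monoidal
    _ = _ := by
      rw [← whisker_exchange, MonoidalCategory.tensorHom_def, unitInl, unitInr]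
      monoidal

section SymmetricDouble

variable {C : Type u} [Category.{v} C] [MonoidalCategory C] [SymmetricCategory C] {H A : C}
  [ExactPairing H A] [HopfObj H] [HopfObj A]

theorem IsDualCop.isQuasitriangularHopf (h : IsDualCop H A) (t : (Conv (H ⊗ A) (𝟙_ C))ˣ)
    (ht : convHom t.1 = evalPairing H A) :
    IsQuasitriangularHopf (doubleCrossMul (evalPairing H A) (convHom (t⁻¹).1))
      η[A ⊗ H] Δ[A ⊗ H] ε[A ⊗ H] (coevalMatrix H A) := by
  have hp : IsSkewPairing (convHom t.1) := ht ▸ h.isSkewPairing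
  have hd : IsDistributiveLaw (exchange t) := hp.isDistributiveLaw
  let iA : A ⟶ CrossProduct hd := CrossProduct.inl hd
  let iH : H ⟶ CrossProduct hd := CrossProduct.inr hd
  have hi : (iA ⊗ₘ iH) ≫ μ[CrossProduct hd] = 𝟙 (A ⊗ H) := CrossProduct.inl_tensorHom_inr_mul hd
  have hx : (iH ⊗ₘ iA) ≫ μ[CrossProduct hd] =
      exchange t ≫ (iA ⊗ₘ iH) ≫ μ[CrossProduct hd] := by
    rw [hi, CrossProduct.inr_tensorHom_inl_mul]
    exact (Category.comp_id _).symm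
  have : Epi ((iA ⊗ₘ iH) ≫ μ[CrossProduct hd]) := hi ▸ inferInstanceAs (Epi (𝟙 (A ⊗ H)))
  rw [← ht, doubleCrossMul_eq, coevalMatrix_eq]
  exact ⟨(inferInstance : HopfObj (CrossProduct hd)), rfl, rfl, rfl, rfl,
    h.isQuasitriangular iH iA t ht hx⟩

theorem IsDualCop.exists_isQuasitriangularHopf (h : IsDualCop H A) :
    ∃ τ' : H ⊗ A ⟶ 𝟙_ C, IsConvInverse (evalPairing H A) τ' ∧
      IsQuasitriangularHopf (doubleCrossMul (evalPairing H A) τ') η[A ⊗ H] Δ[A ⊗ H] ε[A ⊗ H]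
        (coevalMatrix H A) := by
  let t := Units.map h.isSkewPairing.whiskerLeftConv (idUnit A)
  have ht : convHom t.1 = evalPairing H A := by
    change H ◁ 𝟙 A ≫ _ = _
    simp
  refine ⟨convHom (t⁻¹).1, ?_, h.isQuasitriangularHopf t ht⟩
  rw [← ht]
  exact ⟨t.mul_inv, t.inv_mul⟩

end SymmetricDouble

/-! ### The dual Hopf algebra -/

section Dual

variable {C : Type u} [Category.{v} C] [MonoidalCategory C] (H A : C) [ExactPairing H A]

lemma isMate_dualMul [ComonObj H] : IsMate Δ[H] (dualMul H A) := isMate_transpose _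

lemma isMate_dualOne [ComonObj H] : IsMate ε[H] (dualOne H A) := isMate_transpose _

lemma isMate_dualComul [MonObj H] : IsMate μ[H] (dualComul H A) := isMate_transpose _

lemma isMate_dualCounit [MonObj H] : IsMate η[H] (dualCounit H A) := isMate_transpose _

/-- The dual `A = H^*` of a coalgebra as an algebra. -/
abbrev dualMonObj [ComonObj H] : MonObj A where
  one := dualOne H A
  mul := dualMul H A
  one_mul := by
    have h := (isMate_dualMul H A).comp ((isMate_dualOne H A).whiskerLeft (W := H) (W' := A))
    rw [ComonObj.comul_counit] at h
    exact h.unique isMate_rightUnitor_inv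
  mul_one := by
    have h := (isMate_dualMul H A).comp ((isMate_dualOne H A).whiskerRight (W := H) (W' := A))
    rw [ComonObj.counit_comul] at h
    exact h.unique isMate_leftUnitor_inv
  mul_assoc := by
    have hm := isMate_dualMul H A
    have hl := hm.comp (hm.whiskerLeft (W := H) (W' := A))
    have hr := (hm.comp (hm.whiskerRight (W := H) (W' := A))).comp isMate_associator
    rw [Category.assoc, ← ComonObj.comul_assoc] at hr
    exact hl.unique hr

/-- The dual `A = H^*` of an algebra as a coalgebra. -/
abbrev dualComonObj [MonObj H] : ComonObj A where
  counit := dualCounit H A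
  comul := dualComul H A
  counit_comul := by
    have h := ((isMate_dualCounit H A).whiskerLeft (W := H) (W' := A)).comp (isMate_dualComul H A)
    rw [MonObj.mul_one] at h
    exact h.unique isMate_rightUnitor
  comul_counit := by
    have h := ((isMate_dualCounit H A).whiskerRight (W := H) (W' := A)).comp (isMate_dualComul H A)
    rw [MonObj.one_mul] at h
    exact h.unique isMate_leftUnitor
  comul_assoc := by
    have hd := isMate_dualComul H A
    have hr := (isMate_associator_inv.comp (hd.whiskerRight (W := H) (W' := A))).comp hd
    have hl := (hd.whiskerLeft (W := H) (W' := A)).comp hd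
    rw [Category.assoc, MonObj.mul_assoc, Iso.inv_hom_id_assoc] at hr
    rw [← reassoc_of% hr.unique hl, Iso.inv_hom_id, Category.comp_id]

end Dual

section SymmetricDual

variable {C : Type u} [Category.{v} C] [MonoidalCategory C] [SymmetricCategory C]

lemma isMate_tensorμ {X X' Y Y' Z Z' W W' : C} [ExactPairing X X'] [ExactPairing Y Y']
    [ExactPairing Z Z'] [ExactPairing W W'] :
    IsMate (tensorμ X Y Z W) (tensorμ W' Y' Z' X') := by
  have h := (isMate_associator (U := X) (U' := X') (V := Y) (V' := Y') (W := Z ⊗ W)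
    (W' := W' ⊗ Z')).comp <| (isMate_associator_inv.whiskerLeft (W := X) (W' := X')).comp <|
    ((isMate_braiding (U := Y) (U' := Y') (V := Z) (V' := Z')).whiskerRight (W := W)
      (W' := W')).whiskerLeft.comp <| isMate_associator.whiskerLeft.comp isMate_associator_inv
  have e : tensorμ W' Y' Z' X' = 𝟙 _ ⊗≫ (W' ◁ (β_ Y' Z').hom) ▷ X' ⊗≫ 𝟙 _ := by
    rw [tensorμ]; monoidal
  rw [e]
  convert h using 1
  · rw [tensorμ]
  · monoidal

variable (H A : C) [ExactPairing H A]

/-- The dual `A = H^*` of a bialgebra as a bialgebra. -/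
abbrev dualBimonObj [BimonObj H] : BimonObj A where
  __ := dualMonObj H A
  __ := dualComonObj H A
  mul_comul := by
    have hm := isMate_dualMul H A
    have hd := isMate_dualComul H A
    have h := ((hm.tensor hm).comp isMate_tensorμ).comp (hd.tensor hd)
    rw [Category.assoc, ← BimonObj.mul_comul] at h
    exact (hd.comp hm).unique h
  one_comul := by
    have he := isMate_dualOne H A
    have h := (isMate_dualComul H A).comp he
    have h' := (he.tensor he).comp (isMate_leftUnitor (U := 𝟙_ C) (U' := 𝟙_ C))
    rw [BimonObj.mul_counit] at h
    rw [← unitors_inv_equal] at h'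
    exact h.unique h'
  mul_counit := by
    have hc := isMate_dualCounit H A
    have h := hc.comp (isMate_dualMul H A)
    have h' := (isMate_leftUnitor_inv (U := 𝟙_ C) (U' := 𝟙_ C)).comp (hc.tensor hc)
    rw [BimonObj.one_comul] at h
    rw [← unitors_equal] at h'
    exact h.unique h'
  one_counit := by
    have h := (isMate_dualCounit H A).comp (isMate_dualOne H A)
    rw [BimonObj.one_counit] at h
    exact h.unique isMate_id

/-- The dual `A = H^*` of a Hopf algebra as a Hopf algebra. -/
abbrev dualHopfObj [HopfObj H] : HopfObj A where
  __ := dualBimonObj H A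
  antipode := transpose 𝒮[H]
  antipode_left := by
    have hs := isMate_transpose (U' := A) (V' := A) 𝒮[H]
    have h := ((isMate_dualMul H A).comp (hs.whiskerLeft (W := H) (W' := A))).comp
      (isMate_dualComul H A)
    rw [Category.assoc, HopfObj.antipode_right] at h
    exact h.unique ((isMate_dualOne H A).comp (isMate_dualCounit H A))
  antipode_right := by
    have hs := isMate_transpose (U' := A) (V' := A) 𝒮[H]
    have h := ((isMate_dualMul H A).comp (hs.whiskerRight (W := H) (W' := A))).comp
      (isMate_dualComul H A)
    rw [Category.assoc, HopfObj.antipode_left] at h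
    exact h.unique ((isMate_dualOne H A).comp (isMate_dualCounit H A))

end SymmetricDual

noncomputable section CoOpposite

variable {C : Type u} [Category.{v} C] [MonoidalCategory C] [SymmetricCategory C] (H A : C)

/-- The co-opposite bialgebra `H^cop`. -/
abbrev copBimonObj [BimonObj H] : BimonObj H where
  one := η[H]
  mul := μ[H]
  one_mul := MonObj.one_mul H
  mul_one := MonObj.mul_one H
  mul_assoc := MonObj.mul_assoc H
  counit := ε[H]
  comul := copComul Δ[H]
  counit_comul := copComul_counit_left H
  comul_counit := copComul_counit_right H
  comul_assoc := copComul_coassoc H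
  mul_comul := by
    rw [IsMonHom.mul_hom (copComul Δ[H]), MonObj.tensorObj.mul_def]
  one_comul := IsMonHom.one_hom (copComul Δ[H])
  mul_counit := BimonObj.mul_counit H
  one_counit := BimonObj.one_counit H

variable [HopfObj H] [IsIso 𝒮[H]]

lemma copComul_inv_antipode_mul : copComul Δ[H] ≫ inv 𝒮[H] ▷ H ≫ μ[H] = ε[H] ≫ η[H] := by
  have e : μ[H] ≫ 𝒮[H] = _ := HopfObj.mul_antipode H
  rw [← cancel_mono 𝒮[H], copComul]
  simp only [Category.assoc]
  rw [e, ← tensorHom_id, tensorHom_comp_tensorHom_assoc, IsIso.inv_hom_id, Category.id_comp,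
    BraidedCategory.braiding_naturality_assoc, SymmetricCategory.symmetry_assoc, tensorHom_id,
    HopfObj.antipode_left, HopfObj.one_antipode]

lemma copComul_mul_inv_antipode : copComul Δ[H] ≫ H ◁ inv 𝒮[H] ≫ μ[H] = ε[H] ≫ η[H] := by
  have e : μ[H] ≫ 𝒮[H] = _ := HopfObj.mul_antipode H
  rw [← cancel_mono 𝒮[H], copComul]
  simp only [Category.assoc]
  rw [e, ← id_tensorHom, tensorHom_comp_tensorHom_assoc, IsIso.inv_hom_id, Category.id_comp,
    BraidedCategory.braiding_naturality_assoc, SymmetricCategory.symmetry_assoc, id_tensorHom,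
    HopfObj.antipode_right, HopfObj.one_antipode]

/-- The co-opposite Hopf algebra `H^cop`, whose antipode is the inverse of the antipode of `H`. -/
abbrev copHopfObj : HopfObj H where
  __ := copBimonObj H
  antipode := inv 𝒮[H]
  antipode_left := copComul_inv_antipode_mul H
  antipode_right := copComul_mul_inv_antipode H

variable [ExactPairing H A]

/-- The dual of the co-opposite of `H`, which is the opposite of the dual of `H`. -/
abbrev dualCopHopfObj : HopfObj A :=
  letI := copHopfObj H
  dualHopfObj H A

lemma isDualCop_dualCopHopfObj : letI := dualCopHopfObj H A; IsDualCop H A :=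
  letI := dualCopHopfObj H A
  { mul := isMate_transpose (copComul Δ[H])
    one := isMate_transpose ε[H]
    comul := isMate_transpose μ[H]
    counit := isMate_transpose η[H] }

end CoOpposite

/-! ### Hopf modules -/

section HopfModules

variable {C : Type u} [Category.{v} C] [MonoidalCategory C] [BraidedCategory C]

/-- Left Hopf modules over a bimonoid. -/
structure IsHopfModule {H M : C} [BimonObj H] (a : H ⊗ M ⟶ M) (r : M ⟶ H ⊗ M) : Prop where
  act_mul : μ[H] ▷ M ≫ a = (α_ H H M).hom ≫ H ◁ a ≫ a
  act_one : η[H] ▷ M ≫ a = (λ_ M).hom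
  coact_comul : r ≫ H ◁ r = r ≫ Δ[H] ▷ M ≫ (α_ H H M).hom
  coact_counit : r ≫ ε[H] ▷ M = (λ_ M).inv
  compat : a ≫ r = (Δ[H] ⊗ₘ r) ≫ tensorμ H H H M ≫ (μ[H] ⊗ₘ a)

variable {H M : C} [HopfObj H] {a : H ⊗ M ⟶ M} {r : M ⟶ H ⊗ M}

/-- The projection of a Hopf module to its coinvariants. -/
def coinvProj (a : H ⊗ M ⟶ M) (r : M ⟶ H ⊗ M) : M ⟶ M :=
  r ≫ 𝒮[H] ▷ M ≫ a

lemma IsHopfModule.coact_coinvProj_act (h : IsHopfModule a r) :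
    r ≫ H ◁ coinvProj a r ≫ a = 𝟙 M := by
  calc
    _ = (r ≫ H ◁ r) ≫ H ◁ 𝒮[H] ▷ M ≫ (H ◁ a ≫ a) := by
      simp [coinvProj]
    _ = r ≫ (Δ[H] ≫ H ◁ 𝒮[H] ≫ μ[H]) ▷ M ≫ a := by
      have e : H ◁ a ≫ a = (α_ H H M).inv ≫ μ[H] ▷ M ≫ a := by
        rw [h.act_mul, Iso.inv_hom_id_assoc]
      rw [h.coact_comul, e]; monoidal
    _ = (r ≫ ε[H] ▷ M) ≫ η[H] ▷ M ≫ a := by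
      rw [HopfObj.antipode_right, comp_whiskerRight, Category.assoc, Category.assoc]
    _ = _ := by
      rw [h.coact_counit, h.act_one, Iso.inv_hom_id]

lemma whiskerLeft_one_braiding (H : C) [MonObj H] :
    H ◁ η[H] ≫ (β_ H H).hom = (ρ_ H).hom ≫ unitInr H H := by
  rw [BraidedCategory.braiding_naturality_right, braiding_tensorUnit_right, unitInr,
    Category.assoc]

lemma antipode_comul_diagonal_act (a : H ⊗ M ⟶ M) :
    (Δ[H] ▷ M ≫ (α_ H H M).hom) ≫ (𝒮[H] ≫ Δ[H]) ▷ (H ⊗ M) ≫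
      tensorμ H H H M ≫ (μ[H] ⊗ₘ a) =
    𝒮[H] ▷ M ≫ a ≫ unitInr H M := by
  have hl : 𝒮[H] ≫ Δ[H] = _ := HopfObj.antipode_comul H
  have hc : Δ[H] ≫ Δ[H] ▷ H = Δ[H] ≫ H ◁ Δ[H] ≫ (α_ H H H).inv := by
    rw [ComonObj.comul_assoc_assoc, Iso.hom_inv_id, Category.comp_id]
  rw [hl, tensorμ]
  calc
    _ = (Δ[H] ≫ Δ[H] ▷ H) ▷ M ⊗≫ (𝟙 ((H ⊗ H) ⊗ H) ⊗≫ (β_ H H).hom ▷ H ⊗≫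
        (𝒮[H] ▷ (H ⊗ H) ≫ H ◁ (𝒮[H] ▷ H ≫ (β_ H H).hom)) ⊗≫ μ[H] ▷ H) ▷ M ⊗≫ H ◁ a := by
      simp only [MonoidalCategory.tensorHom_def]; monoidal
    _ = (Δ[H] ≫ Δ[H] ▷ H) ▷ M ⊗≫ (𝟙 ((H ⊗ H) ⊗ H) ⊗≫ (β_ H (H ⊗ H)).hom ⊗≫
        ((H ⊗ H) ◁ 𝒮[H] ≫ (𝒮[H] ▷ H ≫ μ[H]) ▷ H)) ▷ M ⊗≫ H ◁ a := by
      rw [BraidedCategory.braiding_naturality_left, ← whisker_exchange,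
        BraidedCategory.braiding_tensor_right_hom]
      monoidal
    _ = Δ[H] ▷ M ⊗≫ (H ◁ (Δ[H] ≫ 𝒮[H] ▷ H ≫ μ[H]) ≫ (β_ H H).hom) ▷ M ⊗≫ H ◁ (𝒮[H] ▷ M ≫ a) := by
      rw [hc, whisker_exchange, BraidedCategory.braiding_naturality_right]
      simp only [comp_whiskerRight Δ[H]]
      rw [comp_whiskerRight, ← BraidedCategory.braiding_naturality_right_assoc]
      monoidal
    _ = (Δ[H] ≫ H ◁ ε[H]) ▷ M ⊗≫ (η[H] ▷ (H ⊗ M) ≫ H ◁ (𝒮[H] ▷ M ≫ a)) := by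
      rw [HopfObj.antipode_left, whiskerLeft_comp, Category.assoc, whiskerLeft_one_braiding,
        unitInr]
      monoidal
    _ = _ := by
      rw [ComonObj.comul_counit, ← whisker_exchange, unitInr]; monoidal

lemma IsHopfModule.coinvProj_coact (h : IsHopfModule a r) :
    coinvProj a r ≫ r = coinvProj a r ≫ unitInr H M := by
  calc
    _ = r ≫ 𝒮[H] ▷ M ≫ (Δ[H] ▷ M ≫ _ ◁ r) ≫
          tensorμ H H H M ≫ (μ[H] ⊗ₘ a) := by
      rw [coinvProj, Category.assoc, Category.assoc, h.compat, MonoidalCategory.tensorHom_def]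
    _ = (r ≫ H ◁ r) ≫ (𝒮[H] ≫ Δ[H]) ▷ (H ⊗ M) ≫
        tensorμ H H H M ≫ (μ[H] ⊗ₘ a) := by
      rw [← whisker_exchange Δ[H], Category.assoc, Category.assoc, ← whisker_exchange_assoc]
      simp
    _ = r ≫ (Δ[H] ▷ M ≫ (α_ H H M).hom) ≫ (𝒮[H] ≫ Δ[H]) ▷ (H ⊗ M) ≫
        tensorμ H H H M ≫ (μ[H] ⊗ₘ a) := by
      rw [h.coact_comul]; simp only [Category.assoc]
    _ = _ := by
      rw [antipode_comul_diagonal_act a, coinvProj]; simp only [Category.assoc]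

lemma IsHopfModule.coinvProj_act_coact (h : IsHopfModule a r) :
    H ◁ coinvProj a r ≫ a ≫ r =
      H ◁ coinvProj a r ≫ Δ[H] ▷ M ≫ (α_ H H M).hom ≫ H ◁ a := by
  calc
    _ = H ◁ (coinvProj a r ≫ r) ≫ Δ[H] ▷ (H ⊗ M) ≫ tensorμ H H H M ≫ (μ[H] ⊗ₘ a) := by
      rw [h.compat, MonoidalCategory.tensorHom_def', whiskerLeft_comp]; simp only [Category.assoc]
    _ = H ◁ coinvProj a r ⊗≫ (H ◁ η[H] ≫ Δ[H] ▷ H) ▷ M ⊗≫ H ◁ (β_ H H).hom ▷ M ⊗≫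
        (μ[H] ⊗ₘ a) := by
      rw [h.coinvProj_coact, unitInr, tensorμ]; monoidal
    _ = H ◁ coinvProj a r ⊗≫ Δ[H] ▷ M ⊗≫ H ◁ (H ◁ η[H] ≫ (β_ H H).hom) ▷ M ⊗≫
        (μ[H] ⊗ₘ a) := by
      rw [whisker_exchange]; monoidal
    _ = H ◁ coinvProj a r ⊗≫ Δ[H] ▷ M ⊗≫ (H ◁ η[H] ≫ μ[H]) ▷ (H ⊗ M) ⊗≫ H ◁ a := by
      rw [whiskerLeft_one_braiding, unitInr, MonoidalCategory.tensorHom_def]; monoidal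
    _ = _ := by
      rw [MonObj.mul_one]; monoidal

lemma IsHopfModule.coinvProj_act_coinvProj (h : IsHopfModule a r) :
    H ◁ coinvProj a r ≫ a ≫ coinvProj a r = H ◁ coinvProj a r ≫ ε[H] ▷ M ≫ (λ_ M).hom := by
  have e := h.coinvProj_act_coact
  calc
    _ = (H ◁ coinvProj a r ≫ a ≫ r) ≫ 𝒮[H] ▷ M ≫ a := by
      conv_lhs => arg 2; arg 2; rw [coinvProj]
      simp only [Category.assoc]
    _ = H ◁ coinvProj a r ≫ Δ[H] ▷ M ≫ (α_ H H M).hom ≫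
        (H ◁ a ≫ 𝒮[H] ▷ M) ≫ a := by
      rw [e]; simp only [Category.assoc]
    _ = H ◁ coinvProj a r ⊗≫ (Δ[H] ≫ 𝒮[H] ▷ H) ▷ M ≫
        ((α_ H H M).hom ≫ H ◁ a ≫ a) := by
      rw [whisker_exchange]; monoidal
    _ = H ◁ coinvProj a r ≫ (Δ[H] ≫ 𝒮[H] ▷ H ≫ μ[H]) ▷ M ≫ a := by
      rw [← h.act_mul]; monoidal
    _ = _ := by
      rw [HopfObj.antipode_left, comp_whiskerRight, Category.assoc, h.act_one]

lemma IsHopfModule.coinvProj_act_coact_coinvProj (h : IsHopfModule a r) :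
    H ◁ coinvProj a r ≫ a ≫ r ≫ H ◁ coinvProj a r = H ◁ coinvProj a r := by
  have e := h.coinvProj_act_coact
  calc
    _ = (H ◁ coinvProj a r ≫ a ≫ r) ≫ H ◁ coinvProj a r := by simp only [Category.assoc]
    _ = (H ◁ coinvProj a r ≫ Δ[H] ▷ M) ≫ (α_ H H M).hom ≫ H ◁ (a ≫ coinvProj a r) := by
      rw [e]; simp only [Category.assoc, whiskerLeft_comp]
    _ = Δ[H] ▷ M ≫ (α_ H H M).hom ≫ H ◁ (H ◁ coinvProj a r ≫ a ≫ coinvProj a r) := by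
      rw [whisker_exchange]; simp
    _ = Δ[H] ▷ M ≫ ((H ⊗ H) ◁ coinvProj a r ≫ (H ◁ ε[H]) ▷ M) ⊗≫ 𝟙 _ := by
      rw [h.coinvProj_act_coinvProj]; monoidal
    _ = (Δ[H] ≫ H ◁ ε[H]) ▷ M ⊗≫ H ◁ coinvProj a r := by
      rw [whisker_exchange]; monoidal
    _ = _ := by
      rw [ComonObj.comul_counit]; monoidal

end HopfModules

section DualModule

variable {C : Type u} [Category.{v} C] [MonoidalCategory C]

/-- The morphism `X ⟶ Z ⊗ A` adjunct to `g : X ⊗ H ⟶ Z`, where `A` is a left dual of `H`. -/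
def curryRight {H A X Z : C} [ExactPairing H A] (g : X ⊗ H ⟶ Z) : X ⟶ Z ⊗ A :=
  𝟙 X ⊗≫ X ◁ η_ H A ⊗≫ g ▷ A

lemma adjunctRight_curryRight {H A X Z : C} [ExactPairing H A] (g : X ⊗ H ⟶ Z) :
    adjunctRight (A := A) (curryRight g) = g := by
  unfold adjunctRight curryRight
  calc
    _ = 𝟙 _ ⊗≫ X ◁ η_ H A ▷ H ⊗≫ (g ▷ (A ⊗ H) ≫ Z ◁ ε_ H A) ⊗≫ 𝟙 Z := by monoidal
    _ = 𝟙 _ ⊗≫ X ◁ (η_ H A ▷ H ⊗≫ H ◁ ε_ H A) ⊗≫ g := by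
      rw [← whisker_exchange]; monoidal
    _ = _ := by rw [ExactPairing.evaluation_coevaluation'']; monoidal

variable (H A : C) [ExactPairing H A]

/-- The regular right action `(f k)(x) = f(k x)` on the dual. -/
def dualTrans [MonObj H] : A ⊗ H ⟶ A :=
  curryRight ((α_ A H H).hom ≫ A ◁ μ[H] ≫ ε_ H A) ≫ (λ_ A).hom

lemma dualTrans_evaluation [MonObj H] :
    dualTrans H A ▷ H ≫ ε_ H A = (α_ A H H).hom ≫ A ◁ μ[H] ≫ ε_ H A := by
  calc
    _ = adjunctRight (A := A) (curryRight ((α_ A H H).hom ≫ A ◁ μ[H] ≫ ε_ H A)) := by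
      rw [dualTrans, adjunctRight]; monoidal
    _ = _ := adjunctRight_curryRight _

lemma dualTrans_mul [MonObj H] : dualTrans H A ▷ H ≫ dualTrans H A =
    (α_ A H H).hom ≫ A ◁ μ[H] ≫ dualTrans H A := by
  have e := dualTrans_evaluation H A
  apply hom_ext_evaluation_left (H := H)
  calc
    _ = (dualTrans H A ▷ H) ▷ H ≫ dualTrans H A ▷ H ≫ ε_ H A := by
      rw [comp_whiskerRight, Category.assoc]
    _ = 𝟙 _ ⊗≫ (dualTrans H A ▷ (H ⊗ H) ≫ A ◁ μ[H]) ≫ ε_ H A := by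
      rw [e]; monoidal
    _ = 𝟙 _ ⊗≫ (A ⊗ H) ◁ μ[H] ≫ dualTrans H A ▷ H ≫ ε_ H A := by
      rw [← whisker_exchange]; monoidal
    _ = 𝟙 _ ⊗≫ A ◁ ((α_ H H H).hom ≫ H ◁ μ[H] ≫ μ[H]) ≫ ε_ H A := by
      rw [e]; monoidal
    _ = ((α_ A H H).hom ≫ A ◁ μ[H]) ▷ H ≫ (α_ A H H).hom ≫ A ◁ μ[H] ≫ ε_ H A := by
      rw [← MonObj.mul_assoc]; monoidal
    _ = _ := by
      rw [← e]; simp only [comp_whiskerRight, Category.assoc]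

lemma dualTrans_one [MonObj H] : A ◁ η[H] ≫ dualTrans H A = (ρ_ A).hom := by
  apply hom_ext_evaluation_left (H := H)
  calc
    _ = 𝟙 _ ⊗≫ A ◁ (η[H] ▷ H ≫ μ[H]) ≫ ε_ H A := by
      rw [comp_whiskerRight, Category.assoc, dualTrans_evaluation]; monoidal
    _ = _ := by
      rw [MonObj.one_mul]; monoidal

/-- The regular coaction `f ↦ f₋₁ ⊗ f₀` on the dual, where `f₋₁ f₀(x) = f(x₁) x₂`. -/
def dualCoact [ComonObj H] : A ⟶ H ⊗ A :=
  curryRight (adjunctLeft Δ[H])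

lemma adjunctRight_dualCoact [ComonObj H] : adjunctRight (dualCoact H A) = adjunctLeft Δ[H] :=
  adjunctRight_curryRight _

lemma dualCoact_comul [ComonObj H] : dualCoact H A ≫ H ◁ dualCoact H A =
    dualCoact H A ≫ Δ[H] ▷ A ≫ (α_ H H A).hom := by
  have e : dualCoact H A ▷ H ⊗≫ H ◁ ε_ H A ⊗≫ 𝟙 H = A ◁ Δ[H] ⊗≫ ε_ H A ▷ H ⊗≫ 𝟙 H :=
    adjunctRight_dualCoact H A
  suffices h : (dualCoact H A ≫ H ◁ dualCoact H A) ≫ (α_ H H A).inv = dualCoact H A ≫ Δ[H] ▷ A by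
    rw [← cancel_mono (α_ H H A).inv, h]; simp
  apply adjunctRight_injective (H := H)
  rw [adjunctRight_comp_whiskerRight, adjunctRight_dualCoact, ← adjunctLeft_comp_whiskerLeft,
    ComonObj.comul_assoc, adjunctRight, adjunctLeft]
  calc
    _ = dualCoact H A ▷ H ⊗≫ H ◁ (dualCoact H A ▷ H ⊗≫ H ◁ ε_ H A ⊗≫ 𝟙 H) ⊗≫ 𝟙 (H ⊗ H) := by
      monoidal
    _ = 𝟙 _ ⊗≫ (dualCoact H A ▷ H ≫ (H ⊗ A) ◁ Δ[H]) ⊗≫ H ◁ ε_ H A ▷ H ⊗≫ 𝟙 (H ⊗ H) := by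
      rw [e]; monoidal
    _ = 𝟙 _ ⊗≫ A ◁ Δ[H] ⊗≫ (dualCoact H A ▷ H ⊗≫ H ◁ ε_ H A ⊗≫ 𝟙 H) ▷ H ⊗≫ 𝟙 (H ⊗ H) := by
      rw [← whisker_exchange]; monoidal
    _ = _ := by
      rw [e]; monoidal

lemma dualCoact_counit [ComonObj H] : dualCoact H A ≫ ε[H] ▷ A = (λ_ A).inv := by
  apply adjunctRight_injective (H := H)
  rw [adjunctRight_comp_whiskerRight, adjunctRight_dualCoact, ← adjunctLeft_comp_whiskerLeft,
    ComonObj.comul_counit, adjunctLeft, adjunctRight]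
  monoidal

end DualModule

/-! ### Invertibility of the antipode -/

section DualHopfModule

variable {C : Type u} [Category.{v} C] [MonoidalCategory C] [SymmetricCategory C]

lemma whiskerLeft_eq_braiding_comp_whiskerRight {X Y : C} (f : X ⟶ 𝟙_ C) :
    Y ◁ f = (β_ Y X).hom ≫ f ▷ Y ≫ (λ_ Y).hom ≫ (ρ_ Y).inv := by
  rw [← BraidedCategory.braiding_naturality_right_assoc, braiding_tensorUnit_right]; simp

lemma braiding_whiskerRight_braiding_whiskerLeft_braiding (X Y Z : C) :
    (β_ X Y).hom ▷ Z ≫ (β_ (Y ⊗ X) Z).hom ≫ Z ◁ (β_ Y X).hom = (β_ (X ⊗ Y) Z).hom := by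
  rw [BraidedCategory.braiding_naturality_left_assoc, ← whiskerLeft_comp,
    SymmetricCategory.symmetry, whiskerLeft_id, Category.comp_id]

lemma antipode_copComul (H : C) [HopfObj H] :
    𝒮[H] ≫ copComul Δ[H] = Δ[H] ≫ 𝒮[H] ▷ H ≫ H ◁ 𝒮[H] := by
  have e : 𝒮[H] ≫ Δ[H] = Δ[H] ≫ (β_ H H).hom ≫ (𝒮[H] ⊗ₘ 𝒮[H]) := HopfObj.antipode_comul H
  rw [copComul, reassoc_of% e, BraidedCategory.braiding_naturality,
    SymmetricCategory.symmetry_assoc, MonoidalCategory.tensorHom_def]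

lemma exists_comp_eq_id_of_whiskerRight {X Y Z M : C} {f : X ⟶ Y} {e : M ⟶ M}
    {φ : Y ⊗ M ⟶ X ⊗ M} {u : 𝟙_ C ⟶ Z ⊗ M} {ψ : Z ⊗ M ⟶ 𝟙_ C}
    (hφ : X ◁ e ≫ f ▷ M ≫ φ = X ◁ e) (hψ : u ≫ Z ◁ e ≫ ψ = 𝟙 (𝟙_ C)) :
    ∃ r : Y ⟶ X, f ≫ r = 𝟙 X := by
  refine ⟨𝟙 Y ⊗≫ Y ◁ (u ≫ Z ◁ e) ⊗≫ (β_ Y Z).hom ▷ M ⊗≫ Z ◁ φ ⊗≫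
    (β_ Z X).hom ▷ M ⊗≫ X ◁ ψ ⊗≫ 𝟙 X, ?_⟩
  calc
    _ = 𝟙 X ⊗≫ (f ▷ (𝟙_ C) ≫ Y ◁ (u ≫ Z ◁ e)) ⊗≫ (β_ Y Z).hom ▷ M ⊗≫
        Z ◁ φ ⊗≫ (β_ Z X).hom ▷ M ⊗≫ X ◁ ψ ⊗≫ 𝟙 X := by monoidal
    _ = 𝟙 X ⊗≫ X ◁ (u ≫ Z ◁ e) ⊗≫ (f ▷ Z ≫ (β_ Y Z).hom) ▷ M ⊗≫
        Z ◁ φ ⊗≫ (β_ Z X).hom ▷ M ⊗≫ X ◁ ψ ⊗≫ 𝟙 X := by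
      rw [← whisker_exchange]; monoidal
    _ = 𝟙 X ⊗≫ X ◁ u ⊗≫ ((X ⊗ Z) ◁ e ≫ (β_ X Z).hom ▷ M) ⊗≫
        Z ◁ (f ▷ M ≫ φ) ⊗≫ (β_ Z X).hom ▷ M ⊗≫ X ◁ ψ ⊗≫ 𝟙 X := by
      rw [BraidedCategory.braiding_naturality_left]; monoidal
    _ = 𝟙 X ⊗≫ X ◁ u ⊗≫ (β_ X Z).hom ▷ M ⊗≫ Z ◁ (X ◁ e ≫ f ▷ M ≫ φ) ⊗≫
        (β_ Z X).hom ▷ M ⊗≫ X ◁ ψ ⊗≫ 𝟙 X := by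
      rw [whisker_exchange]; monoidal
    _ = 𝟙 X ⊗≫ X ◁ u ⊗≫ ((β_ X Z).hom ▷ M ≫ (Z ⊗ X) ◁ e) ⊗≫
        (β_ Z X).hom ▷ M ⊗≫ X ◁ ψ ⊗≫ 𝟙 X := by
      rw [hφ]; monoidal
    _ = 𝟙 X ⊗≫ X ◁ (u ≫ Z ◁ e) ⊗≫ ((β_ X Z).hom ≫ (β_ Z X).hom) ▷ M ⊗≫
        X ◁ ψ ⊗≫ 𝟙 X := by
      rw [← whisker_exchange]; monoidal
    _ = 𝟙 X ⊗≫ X ◁ (u ≫ Z ◁ e ≫ ψ) ⊗≫ 𝟙 X := by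
      rw [SymmetricCategory.symmetry]; monoidal
    _ = _ := by
      rw [hψ]; monoidal

section

variable (H A : C) [ExactPairing H A]

/-- The action `(k f)(x) = f(k x)` of the opposite of a monoid on its dual. -/
def dualActOp [MonObj H] : H ⊗ A ⟶ A := (β_ H A).hom ≫ dualTrans H A

lemma dualActOp_evaluation [MonObj H] : dualActOp H A ▷ H ≫ ε_ H A =
    (β_ H A).hom ▷ H ⊗≫ A ◁ μ[H] ⊗≫ ε_ H A := by
  rw [dualActOp, comp_whiskerRight, Category.assoc, dualTrans_evaluation]; monoidal

lemma dualActOp_mul [MonObj H] : ((β_ H H).hom ≫ μ[H]) ▷ A ≫ dualActOp H A =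
    (α_ H H A).hom ≫ H ◁ dualActOp H A ≫ dualActOp H A := by
  calc
    _ = (β_ H H).hom ▷ A ≫ (β_ (H ⊗ H) A).hom ≫ A ◁ μ[H] ≫ dualTrans H A := by
      rw [dualActOp, comp_whiskerRight, Category.assoc,
        BraidedCategory.braiding_naturality_left_assoc]
    _ = (β_ H H).hom ▷ A ≫ (β_ (H ⊗ H) A).hom ≫ (α_ A H H).inv ≫ dualTrans H A ▷ H ≫
        dualTrans H A := by
      rw [dualTrans_mul, Iso.inv_hom_id_assoc]
    _ = (α_ H H A).hom ≫ H ◁ (β_ H A).hom ≫ (β_ H (A ⊗ H)).hom ≫ dualTrans H A ▷ H ≫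
        dualTrans H A := by
      rw [BraidedCategory.braiding_naturality_left_assoc,
        BraidedCategory.braiding_tensor_right_hom, BraidedCategory.braiding_tensor_left_hom]
      monoidal
    _ = _ := by
      rw [dualActOp, whiskerLeft_comp, Category.assoc,
        ← BraidedCategory.braiding_naturality_right_assoc]

lemma dualActOp_one [MonObj H] : η[H] ▷ A ≫ dualActOp H A = (λ_ A).hom := by
  rw [dualActOp, BraidedCategory.braiding_naturality_left_assoc, dualTrans_one,
    braiding_tensorUnit_left, Category.assoc, Iso.inv_hom_id, Category.comp_id]

lemma adjunctRight_dualCoact_dualActOp [BimonObj H] :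
    adjunctRight (H ◁ dualCoact H A ⊗≫ (β_ H H).hom ▷ A ⊗≫ H ◁ dualActOp H A) =
      (β_ H A).hom ▷ H ⊗≫ A ◁ μ[H] ≫ adjunctLeft Δ[H] := by
  calc
    _ = 𝟙 _ ⊗≫ H ◁ dualCoact H A ▷ H ⊗≫ (β_ H H).hom ▷ (A ⊗ H) ⊗≫
        H ◁ (dualActOp H A ▷ H ≫ ε_ H A) ⊗≫ 𝟙 H := by
      rw [adjunctRight]; monoidal
    _ = 𝟙 _ ⊗≫ (H ◁ dualCoact H A ≫ (β_ H (H ⊗ A)).hom) ▷ H ⊗≫ (H ⊗ A) ◁ μ[H] ⊗≫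
        H ◁ ε_ H A ⊗≫ 𝟙 H := by
      rw [dualActOp_evaluation, BraidedCategory.braiding_tensor_right_hom]; monoidal
    _ = 𝟙 _ ⊗≫ (β_ H A).hom ▷ H ⊗≫ (dualCoact H A ▷ (H ⊗ H) ≫ (H ⊗ A) ◁ μ[H]) ⊗≫
        H ◁ ε_ H A ⊗≫ 𝟙 H := by
      rw [BraidedCategory.braiding_naturality_right]; monoidal
    _ = (β_ H A).hom ▷ H ⊗≫ A ◁ μ[H] ≫ adjunctRight (dualCoact H A) := by
      rw [← whisker_exchange, adjunctRight]; monoidal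
    _ = _ := by
      rw [adjunctRight_dualCoact]

lemma adjunctRight_dualActOp_dualCoact_mul [BimonObj H] {X : C} (f : X ⟶ H ⊗ H) :
    adjunctRight (f ▷ A ⊗≫ H ◁ (dualActOp H A ≫ dualCoact H A) ⊗≫ μ[H] ▷ A) =
      f ▷ A ▷ H ⊗≫ (H ⊗ H ⊗ A) ◁ Δ[H] ⊗≫ H ◁ (β_ H A).hom ▷ (H ⊗ H) ⊗≫
        H ◁ (A ◁ μ[H] ≫ ε_ H A) ▷ H ⊗≫ μ[H] := by
  have e : dualCoact H A ▷ H ⊗≫ H ◁ ε_ H A ⊗≫ 𝟙 H = A ◁ Δ[H] ⊗≫ ε_ H A ▷ H ⊗≫ 𝟙 H :=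
    adjunctRight_dualCoact H A
  calc
    _ = f ▷ A ▷ H ⊗≫ H ◁ dualActOp H A ▷ H ⊗≫
        H ◁ (dualCoact H A ▷ H) ⊗≫ (μ[H] ▷ (A ⊗ H) ≫ H ◁ ε_ H A) ⊗≫ 𝟙 H := by
      rw [adjunctRight]; monoidal
    _ = f ▷ A ▷ H ⊗≫ H ◁ dualActOp H A ▷ H ⊗≫
        H ◁ (dualCoact H A ▷ H ⊗≫ H ◁ ε_ H A ⊗≫ 𝟙 H) ⊗≫ μ[H] := by
      rw [← whisker_exchange]; monoidal
    _ = f ▷ A ▷ H ⊗≫ H ◁ (dualActOp H A ▷ H ≫ A ◁ Δ[H]) ⊗≫ H ◁ ε_ H A ▷ H ⊗≫ μ[H] := by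
      rw [e]; monoidal
    _ = f ▷ A ▷ H ⊗≫ (H ⊗ H ⊗ A) ◁ Δ[H] ⊗≫ H ◁ (dualActOp H A ▷ H ≫ ε_ H A) ▷ H ⊗≫ μ[H] := by
      rw [← whisker_exchange]; monoidal
    _ = _ := by
      rw [dualActOp_evaluation]; monoidal

lemma copComul_braiding_mul_evaluation [BimonObj H] :
    copComul Δ[H] ▷ A ▷ (H ⊗ H) ⊗≫ H ◁ (β_ H A).hom ▷ (H ⊗ H) ⊗≫
        H ◁ (A ◁ μ[H] ≫ ε_ H A) ▷ H ⊗≫ 𝟙 (H ⊗ H) =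
      (β_ H A).hom ▷ (H ⊗ H) ⊗≫ A ◁ Δ[H] ▷ (H ⊗ H) ⊗≫ A ◁ H ◁ (β_ H H).hom ▷ H ⊗≫
        (A ◁ μ[H] ≫ ε_ H A) ▷ (H ⊗ H) ⊗≫ 𝟙 (H ⊗ H) := by
  calc
    _ = Δ[H] ▷ A ▷ (H ⊗ H) ⊗≫ (β_ H H).hom ▷ A ▷ (H ⊗ H) ⊗≫ H ◁ (β_ H A).hom ▷ (H ⊗ H) ⊗≫
        (H ◁ (A ◁ μ[H] ≫ ε_ H A)) ▷ H ⊗≫ 𝟙 (H ⊗ H) := by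
      rw [copComul]; monoidal
    _ = Δ[H] ▷ A ▷ (H ⊗ H) ⊗≫ ((β_ H H).hom ▷ A ≫ (β_ (H ⊗ H) A).hom ≫ A ◁ (β_ H H).hom) ▷
        (H ⊗ H) ⊗≫ A ◁ H ◁ (β_ H H).hom ▷ H ⊗≫ (A ◁ μ[H] ≫ ε_ H A) ▷ (H ⊗ H) ⊗≫
        𝟙 (H ⊗ H) := by
      rw [whiskerLeft_eq_braiding_comp_whiskerRight (Y := H) (A ◁ μ[H] ≫ ε_ H A),
        BraidedCategory.braiding_tensor_right_hom H A (H ⊗ H),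
        BraidedCategory.braiding_tensor_right_hom H H H, BraidedCategory.braiding_tensor_left_hom]
      monoidal
    _ = (Δ[H] ▷ A ≫ (β_ (H ⊗ H) A).hom) ▷ (H ⊗ H) ⊗≫ A ◁ H ◁ (β_ H H).hom ▷ H ⊗≫
        (A ◁ μ[H] ≫ ε_ H A) ▷ (H ⊗ H) ⊗≫ 𝟙 (H ⊗ H) := by
      rw [braiding_whiskerRight_braiding_whiskerLeft_braiding]; monoidal
    _ = _ := by
      rw [BraidedCategory.braiding_naturality_left]; monoidal

lemma adjunctRight_copComul_dualActOp_dualCoact [BimonObj H] :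
    adjunctRight (copComul Δ[H] ▷ A ⊗≫ H ◁ (dualActOp H A ≫ dualCoact H A) ⊗≫ μ[H] ▷ A) =
      (β_ H A).hom ▷ H ⊗≫ A ◁ μ[H] ≫ adjunctLeft Δ[H] := by
  rw [adjunctRight_dualActOp_dualCoact_mul]
  calc
    _ = (copComul Δ[H] ▷ A ▷ H ≫ ((H ⊗ H) ⊗ A) ◁ Δ[H]) ⊗≫ H ◁ (β_ H A).hom ▷ (H ⊗ H) ⊗≫
        H ◁ (A ◁ μ[H] ≫ ε_ H A) ▷ H ⊗≫ μ[H] := by monoidal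
    _ = (H ⊗ A) ◁ Δ[H] ⊗≫ (copComul Δ[H] ▷ A ▷ (H ⊗ H) ⊗≫ H ◁ (β_ H A).hom ▷ (H ⊗ H) ⊗≫
        H ◁ (A ◁ μ[H] ≫ ε_ H A) ▷ H ⊗≫ 𝟙 (H ⊗ H)) ≫ μ[H] := by
      rw [← whisker_exchange]; monoidal
    _ = ((H ⊗ A) ◁ Δ[H] ≫ (β_ H A).hom ▷ (H ⊗ H)) ⊗≫ A ◁ Δ[H] ▷ (H ⊗ H) ⊗≫
        A ◁ H ◁ (β_ H H).hom ▷ H ⊗≫ A ◁ μ[H] ▷ (H ⊗ H) ⊗≫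
        (ε_ H A ▷ (H ⊗ H) ≫ (𝟙_ C) ◁ μ[H]) ⊗≫ 𝟙 H := by
      rw [copComul_braiding_mul_evaluation]; monoidal
    _ = (β_ H A).hom ▷ H ⊗≫ A ◁ ((Δ[H] ⊗ₘ Δ[H]) ≫ tensorμ H H H H ≫ (μ[H] ⊗ₘ μ[H])) ⊗≫
        ε_ H A ▷ H ⊗≫ 𝟙 H := by
      rw [whisker_exchange, ← whisker_exchange (ε_ H A), MonoidalCategory.tensorHom_def',
        MonoidalCategory.tensorHom_def, tensorμ]
      monoidal
    _ = _ := by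
      rw [← BimonObj.mul_comul, adjunctLeft]; monoidal

lemma dualActOp_coact [BimonObj H] :
    H ◁ dualCoact H A ⊗≫ (β_ H H).hom ▷ A ⊗≫ H ◁ dualActOp H A =
      copComul Δ[H] ▷ A ⊗≫ H ◁ (dualActOp H A ≫ dualCoact H A) ⊗≫ μ[H] ▷ A :=
  adjunctRight_injective <| (adjunctRight_dualCoact_dualActOp H A).trans
    (adjunctRight_copComul_dualActOp_dualCoact H A).symm

/-- The action `(h f)(x) = f(S(h) x)` of a Hopf monoid on its dual. -/
def dualAct [HopfObj H] : H ⊗ A ⟶ A := 𝒮[H] ▷ A ≫ dualActOp H A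

lemma mul_dualAct [HopfObj H] :
    μ[H] ▷ A ≫ dualAct H A = (α_ H H A).hom ≫ H ◁ dualAct H A ≫ dualAct H A := by
  have e : μ[H] ≫ 𝒮[H] = _ := HopfObj.mul_antipode H
  calc
    _ = (𝒮[H] ⊗ₘ 𝒮[H]) ▷ A ≫ ((β_ H H).hom ≫ μ[H]) ▷ A ≫ dualActOp H A := by
      rw [dualAct, ← comp_whiskerRight_assoc, e, comp_whiskerRight, Category.assoc]
    _ = (α_ H H A).hom ≫ H ◁ 𝒮[H] ▷ A ≫ (𝒮[H] ▷ (H ⊗ A) ≫ H ◁ dualActOp H A) ≫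
        dualActOp H A := by
      rw [dualActOp_mul, MonoidalCategory.tensorHom_def']; monoidal
    _ = _ := by
      rw [← whisker_exchange, dualAct]; monoidal

lemma one_dualAct [HopfObj H] : η[H] ▷ A ≫ dualAct H A = (λ_ A).hom := by
  rw [dualAct, ← comp_whiskerRight_assoc, HopfObj.one_antipode, dualActOp_one]

lemma diagonal_dualAct [HopfObj H] :
    (Δ[H] ⊗ₘ dualCoact H A) ≫ tensorμ H H H A ≫ (μ[H] ⊗ₘ dualAct H A) =
      Δ[H] ▷ A ⊗≫ H ◁ (𝒮[H] ≫ copComul Δ[H]) ▷ A ⊗≫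
        H ◁ H ◁ (dualActOp H A ≫ dualCoact H A) ⊗≫ H ◁ μ[H] ▷ A ⊗≫ μ[H] ▷ A := by
  calc
    _ = Δ[H] ▷ A ⊗≫ (H ⊗ H) ◁ dualCoact H A ⊗≫ H ◁ (β_ H H).hom ▷ A ⊗≫
        (μ[H] ▷ (H ⊗ A) ≫ H ◁ dualAct H A) := by
      rw [tensorμ, MonoidalCategory.tensorHom_def, MonoidalCategory.tensorHom_def]
      monoidal
    _ = Δ[H] ▷ A ⊗≫ (H ⊗ H) ◁ dualCoact H A ⊗≫ H ◁ ((β_ H H).hom ≫ H ◁ 𝒮[H]) ▷ A ⊗≫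
        H ◁ H ◁ dualActOp H A ⊗≫ μ[H] ▷ A := by
      rw [← whisker_exchange, dualAct]; monoidal
    _ = Δ[H] ▷ A ⊗≫ H ◁ (H ◁ dualCoact H A ≫ 𝒮[H] ▷ (H ⊗ A)) ⊗≫ H ◁ (β_ H H).hom ▷ A ⊗≫
        H ◁ H ◁ dualActOp H A ⊗≫ μ[H] ▷ A := by
      rw [← BraidedCategory.braiding_naturality_left]; monoidal
    _ = Δ[H] ▷ A ⊗≫ H ◁ 𝒮[H] ▷ A ⊗≫
        H ◁ (H ◁ dualCoact H A ⊗≫ (β_ H H).hom ▷ A ⊗≫ H ◁ dualActOp H A) ⊗≫ μ[H] ▷ A := by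
      rw [whisker_exchange]; monoidal
    _ = _ := by
      rw [dualActOp_coact]; monoidal

lemma dualAct_coact [HopfObj H] :
    dualAct H A ≫ dualCoact H A =
      (Δ[H] ⊗ₘ dualCoact H A) ≫ tensorμ H H H A ≫ (μ[H] ⊗ₘ dualAct H A) := by
  rw [diagonal_dualAct, antipode_copComul]
  symm
  calc
    _ = (Δ[H] ≫ H ◁ Δ[H] ≫ (α_ H H H).inv) ▷ A ⊗≫ H ◁ 𝒮[H] ▷ (H ⊗ A) ⊗≫ (H ⊗ H) ◁ 𝒮[H] ▷ A ⊗≫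
        (H ⊗ H) ◁ (dualActOp H A ≫ dualCoact H A) ⊗≫
        ((α_ H H H).hom ≫ H ◁ μ[H] ≫ μ[H]) ▷ A := by
      monoidal
    _ = (Δ[H] ≫ Δ[H] ▷ H) ▷ A ⊗≫ H ◁ 𝒮[H] ▷ (H ⊗ A) ⊗≫
        ((H ⊗ H) ◁ (𝒮[H] ▷ A ≫ dualActOp H A ≫ dualCoact H A) ≫ μ[H] ▷ (H ⊗ A)) ⊗≫
        μ[H] ▷ A := by
      rw [← MonObj.mul_assoc, ComonObj.comul_assoc_assoc, Iso.hom_inv_id, Category.comp_id]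
      monoidal
    _ = (Δ[H] ≫ (Δ[H] ≫ H ◁ 𝒮[H] ≫ μ[H]) ▷ H) ▷ A ⊗≫
        H ◁ (dualAct H A ≫ dualCoact H A) ⊗≫ μ[H] ▷ A := by
      rw [whisker_exchange, dualAct]; monoidal
    _ = (Δ[H] ≫ ε[H] ▷ H) ▷ A ⊗≫ (η[H] ▷ (H ⊗ A) ≫ H ◁ (dualAct H A ≫ dualCoact H A)) ⊗≫
        μ[H] ▷ A := by
      rw [HopfObj.antipode_right]; monoidal
    _ = 𝟙 _ ⊗≫ (dualAct H A ≫ dualCoact H A) ⊗≫ (η[H] ▷ H ≫ μ[H]) ▷ A := by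
      rw [← whisker_exchange, ComonObj.counit_comul]; monoidal
    _ = _ := by
      rw [MonObj.one_mul]; monoidal

lemma isHopfModule_dual [HopfObj H] : IsHopfModule (dualAct H A) (dualCoact H A) where
  act_mul := mul_dualAct H A
  act_one := one_dualAct H A
  coact_comul := dualCoact_comul H A
  coact_counit := dualCoact_counit H A
  compat := dualAct_coact H A

end

lemma exists_antipode_comp_eq_id (H A : C) [ExactPairing H A] [HopfObj H] :
    ∃ r : H ⟶ H, 𝒮[H] ≫ r = 𝟙 H := by
  have hM := isHopfModule_dual H A
  let e := coinvProj (dualAct H A) (dualCoact H A)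
  have unit_counit : dualOne H A ≫ dualCounit H A = 𝟙 (𝟙_ C) := (dualBimonObj H A).one_counit
  have dualAct_eq : 𝒮[H] ▷ A ≫ dualActOp H A ≫ dualCoact H A ≫ H ◁ e =
      dualAct H A ≫ dualCoact H A ≫ H ◁ e := by
    simp only [dualAct, Category.assoc]
  refine exists_comp_eq_id_of_whiskerRight (Z := H) (e := e)
    (φ := dualActOp H A ≫ dualCoact H A ≫ H ◁ e) (u := dualOne H A ≫ dualCoact H A)
    (ψ := dualAct H A ≫ dualCounit H A) ?_ ?_
  · rw [dualAct_eq]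
    exact hM.coinvProj_act_coact_coinvProj
  · have h : dualCoact H A ≫ H ◁ e ≫ dualAct H A = 𝟙 A := hM.coact_coinvProj_act
    rw [Category.assoc, reassoc_of% h, unit_counit]

theorem isIso_antipode (H A : C) [ExactPairing H A] [HopfObj H] : IsIso 𝒮[H] := by
  obtain ⟨r, hr⟩ := exists_antipode_comp_eq_id H A
  obtain ⟨r', hr'⟩ : ∃ r' : H ⟶ H, r' ≫ 𝒮[H] = 𝟙 H := by
    let _ : HopfObj A := dualHopfObj H A
    let _ : ExactPairing A H := BraidedCategory.exactPairing_swap H A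
    obtain ⟨s, hs⟩ := exists_antipode_comp_eq_id A H
    obtain ⟨r', hr'⟩ := exists_isMate (U := H) (V := H) s
    have hm := hr'.comp (isMate_transpose 𝒮[H] (V' := A) (U' := A))
    rw [show transpose 𝒮[H] ≫ s = 𝟙 A from hs] at hm
    exact ⟨r', hm.unique_left isMate_id⟩
  have e : r = r' := by
    rw [← Category.id_comp r, ← hr', Category.assoc, hr, Category.comp_id]
  exact ⟨r, hr, e ▸ hr'⟩

end DualHopfModule

/-! ### Centralizing objects -/

section DoubleBraiding

variable {C : Type u} [Category.{v} C] [MonoidalCategory C] [BraidedCategory C]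

/-- Two objects centralize each other (in the sense of Müger) if their double braiding is
trivial. -/
def Centralizes (X Y : C) : Prop := (β_ X Y).hom ≫ (β_ Y X).hom = 𝟙 (X ⊗ Y)

lemma centralizes_iff {X Y : C} : Centralizes X Y ↔ (β_ Y X).hom = (β_ X Y).inv := by
  rw [Centralizes, ← cancel_epi (β_ X Y).hom, Iso.hom_inv_id]

lemma Centralizes.symm {X Y : C} (h : Centralizes X Y) : Centralizes Y X := by
  rw [Centralizes, centralizes_iff.1 h, Iso.inv_hom_id]

lemma centralizes_tensorUnit (X : C) : Centralizes X (𝟙_ C) := by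
  rw [Centralizes, braiding_tensorUnit_right, braiding_tensorUnit_left]; simp

lemma Centralizes.tensor {X Y Z : C} (h : Centralizes X Y) (h' : Centralizes X Z) :
    Centralizes X (Y ⊗ Z) := by
  unfold Centralizes at *
  rw [BraidedCategory.braiding_tensor_right_hom, BraidedCategory.braiding_tensor_left_hom]
  calc
    _ = 𝟙 _ ⊗≫ (β_ X Y).hom ▷ Z ⊗≫ Y ◁ ((β_ X Z).hom ≫ (β_ Z X).hom) ⊗≫ (β_ Y X).hom ▷ Z ⊗≫
        𝟙 _ := by monoidal
    _ = 𝟙 _ ⊗≫ ((β_ X Y).hom ≫ (β_ Y X).hom) ▷ Z ⊗≫ 𝟙 _ := by rw [h']; monoidal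
    _ = _ := by rw [h]; monoidal

lemma coevaluation_braiding_inv (X X' Y : C) [ExactPairing X X'] :
    Y ◁ η_ X X' ⊗≫ (β_ X Y).inv ▷ X' ⊗≫ 𝟙 (X ⊗ Y ⊗ X') =
      𝟙 _ ⊗≫ η_ X X' ▷ Y ⊗≫ X ◁ (β_ X' Y).hom ⊗≫ 𝟙 (X ⊗ Y ⊗ X') := by
  have naturality : Y ◁ η_ X X' ≫ (β_ (X ⊗ X') Y).inv = _ :=
    BraidedCategory.braiding_inv_naturality_right Y (η_ X X')
  rw [braiding_inv_tensorUnit_left, BraidedCategory.braiding_tensor_left_inv] at naturality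
  calc
    _ = Y ◁ η_ X X' ⊗≫ (β_ X Y).inv ▷ X' ⊗≫ X ◁ ((β_ X' Y).inv ≫ (β_ X' Y).hom) ⊗≫
        𝟙 _ := by rw [Iso.inv_hom_id]; monoidal
    _ = (Y ◁ η_ X X' ≫ (α_ Y X X').inv ≫ (β_ X Y).inv ▷ X' ≫ (α_ X Y X').hom ≫
        X ◁ (β_ X' Y).inv ≫ (α_ X X' Y).inv) ⊗≫ X ◁ (β_ X' Y).hom ⊗≫ 𝟙 _ := by monoidal
    _ = _ := by rw [naturality]; monoidal

lemma braiding_dual_eq (X X' Y : C) [ExactPairing X X'] :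
    (β_ X' Y).hom =
      𝟙 (X' ⊗ Y) ⊗≫ X' ◁ (Y ◁ η_ X X' ⊗≫ (β_ X Y).inv ▷ X' ⊗≫ 𝟙 (X ⊗ Y ⊗ X')) ⊗≫
        ε_ X X' ▷ (Y ⊗ X') ⊗≫ 𝟙 (Y ⊗ X') := by
  symm
  calc
    _ = 𝟙 (X' ⊗ Y) ⊗≫ X' ◁ η_ X X' ▷ Y ⊗≫ ((X' ⊗ X) ◁ (β_ X' Y).hom ≫ ε_ X X' ▷ (Y ⊗ X')) ⊗≫
        𝟙 (Y ⊗ X') := by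
      rw [coevaluation_braiding_inv]; monoidal
    _ = 𝟙 (X' ⊗ Y) ⊗≫ (X' ◁ η_ X X' ⊗≫ ε_ X X' ▷ X') ▷ Y ⊗≫ (β_ X' Y).hom := by
      rw [whisker_exchange]; monoidal
    _ = _ := by
      rw [ExactPairing.coevaluation_evaluation'']; monoidal

lemma Centralizes.doubleBraiding_evaluation {X X' Y : C} [ExactPairing X X']
    (h : Centralizes X Y) :
    ((β_ X' Y).hom ≫ (β_ Y X').hom) ▷ X ⊗≫ X' ◁ (β_ X Y).inv ⊗≫ ε_ X X' ▷ Y ⊗≫ 𝟙 Y =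
      𝟙 _ ⊗≫ X' ◁ (β_ X Y).inv ⊗≫ ε_ X X' ▷ Y ⊗≫ 𝟙 Y := by
  have naturality : (β_ (X' ⊗ X) Y).hom ≫ (β_ Y (X' ⊗ X)).hom ≫ ε_ X X' ▷ Y = ε_ X X' ▷ Y := by
    rw [← BraidedCategory.braiding_naturality_right,
      ← BraidedCategory.braiding_naturality_left_assoc, (centralizes_tensorUnit Y).symm,
      Category.comp_id]
  rw [BraidedCategory.braiding_tensor_left_hom, BraidedCategory.braiding_tensor_right_hom,
    centralizes_iff.1 h] at naturality
  simp only [Category.assoc] at naturality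
  calc
    _ = 𝟙 _ ⊗≫ X' ◁ ((β_ X Y).inv ≫ (β_ X Y).hom) ⊗≫ ((β_ X' Y).hom ≫ (β_ Y X').hom) ▷ X ⊗≫
        X' ◁ (β_ X Y).inv ⊗≫ ε_ X X' ▷ Y ⊗≫ 𝟙 Y := by
      rw [Iso.inv_hom_id]; monoidal
    _ = 𝟙 _ ⊗≫ X' ◁ (β_ X Y).inv ⊗≫ ((α_ X' X Y).hom ≫ X' ◁ (β_ X Y).hom ≫ (α_ X' Y X).inv ≫
        (β_ X' Y).hom ▷ X ≫ (α_ Y X' X).hom ≫ (α_ Y X' X).inv ≫ (β_ Y X').hom ▷ X ≫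
        (α_ X' Y X).hom ≫ X' ◁ (β_ X Y).inv ≫ (α_ X' X Y).inv ≫ ε_ X X' ▷ Y) ⊗≫ 𝟙 Y := by
      monoidal
    _ = _ := by
      rw [naturality]

lemma Centralizes.dual {X X' Y : C} [ExactPairing X X'] (h : Centralizes X Y) :
    Centralizes X' Y := by
  rw [Centralizes, ← cancel_mono (β_ X' Y).hom, Category.id_comp]
  set m := (β_ X' Y).hom ≫ (β_ Y X').hom with hm
  calc
    _ = 𝟙 _ ⊗≫ (m ▷ (𝟙_ C) ≫ (X' ⊗ Y) ◁ η_ X X') ⊗≫ X' ◁ (β_ X Y).inv ▷ X' ⊗≫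
        ε_ X X' ▷ (Y ⊗ X') ⊗≫ 𝟙 (Y ⊗ X') := by
      conv_lhs => rw [braiding_dual_eq X X' Y]
      monoidal
    _ = 𝟙 _ ⊗≫ (X' ⊗ Y) ◁ η_ X X' ⊗≫ (m ▷ X ⊗≫ X' ◁ (β_ X Y).inv ⊗≫ ε_ X X' ▷ Y ⊗≫ 𝟙 Y) ▷ X' ⊗≫
        𝟙 (Y ⊗ X') := by
      rw [← whisker_exchange]; monoidal
    _ = 𝟙 (X' ⊗ Y) ⊗≫ X' ◁ (Y ◁ η_ X X' ⊗≫ (β_ X Y).inv ▷ X' ⊗≫ 𝟙 (X ⊗ Y ⊗ X')) ⊗≫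
        ε_ X X' ▷ (Y ⊗ X') ⊗≫ 𝟙 (Y ⊗ X') := by
      rw [hm, h.doubleBraiding_evaluation]; monoidal
    _ = _ := (braiding_dual_eq X X' Y).symm

/-- The objects generated by `H` and `A` under tensor products. -/
inductive tensorClosure (H A : C) : ObjectProperty C
  | fst : tensorClosure H A H
  | snd : tensorClosure H A A
  | unit : tensorClosure H A (𝟙_ C)
  | tensor (X Y : C) (hX : tensorClosure H A X) (hY : tensorClosure H A Y) :
    tensorClosure H A (X ⊗ Y)

instance (H A : C) : (tensorClosure H A).IsMonoidal where
  prop_unit := .unit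
  prop_tensor := .tensor

lemma Centralizes.of_tensorClosure {H A Z W : C} (hW : tensorClosure H A W)
    (hH : Centralizes Z H) (hA : Centralizes Z A) : Centralizes Z W := by
  induction hW with
  | fst => exact hH
  | snd => exact hA
  | unit => exact centralizes_tensorUnit Z
  | tensor _ _ _ _ hX hY => exact hX.tensor hY

lemma tensorClosure.centralizes {H A : C} [ExactPairing H A] (hH : Centralizes H H) {X Y : C}
    (hX : tensorClosure H A X) (hY : tensorClosure H A Y) : Centralizes X Y := by
  have hA : Centralizes A H := hH.dual
  have hXH : Centralizes X H := (Centralizes.of_tensorClosure hX hH hA.symm).symm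
  have hXA : Centralizes X A := (Centralizes.of_tensorClosure hX hA hA.symm.dual).symm
  exact .of_tensorClosure hY hXH hXA

end DoubleBraiding

/-! ### Hopf algebras in full subcategories -/

section FullSubcategory

variable {C : Type u} [Category.{v} C] [MonoidalCategory C] [BraidedCategory C]
  {P : ObjectProperty C} [P.IsMonoidal]

/-- A monoidal full subcategory of pairwise centralizing objects is symmetric. -/
abbrev symmetricSubcategory (h : ∀ X Y : C, P X → P Y → Centralizes X Y) :
    SymmetricCategory P.FullSubcategory where
  symmetry X Y := ObjectProperty.hom_ext _ (h X.obj Y.obj X.property Y.property)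

/-- The Hopf monoid of a monoidal full subcategory given by a Hopf monoid of the ambient
category. -/
abbrev liftHopfObj (X : P.FullSubcategory) [HopfObj X.obj] : HopfObj X where
  one := ObjectProperty.homMk η[X.obj]
  mul := ObjectProperty.homMk μ[X.obj]
  counit := ObjectProperty.homMk ε[X.obj]
  comul := ObjectProperty.homMk Δ[X.obj]
  antipode := ObjectProperty.homMk 𝒮[X.obj]
  one_mul := ObjectProperty.hom_ext _ (MonObj.one_mul X.obj)
  mul_one := ObjectProperty.hom_ext _ (MonObj.mul_one X.obj)
  mul_assoc := ObjectProperty.hom_ext _ (MonObj.mul_assoc X.obj)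
  counit_comul := ObjectProperty.hom_ext _ (ComonObj.counit_comul X.obj)
  comul_counit := ObjectProperty.hom_ext _ (ComonObj.comul_counit X.obj)
  comul_assoc := ObjectProperty.hom_ext _ (ComonObj.comul_assoc X.obj)
  mul_comul := ObjectProperty.hom_ext _ (BimonObj.mul_comul X.obj)
  one_comul := ObjectProperty.hom_ext _ (BimonObj.one_comul X.obj)
  mul_counit := ObjectProperty.hom_ext _ (BimonObj.mul_counit X.obj)
  one_counit := ObjectProperty.hom_ext _ (BimonObj.one_counit X.obj)
  antipode_left := ObjectProperty.hom_ext _ (HopfObj.antipode_left X.obj)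
  antipode_right := ObjectProperty.hom_ext _ (HopfObj.antipode_right X.obj)

/-- The Hopf monoid of the ambient category underlying a Hopf monoid of a monoidal full
subcategory. -/
abbrev underlyingHopfObj (X : P.FullSubcategory) [HopfObj X] : HopfObj X.obj where
  one := η[X].hom
  mul := μ[X].hom
  counit := ε[X].hom
  comul := Δ[X].hom
  antipode := 𝒮[X].hom
  one_mul := congrArg (·.hom) (MonObj.one_mul X)
  mul_one := congrArg (·.hom) (MonObj.mul_one X)
  mul_assoc := congrArg (·.hom) (MonObj.mul_assoc X)
  counit_comul := congrArg (·.hom) (ComonObj.counit_comul X)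
  comul_counit := congrArg (·.hom) (ComonObj.comul_counit X)
  comul_assoc := congrArg (·.hom) (ComonObj.comul_assoc X)
  mul_comul := congrArg (·.hom) (BimonObj.mul_comul X)
  one_comul := congrArg (·.hom) (BimonObj.one_comul X)
  mul_counit := congrArg (·.hom) (BimonObj.mul_counit X)
  one_counit := congrArg (·.hom) (BimonObj.one_counit X)
  antipode_left := congrArg (·.hom) (HopfObj.antipode_left X)
  antipode_right := congrArg (·.hom) (HopfObj.antipode_right X)

/-- The exact pairing in a monoidal full subcategory given by an exact pairing in the ambient
category. -/
abbrev liftExactPairing (X Y : P.FullSubcategory) [ExactPairing X.obj Y.obj] :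
    ExactPairing X Y where
  coevaluation' := ObjectProperty.homMk (η_ X.obj Y.obj)
  evaluation' := ObjectProperty.homMk (ε_ X.obj Y.obj)
  coevaluation_evaluation' :=
    ObjectProperty.hom_ext _ (ExactPairing.coevaluation_evaluation X.obj Y.obj)
  evaluation_coevaluation' :=
    ObjectProperty.hom_ext _ (ExactPairing.evaluation_coevaluation X.obj Y.obj)

/-- The exact pairing of the ambient category underlying an exact pairing in a monoidal full
subcategory. -/
abbrev underlyingExactPairing (X Y : P.FullSubcategory) [ExactPairing X Y] :
    ExactPairing X.obj Y.obj where
  coevaluation' := (η_ X Y).hom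
  evaluation' := (ε_ X Y).hom
  coevaluation_evaluation' := congrArg (·.hom) (ExactPairing.coevaluation_evaluation X Y)
  evaluation_coevaluation' := congrArg (·.hom) (ExactPairing.evaluation_coevaluation X Y)

attribute [local instance] underlyingHopfObj underlyingExactPairing

variable {H A D : P.FullSubcategory}

lemma IsDualOp.underlying [HopfObj H] [HopfObj A] [ExactPairing H A] (h : IsDualOp H A) :
    IsDualOp H.obj A.obj where
  mul_eq := congrArg (·.hom) h.mul_eq
  one_eq := congrArg (·.hom) h.one_eq
  comul_eq := congrArg (·.hom) h.comul_eq
  counit_eq := congrArg (·.hom) h.counit_eq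

lemma IsSkewPairing.underlying [HopfObj H] [HopfObj A] {τ : H ⊗ A ⟶ 𝟙_ P.FullSubcategory}
    (h : IsSkewPairing τ) : IsSkewPairing (H := H.obj) (A := A.obj) τ.hom where
  mul_left := congrArg (·.hom) h.mul_left
  mul_right := congrArg (·.hom) h.mul_right
  one_left := congrArg (·.hom) h.one_left
  one_right := congrArg (·.hom) h.one_right

lemma IsSymmetricPairing.underlying {τ : H ⊗ A ⟶ 𝟙_ P.FullSubcategory}
    (h : IsSymmetricPairing τ) : IsSymmetricPairing (V := H.obj) (W := A.obj) τ.hom := by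
  unfold IsSymmetricPairing IsSymmetricAt at *
  exact ⟨congrArg (·.hom) h.1, congrArg (·.hom) h.2⟩

lemma IsConvInverse.underlying [HopfObj H] [HopfObj A] {τ τ' : H ⊗ A ⟶ 𝟙_ P.FullSubcategory}
    (h : IsConvInverse τ τ') :
    IsConvInverse (X := H.obj ⊗ A.obj) (Y := 𝟙_ C) τ.hom τ'.hom :=
  ⟨congrArg (·.hom) h.1, congrArg (·.hom) h.2⟩

attribute [local instance] ComonObj.instTensorUnit in
lemma IsQuasitriangular.underlying [HopfObj D] {R : 𝟙_ P.FullSubcategory ⟶ D ⊗ D}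
    (h : IsQuasitriangular D R) : IsQuasitriangular D.obj R.hom where
  invertible := h.invertible.imp' (·.hom) fun _ h ↦
    ⟨congrArg (·.hom) h.1, congrArg (·.hom) h.2⟩
  coassoc := congrArg (·.hom) h.coassoc
  counit_left := congrArg (·.hom) h.counit_left
  counit_right := congrArg (·.hom) h.counit_right
  qt1 := congrArg (·.hom) h.qt1
  qt2 := congrArg (·.hom) h.qt2
  qt3 := congrArg (·.hom) h.qt3

lemma IsQuasitriangularHopf.underlying {m : D ⊗ D ⟶ D} {e : 𝟙_ P.FullSubcategory ⟶ D}
    {δ : D ⟶ D ⊗ D} {c : D ⟶ 𝟙_ P.FullSubcategory} {R : 𝟙_ P.FullSubcategory ⟶ D ⊗ D}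
    (h : IsQuasitriangularHopf m e δ c R) :
    IsQuasitriangularHopf (D := D.obj) m.hom e.hom δ.hom c.hom R.hom := by
  obtain ⟨_, rfl, rfl, rfl, rfl, h⟩ := h
  exact ⟨underlyingHopfObj D, rfl, rfl, rfl, rfl, h.underlying⟩

end FullSubcategory

theorem exists_drinfeldDouble {C : Type u} [Category.{v} C] [MonoidalCategory C]
    [SymmetricCategory C] (H A : C) [HopfObj H] [ExactPairing H A] :
    ∃ _ : HopfObj A, IsDualOp H A ∧ IsSkewPairing (evalPairing H A) ∧
      IsSymmetricPairing (evalPairing H A) ∧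
      ∃ τ' : H ⊗ A ⟶ 𝟙_ C, IsConvInverse (evalPairing H A) τ' ∧
        IsQuasitriangularHopf (doubleCrossMul (evalPairing H A) τ')
          η[A ⊗ H] Δ[A ⊗ H] ε[A ⊗ H] (coevalMatrix H A) := by
  have := isIso_antipode H A
  let _ := dualCopHopfObj H A
  have h := isDualCop_dualCopHopfObj H A
  exact ⟨_, h.isDualOp, h.isSkewPairing, isSymmetricPairing_evalPairing,
    h.exists_isQuasitriangularHopf⟩

end BraidedDouble

theorem theorem3p2 {C : Type u} [Category.{v} C] [MonoidalCategory C] [BraidedCategory C]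
    (H A : C) [HopfObj H] [ExactPairing H A]
    (hH : (β_ H H).hom = (β_ H H).inv) :
    ∃ _ : HopfObj A, BraidedDouble.IsDualOp H A ∧
      BraidedDouble.IsSkewPairing (BraidedDouble.evalPairing H A) ∧
      BraidedDouble.IsSymmetricPairing (BraidedDouble.evalPairing H A) ∧
      ∃ τ' : H ⊗ A ⟶ 𝟙_ C,
        BraidedDouble.IsConvInverse (BraidedDouble.evalPairing H A) τ' ∧
        BraidedDouble.IsQuasitriangularHopf
          (BraidedDouble.doubleCrossMul (BraidedDouble.evalPairing H A) τ')
          η[A ⊗ H] Δ[A ⊗ H] ε[A ⊗ H]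
          (BraidedDouble.coevalMatrix H A) := by
  let P := BraidedDouble.tensorClosure H A
  let H' : P.FullSubcategory := ⟨H, .fst⟩
  let A' : P.FullSubcategory := ⟨A, .snd⟩
  have hHH : BraidedDouble.Centralizes H H := BraidedDouble.centralizes_iff.2 hH
  let _ : SymmetricCategory P.FullSubcategory :=
    BraidedDouble.symmetricSubcategory fun _ _ hX hY ↦ hX.centralizes hHH hY
  let _ : HopfObj H'.obj := ‹HopfObj H›
  let _ : ExactPairing H'.obj A'.obj := ‹ExactPairing H A›
  let _ : HopfObj H' := BraidedDouble.liftHopfObj H'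
  let _ : ExactPairing H' A' := BraidedDouble.liftExactPairing H' A'
  obtain ⟨_, hDual, hSkew, hSymm, τ', hInv, hDouble⟩ := BraidedDouble.exists_drinfeldDouble H' A'
  exact ⟨BraidedDouble.underlyingHopfObj A', hDual.underlying, hSkew.underlying,
    hSymm.underlying, τ'.hom, hInv.underlying, hDouble.underlying⟩
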